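/- Fix an integer $d\ge 1$ and let $\Sigma=\{0,\dots,d-1\}$. A tree over a finite alphabet $A$ is a map $t\colon\Sigma^*\to A$; a block of height $h\ge 0$ over $A$ is a map from the set of words of length $<h$ over $\Sigma$ to $A$, and it occurs in $t$ at the node $x$ if it is $w\mapsto t(xw)$. A tree-shift of finite type is the set of all trees over $A$ in which no block of a given finite set of blocks occurs. Two sets of trees $X,Y$ (tree-shifts) are conjugate if there is a bijection $X\to Y$ which, together with its inverse, is a sliding block code (i.e. the label of the image at a node $x$ is a function of the block of some fixed height at $x$). The Hom tree-shift of a finite undirected simple graph $G$ (loops allowed) is the set of trees labelled by vertices of $G$ such that the labels of any node and of any of its children are joined by an edge of $G$. A (top-down) tree automaton $\mathcal A=(Q,\Delta)$ over $A$ has a finite set $Q$ of states and a finite set $\Delta$ of transitions $(p,a)\to(q_0,\dots,q_{d-1})$, with $p,q_i\in Q$, $a\in A$. It accepts a tree $t$ if there is $u\colon\Sigma^*\to Q$ such that $(u_x,t_x)\to(u_{x0},\dots,u_{x(d-1)})$ is in $\Delta$ for every $x\in\Sigma^*$; $X_{\mathcal A}$ is the set of accepted trees. $\mathcal A$ is trim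 if each state has an outgoing transition. It is an edge tree automaton if distinct transitions have distinct labels; then $X_{\mathcal A}$ is called an edge tree-shift, and $M_{p,v}$ denotes the number of transitions from the state $p$ to the tuple $v\in Q^d$. Two states $q,q'$ of an edge tree automaton can be merged if any two columns of $M$ whose indices in $Q^d$ differ only in having $q$, respectively $q'$, at one same position are identical. A general amalgamation of $\mathcal A$ is an edge tree automaton obtained by merging the states of each class of a partition of $Q$ such that any two states of a class can be merged: the rows of each class are added and one column is kept for each $d$-tuple of classes (labels and states being taken up to renaming). A total amalgamation of $\mathcal A$ is an edge tree automaton obtained from $\mathcal A$ by a finite sequence of general amalgamations, no two distinct states of which can be merged. An edge tree automaton with matrix $M$ is regular if for each state $p$: (i) if $M_{p,v}>0$ and $M_{p,w}>0$, then $M_{p,u}>0$ for every $u\in Q^d$ all of whose entries are entries of $v$ or $w$; (ii) the nonzero entries of row $p$ are equal; (iii) if $M_{p,v}>0$, then $M_{v_i,(p,\dots,p)}>0$ for every $i\in\Sigma$. **Proposition.** 1. It is decidable whether the edge tree-shift of a given edge tree automaton is conjugate to a Hom tree-shift. 2. It is decidable whether the tree-shift of finite type given by a finite alphabet and a finite list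 of forbidden blocks is conjugate to a Hom tree-shift. 3. Every trim edge tree automaton $\mathcal A$ has a total amalgamation, and for every total amalgamation $\mathcal B$ of $\mathcal A$, the tree-shift $X_{\mathcal A}$ is conjugate to a Hom tree-shift if and only if $\mathcal B$ is regular. 4. There is an algorithm that, given a trim edge tree automaton $\mathcal A$ with $n$ states over an alphabet of $k$ letters by the list of its transitions, decides whether the total amalgamation of $\mathcal A$ is regular, in time and space bounded by a polynomial in $n+k+|\Delta|$. -/

import Mathlib

namespace TreeShift

/-! ### Trees, blocks, tree-shifts and conjugacy -/

/-- Infinite `d`-ary trees labelled on `A`: nodes are words over `{0, …, d-1}`, the root is the empty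
word and the `i`-th child of the node `x` is `x ++ [i]`. -/
abbrev LTree (d : ℕ) (A : Type) : Type := List (Fin d) → A

/-- Blocks of height `h`: labellings of the words of length less than `h` (the block of height `0` is
the empty block). -/
abbrev Block (d : ℕ) (A : Type) (h : ℕ) : Type := {w : List (Fin d) // w.length < h} → A

/-- The block of height `h` of `t` rooted at the node `x`. -/
def blockAt {d : ℕ} {A : Type} (t : LTree d A) (h : ℕ) (x : List (Fin d)) : Block d A h :=
  fun w => t (x ++ w.1)

/-- The blocks of height `h` of all trees of `X`. -/
def blocks {d : ℕ} {A : Type} (X : Set (LTree d A)) (h : ℕ) : Set (Block d A h) :=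
  {b | ∃ t ∈ X, ∃ x, blockAt t h x = b}

/-- The tree-shift `X_F` of the trees that avoid every block of `F`
(`F h` is the set of the forbidden blocks of height `h`). -/
def avoiding {d : ℕ} {A : Type} (F : (h : ℕ) → Set (Block d A h)) : Set (LTree d A) :=
  {t | ∀ h x, blockAt t h x ∉ F h}

/-- `φ : X → Y` is the sliding block code of some block map `f` on the blocks of height `n` of `X`. -/
def IsSlidingBlockCode {d : ℕ} {A B : Type} {X : Set (LTree d A)} {Y : Set (LTree d B)}
    (φ : X → Y) : Prop :=
  ∃ (n : ℕ) (f : blocks X n → B), ∀ (t : X) (x : List (Fin d)),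
    (φ t).1 x = f ⟨blockAt t.1 n x, t.1, t.2, x, rfl⟩

/-- `X` and `Y` are conjugate: there is an invertible sliding block code from `X` onto `Y`
(whose inverse is a sliding block code). -/
def Conjugate {d : ℕ} {A B : Type} (X : Set (LTree d A)) (Y : Set (LTree d B)) : Prop :=
  ∃ φ : X ≃ Y, IsSlidingBlockCode φ ∧ IsSlidingBlockCode φ.symm

/-- The Hom tree-shift of the graph with vertex set `V` and edge relation `E`. -/
def homShift (d : ℕ) {V : Type} (E : V → V → Prop) : Set (LTree d V) :=
  {t | ∀ (x : List (Fin d)) (i : Fin d), E (t x) (t (x ++ [i]))}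

/-- `X` is conjugate to the Hom tree-shift of some finite simple undirected graph, loops allowed,
that is, of some symmetric relation on a finite set. -/
def IsConjugateToHom {d : ℕ} {A : Type} (X : Set (LTree d A)) : Prop :=
  ∃ (V : Type) (_ : Finite V) (E : V → V → Prop),
    (∀ u v, E u v → E v u) ∧ Conjugate X (homShift d E)

end TreeShift

/-! ### Top-down tree automata -/

/-- A top-down tree automaton on `d`-ary trees; `trans p a v` is the transition
`(p, a) → (v 0, …, v (d-1))`. -/
structure TreeAutomaton (d : ℕ) where
  Q : Type
  A : Type
  [fintypeQ : Fintype Q]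
  [decidableEqQ : DecidableEq Q]
  [finiteA : Finite A]
  trans : Q → A → (Fin d → Q) → Prop

namespace TreeAutomaton

attribute [instance] TreeAutomaton.fintypeQ TreeAutomaton.decidableEqQ TreeAutomaton.finiteA

variable {d : ℕ}

/-- The trees accepted by the automaton; `u` is the computation tree. -/
def shift (𝒜 : TreeAutomaton d) : Set (TreeShift.LTree d 𝒜.A) :=
  {t | ∃ u : TreeShift.LTree d 𝒜.Q, ∀ x, 𝒜.trans (u x) (t x) (fun i => u (x ++ [i]))}

/-- Every state has an outgoing transition. -/
def IsTrim (𝒜 : TreeAutomaton d) : Prop := ∀ p, ∃ a v, 𝒜.trans p a v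

/-- Edge tree automata: distinct transitions have distinct labels. -/
def IsEdge (𝒜 : TreeAutomaton d) : Prop :=
  ∀ a p v p' v', 𝒜.trans p a v → 𝒜.trans p' a v' → p = p' ∧ v = v'

/-- The transition matrix: the number of transitions from `p` to `v`. -/
noncomputable def mat (𝒜 : TreeAutomaton d) (p : 𝒜.Q) (v : Fin d → 𝒜.Q) : ℕ :=
  {a | 𝒜.trans p a v}.ncard

/-- Columns of the transition matrix whose indices differ only by `q` and `q'` standing at the same
place are identical. For `d = 2`: the columns `(q, r)` and `(q', r)` are identical, and so are the
columns `(r, q)` and `(r, q')`, for each state `r`. -/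
def SameColumns (𝒜 : TreeAutomaton d) (q q' : 𝒜.Q) : Prop :=
  ∀ (p : 𝒜.Q) (i : Fin d) (v : Fin d → 𝒜.Q),
    𝒜.mat p (Function.update v i q) = 𝒜.mat p (Function.update v i q')

/-- `ℬ` is obtained from `𝒜` by merging the states of each class of a partition of the states
(the fibres of `π`) any two members of which have the same columns: the rows of each class are
summed, and one column is kept for each tuple of classes. -/
def IsGeneralAmalgamation (𝒜 ℬ : TreeAutomaton d) : Prop :=
  ℬ.IsEdge ∧ ∃ π : 𝒜.Q → ℬ.Q, Function.Surjective π ∧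
    (∀ q q', π q = π q' → 𝒜.SameColumns q q') ∧
    ∀ (P : ℬ.Q) (v : Fin d → 𝒜.Q),
      ℬ.mat P (π ∘ v) = ∑ p ∈ Finset.univ.filter (fun p => π p = P), 𝒜.mat p v

/-- `ℬ` is a total amalgamation of `𝒜`: it is obtained from `𝒜` by successive amalgamations, and no
two distinct states of `ℬ` can be merged. -/
def IsTotalAmalgamation (𝒜 ℬ : TreeAutomaton d) : Prop :=
  Relation.ReflTransGen IsGeneralAmalgamation 𝒜 ℬ ∧ ∀ q q', ℬ.SameColumns q q' → q = q'

/-- Regular edge tree automata. -/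
structure IsRegular (𝒜 : TreeAutomaton d) : Prop where
  pos_of_mem : ∀ p v w u, 0 < 𝒜.mat p v → 0 < 𝒜.mat p w →
    (∀ i, u i ∈ Set.range v ∪ Set.range w) → 0 < 𝒜.mat p u
  eq_of_pos : ∀ p v w, 0 < 𝒜.mat p v → 0 < 𝒜.mat p w → 𝒜.mat p v = 𝒜.mat p w
  back : ∀ p v, 0 < 𝒜.mat p v → ∀ i, 0 < 𝒜.mat (v i) (fun _ => p)

end TreeAutomaton

/-! ### Finite descriptions of automata and of tree-shifts of finite type -/

namespace TreeShift

/-- A numerical description of a transition. -/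
def transCode {d n k : ℕ} (e : Fin n × Fin k × (Fin d → Fin n)) : ℕ × ℕ × List ℕ :=
  (e.1.1, e.2.1.1, List.ofFn fun i => (e.2.2 i).1)

/-- The tree automaton described by `(n, k, L)`: its states are `0, …, n-1`, its labels are
`0, …, k-1`, and its transitions are those listed in `L`. -/
def automatonOfCode (d : ℕ) (c : ℕ × ℕ × List (ℕ × ℕ × List ℕ)) : TreeAutomaton d where
  Q := Fin c.1
  A := Fin c.2.1
  trans p a v := transCode (p, a, v) ∈ c.2.2

/-- The code of an automaton given by its list of transitions. -/
def codeOfList {d n k : ℕ} (L : List (Fin n × Fin k × (Fin d → Fin n))) :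
    ℕ × ℕ × List (ℕ × ℕ × List ℕ) :=
  (n, k, L.map transCode)

/-- The `i`-th subblock of height `h` of a block of height `h + 1`. -/
def Block.child {d : ℕ} {A : Type} {h : ℕ} (b : Block d A (h + 1)) (i : Fin d) : Block d A h :=
  fun w => b ⟨i :: w.1, by simpa using w.2⟩

/-- The labels of a block in preorder. -/
def Block.preorder {d : ℕ} {A : Type} : (h : ℕ) → Block d A h → List A
  | 0, _ => []
  | h + 1, b => b ⟨[], h.succ_pos⟩ ::
      (List.finRange d).flatMap fun i => Block.preorder h (Block.child b i)

/-- The tree-shift of finite type described by `(k, F)`: its alphabet is `{0, …, k-1}`, and the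
forbidden blocks are those listed in `F`, a block being given by its height and its labels. -/
def sftOfCode (d : ℕ) (c : ℕ × List (ℕ × List ℕ)) : Set (LTree d (Fin c.1)) :=
  avoiding fun h => {b | (h, (Block.preorder h b).map Fin.val) ∈ c.2}

end TreeShift

/-! ### A machine model with time and space: WHILE programs on binary trees -/

namespace WhileProg

/-- The values of the variables of a program. -/
inductive Data : Type
  | nil : Data
  | cons : Data → Data → Data
  deriving DecidableEq

namespace Data

/-- The number of nodes. -/
def size : Data → ℕ
  | nil => 1
  | cons a b => a.size + b.size + 1

def hd : Data → Data
  | nil => nil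
  | cons a _ => a

def tl : Data → Data
  | nil => nil
  | cons _ b => b

/-- Lists of data as data. -/
def ofList : List Data → Data
  | [] => nil
  | a :: l => cons a (ofList l)

/-- Natural numbers in unary notation. -/
def ofNat (n : ℕ) : Data := ofList (List.replicate n nil)

end Data

abbrev Store : Type := ℕ → Data

inductive Expr : Type
  | var : ℕ → Expr
  | nil : Expr
  | cons : Expr → Expr → Expr
  | hd : Expr → Expr
  | tl : Expr → Expr
  | eq : Expr → Expr → Expr

namespace Expr

def eval (σ : Store) : Expr → Data
  | var x => σ x
  | nil => Data.nil
  | cons e f => Data.cons (e.eval σ) (f.eval σ)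
  | hd e => (e.eval σ).hd
  | tl e => (e.eval σ).tl
  | eq e f => if e.eval σ = f.eval σ then Data.cons Data.nil Data.nil else Data.nil

/-- The cost of an evaluation: one unit for each operation, and, for an equality test, also the sizes
of the two values that are compared. -/
def cost (σ : Store) : Expr → ℕ
  | var _ => 1
  | nil => 1
  | cons e f => e.cost σ + f.cost σ + 1
  | hd e => e.cost σ + 1
  | tl e => e.cost σ + 1
  | eq e f => e.cost σ + f.cost σ + (e.eval σ).size + (f.eval σ).size + 1

end Expr

inductive Cmd : Type
  | assign : ℕ → Expr → Cmd
  | seq : Cmd → Cmd → Cmd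
  | ite : Expr → Cmd → Cmd → Cmd
  | while : Expr → Cmd → Cmd

/-- `Exec m c σ t σ'`: started in the store `σ`, the command `c` halts after exactly `t` units of time
in the store `σ'`, and every value that it stores has size at most `m`. A program has finitely many
variables, so that the space it uses is at most `m` up to a constant factor. -/
inductive Exec (m : ℕ) : Cmd → Store → ℕ → Store → Prop
  | assign (σ : Store) (x : ℕ) (e : Expr) (h : (e.eval σ).size ≤ m) :
      Exec m (.assign x e) σ (e.cost σ + 1) (Function.update σ x (e.eval σ))
  | seq {c₁ c₂ : Cmd} {σ₁ σ₂ σ₃ : Store} {t₁ t₂ : ℕ} (h₁ : Exec m c₁ σ₁ t₁ σ₂)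
      (h₂ : Exec m c₂ σ₂ t₂ σ₃) : Exec m (.seq c₁ c₂) σ₁ (t₁ + t₂) σ₃
  | ite_true {e : Expr} {c₁ c₂ : Cmd} {σ σ' : Store} {t : ℕ} (he : e.eval σ ≠ Data.nil)
      (h : Exec m c₁ σ t σ') : Exec m (.ite e c₁ c₂) σ (e.cost σ + 1 + t) σ'
  | ite_false {e : Expr} {c₁ c₂ : Cmd} {σ σ' : Store} {t : ℕ} (he : e.eval σ = Data.nil)
      (h : Exec m c₂ σ t σ') : Exec m (.ite e c₁ c₂) σ (e.cost σ + 1 + t) σ'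
  | while_done {e : Expr} {c : Cmd} {σ : Store} (he : e.eval σ = Data.nil) :
      Exec m (.while e c) σ (e.cost σ + 1) σ
  | while_step {e : Expr} {c : Cmd} {σ₁ σ₂ σ₃ : Store} {t₁ t₂ : ℕ} (he : e.eval σ₁ ≠ Data.nil)
      (h₁ : Exec m c σ₁ t₁ σ₂) (h₂ : Exec m (.while e c) σ₂ t₂ σ₃) :
      Exec m (.while e c) σ₁ (e.cost σ₁ + 1 + t₁ + t₂) σ₃

/-- Started with `input` in the variable `0` and `nil` in all other ones, `c` halts within time
`bound`, using values of size at most `bound` only (the input included), and it accepts, that is,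
leaves a value other than `nil` in the variable `0`, if and only if `answer` holds. -/
def DecidesWithin (c : Cmd) (input : Data) (bound : ℕ) (answer : Prop) : Prop :=
  input.size ≤ bound ∧ ∃ t ≤ bound, ∃ σ : Store,
    Exec bound c (Function.update (fun _ => Data.nil) 0 input) t σ ∧ (σ 0 ≠ Data.nil ↔ answer)

/-- The input that represents the code of a tree automaton. -/
def encodeAutomaton (c : ℕ × ℕ × List (ℕ × ℕ × List ℕ)) : Data :=
  .cons (.ofNat c.1) (.cons (.ofNat c.2.1) (.ofList (c.2.2.map fun e =>
    .cons (.ofNat e.1) (.cons (.ofNat e.2.1) (.ofList (e.2.2.map .ofNat))))))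

end WhileProg

namespace TreeShift

/-! ### Sliding block codes, conjugacy and exchangeability -/

variable {d : ℕ} {A B C : Type}

theorem blockAt_eq_iff {t t' : LTree d A} {n : ℕ} {x x' : List (Fin d)} :
    blockAt t n x = blockAt t' n x' ↔ ∀ w, w.length < n → t (x ++ w) = t' (x' ++ w) :=
  ⟨fun h w hw => congrFun h ⟨w, hw⟩, fun h => funext fun w => h w.1 w.2⟩

/-- Only blocks that occur in `X` matter, so a block map can be recovered from `φ` by choosing an
occurrence of each block. This form mentions no block map and is the one used in the sequel. -/
theorem isSlidingBlockCode_iff {X : Set (LTree d A)} {Y : Set (LTree d B)} {φ : X → Y} :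
    IsSlidingBlockCode φ ↔ ∃ n : ℕ, ∀ (t t' : X) (x x' : List (Fin d)),
      (∀ w, w.length < n → t.1 (x ++ w) = t'.1 (x' ++ w)) → (φ t).1 x = (φ t').1 x' := by
  constructor
  · rintro ⟨n, f, h⟩
    refine ⟨n, fun t t' x x' hw => ?_⟩
    rw [h, h]
    congr 1
    exact Subtype.ext (blockAt_eq_iff.2 hw)
  · rintro ⟨n, h⟩
    refine ⟨n, fun b => (φ ⟨b.2.choose, b.2.choose_spec.1⟩).1 b.2.choose_spec.2.choose,
      fun t x => h _ _ _ _ ?_⟩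
    intro w hw
    have hb : ∃ t' ∈ X, ∃ x', blockAt t' n x' = blockAt t.1 n x := ⟨t.1, t.2, x, rfl⟩
    exact (blockAt_eq_iff.1 hb.choose_spec.2.choose_spec w hw).symm

theorem IsSlidingBlockCode.comp {X : Set (LTree d A)} {Y : Set (LTree d B)} {Z : Set (LTree d C)}
    {ψ : Y → Z} {φ : X → Y} (hψ : IsSlidingBlockCode ψ) (hφ : IsSlidingBlockCode φ) :
    IsSlidingBlockCode (ψ ∘ φ) := by
  rw [isSlidingBlockCode_iff] at *
  obtain ⟨m, hm⟩ := hψ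
  obtain ⟨n, hn⟩ := hφ
  refine ⟨n + m, fun t t' x x' h => hm _ _ _ _ fun w hw => hn _ _ _ _ fun w' hw' => ?_⟩
  simpa using h (w ++ w') (by simp; omega)

theorem Conjugate.refl (X : Set (LTree d A)) : Conjugate X X := by
  have h : IsSlidingBlockCode (Equiv.refl X) :=
    isSlidingBlockCode_iff.2 ⟨1, fun t t' x x' h => by simpa using h [] (by simp)⟩
  exact ⟨Equiv.refl X, h, h⟩

theorem Conjugate.symm {X : Set (LTree d A)} {Y : Set (LTree d B)} (h : Conjugate X Y) :
    Conjugate Y X := by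
  obtain ⟨φ, h₁, h₂⟩ := h
  exact ⟨φ.symm, h₂, by simpa using h₁⟩

theorem Conjugate.trans {X : Set (LTree d A)} {Y : Set (LTree d B)} {Z : Set (LTree d C)}
    (h : Conjugate X Y) (h' : Conjugate Y Z) : Conjugate X Z := by
  obtain ⟨φ, h₁, h₂⟩ := h
  obtain ⟨ψ, h₃, h₄⟩ := h'
  exact ⟨φ.trans ψ, h₃.comp h₁, h₂.comp h₄⟩

/-- Both codes are given on all labelled trees, so that their values outside `X` and `Y` are
irrelevant and may use default letters. -/
theorem Conjugate.of_maps {X : Set (LTree d A)} {Y : Set (LTree d B)}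
    (F : LTree d A → LTree d B) (G : LTree d B → LTree d A)
    (hF : ∀ t ∈ X, F t ∈ Y) (hG : ∀ t ∈ Y, G t ∈ X)
    (hGF : ∀ t ∈ X, G (F t) = t) (hFG : ∀ t ∈ Y, F (G t) = t) (n m : ℕ)
    (hn : ∀ t ∈ X, ∀ t' ∈ X, ∀ x x',
      (∀ w, w.length < n → t (x ++ w) = t' (x' ++ w)) → F t x = F t' x')
    (hm : ∀ t ∈ Y, ∀ t' ∈ Y, ∀ x x',
      (∀ w, w.length < m → t (x ++ w) = t' (x' ++ w)) → G t x = G t' x') :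
    Conjugate X Y :=
  ⟨⟨fun t => ⟨F t, hF _ t.2⟩, fun t => ⟨G t, hG _ t.2⟩, fun t => Subtype.ext (hGF _ t.2),
    fun t => Subtype.ext (hFG _ t.2)⟩,
    isSlidingBlockCode_iff.2 ⟨n, fun t t' _ _ h => hn _ t.2 _ t'.2 _ _ h⟩,
    isSlidingBlockCode_iff.2 ⟨m, fun t t' _ _ h => hm _ t.2 _ t'.2 _ _ h⟩⟩

/-- Covers the degenerate cases of an empty alphabet or an empty set of states, where no default
value is available. -/
theorem Conjugate.of_isEmpty {X : Set (LTree d A)} {Y : Set (LTree d B)} (hX : X = ∅)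
    (hY : Y = ∅) : Conjugate X Y := by
  subst hX hY
  have : IsEmpty (∅ : Set (LTree d A)) := ⟨fun t => t.2⟩
  have : IsEmpty (∅ : Set (LTree d B)) := ⟨fun t => t.2⟩
  exact ⟨Equiv.equivOfIsEmpty _ _, isSlidingBlockCode_iff.2 ⟨0, fun t => t.2.elim⟩,
    isSlidingBlockCode_iff.2 ⟨0, fun t => t.2.elim⟩⟩

/-- Renaming the letters along an injection is a conjugacy. -/
theorem Conjugate.of_image {Y : Set (LTree d B)} (g : B → A) (hg : Function.Injective g) :
    Conjugate Y ((fun t x => g (t x)) '' Y) := by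
  classical
  by_cases hB : Nonempty B
  · have hl : ∀ b, Function.invFun g (g b) = b := Function.leftInverse_invFun hg
    refine Conjugate.of_maps (fun t x => g (t x)) (fun t x => Function.invFun g (t x))
      (fun t ht => ⟨t, ht, rfl⟩) ?_ ?_ ?_ 1 1 ?_ ?_
    · rintro _ ⟨t, ht, rfl⟩
      simpa [hl] using ht
    · intro t _
      simp [hl]
    · rintro _ ⟨t, _, rfl⟩
      simp [hl]
    · intro t _ t' _ x x' h
      simpa using congrArg g (h [] (by simp))
    · intro t _ t' _ x x' h
      simpa using congrArg (Function.invFun g) (h [] (by simp))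
  · have : Y = ∅ := Set.eq_empty_of_forall_notMem fun t _ => hB ⟨t []⟩
    exact Conjugate.of_isEmpty this (by simp [this])

theorem IsConjugateToHom.congr {X : Set (LTree d A)} {Y : Set (LTree d B)} (h : Conjugate X Y) :
    IsConjugateToHom X ↔ IsConjugateToHom Y := by
  constructor
  · rintro ⟨V, hV, E, hE, hc⟩
    exact ⟨V, hV, E, hE, h.symm.trans hc⟩
  · rintro ⟨V, hV, E, hE, hc⟩
    exact ⟨V, hV, E, hE, h.trans hc⟩

/-- `t` and `t'` are exchangeable with respect to `E`: putting one for the other at any place of a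
tuple yields fibres of `σ` that correspond to each other modulo `E`. -/
def Exchangeable {X : Type} (σ : Fin d → X → X) (E : X → X → Prop) (t t' : X) : Prop :=
  ∀ (i : Fin d) (τ : Fin d → X),
    ∃ β : {s // ∀ j, σ j s = Function.update τ i t j} ≃ {s // ∀ j, σ j s = Function.update τ i t' j},
      ∀ s, E s.1 (β s).1

/-- The notion involves nothing but the maps `σ` and the relation `E`, so every bijection that
commutes with the maps transports it. -/
theorem Exchangeable.map {X Y : Type} {σ : Fin d → X → X} {ρ : Fin d → Y → Y} (φ : X ≃ Y)
    (hφ : ∀ i t, φ (σ i t) = ρ i (φ t)) {E : X → X → Prop} {E' : Y → Y → Prop}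
    (hE : ∀ t t', E t t' → E' (φ t) (φ t')) {t t' : X} (h : Exchangeable σ E t t') :
    Exchangeable ρ E' (φ t) (φ t') := by
  intro i τ
  obtain ⟨β, hβ⟩ := h i (fun j => φ.symm (τ j))
  have key : ∀ (r s : X), (∀ j, σ j s = Function.update (fun j => φ.symm (τ j)) i r j) ↔
      ∀ j, ρ j (φ s) = Function.update τ i (φ r) j := by
    intro r s
    refine forall_congr' fun j => ?_
    rw [← hφ, ← φ.symm.injective.eq_iff]
    simp only [Equiv.symm_apply_apply, Function.update_apply]
    split_ifs <;> simp
  let e : ∀ r : X, {s // ∀ j, σ j s = Function.update (fun j => φ.symm (τ j)) i r j} ≃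
      {s // ∀ j, ρ j s = Function.update τ i (φ r) j} := fun r => φ.subtypeEquiv (key r)
  refine ⟨(e t).symm.trans (β.trans (e t')), fun s => ?_⟩
  obtain ⟨s, rfl⟩ := (e t).surjective s
  simpa [e] using hE _ _ (hβ s)

end TreeShift

/-! ### Rigidity of conjugacies between totally amalgamated automata -/

namespace TreeAutomaton

open TreeShift

variable {d : ℕ} {𝒜 ℬ : TreeAutomaton d}

/-- The tree whose root has the label `a` and the subtrees `τ i`. -/
def graft {A : Type} (a : A) (τ : Fin d → LTree d A) : LTree d A
  | [] => a
  | i :: w => τ i w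

/-- The subtrees at the children of the root. -/
def sub (i : Fin d) (t : 𝒜.shift) : 𝒜.shift :=
  ⟨fun w => t.1 (i :: w), by
    obtain ⟨u, hu⟩ := t.2
    exact ⟨fun w => u (i :: w), fun x => hu (i :: x)⟩⟩

/-- The state at the root. -/
noncomputable def rootState (t : 𝒜.shift) : 𝒜.Q := t.2.choose []

/-- The root label alone determines the transition used at the root, so the chosen computation tree
does not matter. -/
theorem IsEdge.rootState_eq (h : 𝒜.IsEdge) {t : 𝒜.shift} {p v} (hp : 𝒜.trans p (t.1 []) v) :
    rootState t = p :=
  (h _ _ _ _ _ hp (t.2.choose_spec [])).1.symm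

theorem IsEdge.rootState_spec (h : 𝒜.IsEdge) (t : 𝒜.shift) :
    𝒜.trans (rootState t) (t.1 []) (fun i => rootState (sub i t)) := by
  have h1 := t.2.choose_spec []
  have : (fun i => rootState (sub i t)) = fun i => t.2.choose ([] ++ [i]) := by
    funext i
    exact h.rootState_eq (t := sub i t) (t.2.choose_spec [i])
  rw [this]
  exact h1

theorem graft_mem {p : 𝒜.Q} {a : 𝒜.A} {τ : Fin d → 𝒜.shift}
    (ha : 𝒜.trans p a fun i => rootState (τ i)) : graft a (fun i => (τ i).1) ∈ 𝒜.shift := by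
  let u : LTree d 𝒜.Q := fun x => match x with
    | [] => p
    | i :: w => (τ i).2.choose w
  refine ⟨u, fun x => ?_⟩
  match x with
  | [] => exact ha
  | i :: w => exact (τ i).2.choose_spec w

theorem ext_sub {s s' : 𝒜.shift} (h : s.1 [] = s'.1 []) (hs : ∀ j, sub j s = sub j s') :
    s = s' := by
  apply Subtype.ext
  funext w
  match w with
  | [] => exact h
  | i :: w => exact congrFun (congrArg Subtype.val (hs i)) w

/-- Once the subtrees are fixed, a tree is determined by its root label, which may be that of any
transition from `p` to the root states of the subtrees. This expresses the matrix through data that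
a conjugacy respects. -/
theorem mat_eq_card (h : 𝒜.IsEdge) (p : 𝒜.Q) (τ : Fin d → 𝒜.shift) :
    𝒜.mat p (fun i => rootState (τ i)) =
      Nat.card {s : 𝒜.shift // (∀ j, sub j s = τ j) ∧ rootState s = p} := by
  have hg : ∀ a, 𝒜.trans p a (fun i => rootState (τ i)) → ∃ s : 𝒜.shift,
      ((∀ j, sub j s = τ j) ∧ rootState s = p) ∧ s.1 [] = a := fun a ha =>
    ⟨⟨_, graft_mem ha⟩, ⟨fun j => rfl, h.rootState_eq ha⟩, rfl⟩
  rw [mat, ← Nat.card_coe_set_eq]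
  symm
  refine Nat.card_congr (Equiv.ofBijective (fun s => ⟨s.1.1 [], ?_⟩) ⟨?_, ?_⟩)
  · have := h.rootState_spec s.1
    simp only [s.2.1, s.2.2] at this
    exact this
  · intro s s' hs
    exact Subtype.ext (ext_sub (congrArg Subtype.val hs) fun j => (s.2.1 j).trans (s'.2.1 j).symm)
  · rintro ⟨a, ha⟩
    obtain ⟨s, hs, rfl⟩ := hg a ha
    exact ⟨⟨s, hs⟩, rfl⟩

theorem IsTrim.exists_rootState (ht : 𝒜.IsTrim) (h : 𝒜.IsEdge) (p : 𝒜.Q) :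
    ∃ t : 𝒜.shift, rootState t = p := by
  choose a v hav using ht
  let u : LTree d 𝒜.Q := fun x => x.foldl (fun q i => v q i) p
  have hu : ∀ x, 𝒜.trans (u x) (a (u x)) (fun i => u (x ++ [i])) := fun x => by
    simpa [u] using hav (u x)
  exact ⟨⟨fun x => a (u x), u, hu⟩, h.rootState_eq (hu [])⟩

theorem IsTrim.exists_tuple (ht : 𝒜.IsTrim) (h : 𝒜.IsEdge) (v : Fin d → 𝒜.Q) :
    ∃ τ : Fin d → 𝒜.shift, (fun i => rootState (τ i)) = v := by
  choose t htp using ht.exists_rootState h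
  exact ⟨fun i => t (v i), funext fun i => htp _⟩

/-- The states at the root agree, and so do the labels of the nodes of length less than `n`. -/
def SameBlock (n : ℕ) (t t' : 𝒜.shift) : Prop :=
  rootState t = rootState t' ∧ ∀ w, w.length < n → t.1 w = t'.1 w

/-- The root transition sees only the root states of the subtrees, so replacing `t` by `t'` and
keeping the root label gives an accepted tree. The common height grows by one because the root is
added on top. -/
theorem SameBlock.exchangeable (h : 𝒜.IsEdge) {n : ℕ} {t t' : 𝒜.shift} (htt : SameBlock n t t') :
    Exchangeable sub (SameBlock (n + 1)) t t' := by
  intro i τ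
  have key : ∀ r r' : 𝒜.shift, SameBlock n r r' →
      ∀ s : {s : 𝒜.shift // ∀ j, sub j s = Function.update τ i r j},
      ∃ s' : {s : 𝒜.shift // ∀ j, sub j s = Function.update τ i r' j},
        s'.1.1 [] = s.1.1 [] ∧ SameBlock (n + 1) s.1 s'.1 := by
    rintro r r' hr ⟨s, hs⟩
    have htr : 𝒜.trans (rootState s) (s.1 []) fun j => rootState (Function.update τ i r' j) := by
      convert h.rootState_spec s using 2 with j
      rw [hs j]
      by_cases hj : j = i
      · subst hj; simp [hr.1]
      · simp [hj]
    refine ⟨⟨⟨_, graft_mem htr⟩, fun j => rfl⟩, rfl,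
      (h.rootState_eq (t := ⟨_, graft_mem htr⟩) htr).symm, ?_⟩
    intro w hw
    match w with
    | [] => rfl
    | j :: w =>
      have h1 : s.1 (j :: w) = (Function.update τ i r j).1 w :=
        congrFun (congrArg Subtype.val (hs j)) w
      have h2 : w.length < n := by simpa using hw
      change s.1 (j :: w) = (Function.update τ i r' j).1 w
      rw [h1]
      by_cases hj : j = i
      · subst hj; simpa using hr.2 w h2
      · simp [hj]
  choose f hf using key t t' htt
  choose g hg using key t' t ⟨htt.1.symm, fun w hw => (htt.2 w hw).symm⟩
  refine ⟨⟨f, g, fun s => ?_, fun s => ?_⟩, fun s => (hf s).2⟩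
  · exact Subtype.ext (ext_sub ((hg _).1.trans (hf _).1)
      fun j => ((g (f s)).2 j).trans (s.2 j).symm)
  · exact Subtype.ext (ext_sub ((hf _).1.trans (hg _).1)
      fun j => ((f (g s)).2 j).trans (s.2 j).symm)

/-- Trimness realizes every tuple of states by trees; by `mat_eq_card` the two entries count the
trees with root state `p` in two fibres, and the given bijection of the fibres preserves root
states. -/
theorem sameColumns_of_exchangeable (h : 𝒜.IsEdge) (ht : 𝒜.IsTrim) {t t' : 𝒜.shift}
    (htt : Exchangeable sub (SameBlock 0) t t') :
    𝒜.SameColumns (rootState t) (rootState t') := by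
  intro p i v
  obtain ⟨τ, rfl⟩ := ht.exists_tuple h v
  obtain ⟨β, hβ⟩ := htt i τ
  have hu : ∀ r : 𝒜.shift, Function.update (fun i => rootState (τ i)) i (rootState r) =
      fun j => rootState (Function.update τ i r j) := by
    intro r
    funext j
    by_cases hj : j = i
    · subst hj; simp
    · simp [hj]
  rw [hu, hu, mat_eq_card h, mat_eq_card h]
  have e : ∀ r : 𝒜.shift, {s : 𝒜.shift // (∀ j, sub j s = Function.update τ i r j) ∧
      rootState s = p} ≃ {s : {s : 𝒜.shift // ∀ j, sub j s = Function.update τ i r j} //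
        rootState s.1 = p} := fun r => (Equiv.subtypeSubtypeEquivSubtypeInter _ _).symm
  refine Nat.card_congr ((e t).trans (Equiv.trans ?_ (e t').symm))
  exact β.subtypeEquiv fun s => by rw [(hβ s).1]

/-- The induction lowers, one level at a time, the height of the block of `t` on which the root
state of `φ t` depends. -/
theorem rootState_eq_of_conj (hA : 𝒜.IsEdge) (hB : ℬ.IsEdge) (hBt : ℬ.IsTrim)
    (hBm : ∀ q q', ℬ.SameColumns q q' → q = q') (φ : 𝒜.shift ≃ ℬ.shift)
    (hφ : ∀ i t, φ (sub i t) = sub i (φ t)) {n : ℕ}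
    (hn : ∀ t t', SameBlock n t t' → rootState (φ t) = rootState (φ t')) (t t' : 𝒜.shift)
    (htt : rootState t = rootState t') : rootState (φ t) = rootState (φ t') := by
  induction n with
  | zero => exact hn t t' ⟨htt, by simp⟩
  | succ n ih =>
    refine ih fun t t' htt => hBm _ _ (sameColumns_of_exchangeable hB hBt ?_)
    -- Trees that agree to height `n` are exchangeable up to agreement to height `n + 1`, which by
    -- `hn` becomes equality of root states after `φ`.
    exact (htt.exchangeable hA).map φ hφ fun s s' hs => ⟨hn s s' hs, by simp⟩

/-- The image label at a node depends only on what lies at and below that node. -/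
theorem map_sub {φ : 𝒜.shift → ℬ.shift} (h : IsSlidingBlockCode φ) (i : Fin d) (t : 𝒜.shift) :
    φ (sub i t) = sub i (φ t) := by
  obtain ⟨n, hn⟩ := isSlidingBlockCode_iff.1 h
  apply Subtype.ext
  funext x
  exact hn _ _ _ _ fun w _ => rfl

theorem exists_rootState_eq_of_sameBlock (hB : ℬ.IsEdge) {φ : 𝒜.shift → ℬ.shift}
    (h : IsSlidingBlockCode φ) :
    ∃ n, ∀ t t', SameBlock n t t' → rootState (φ t) = rootState (φ t') := by
  obtain ⟨n, hn⟩ := isSlidingBlockCode_iff.1 h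
  refine ⟨n, fun t t' htt => ?_⟩
  have h1 : (φ t).1 [] = (φ t').1 [] := hn _ _ _ _ fun w hw => htt.2 w hw
  have h2 := hB.rootState_spec (φ t')
  rw [← h1] at h2
  exact hB.rootState_eq h2

/-- Conjugacies between totally amalgamated trim edge tree automata come from isomorphisms. -/
theorem exists_equiv_of_conjugate (hA : 𝒜.IsEdge) (hAt : 𝒜.IsTrim)
    (hAm : ∀ q q', 𝒜.SameColumns q q' → q = q') (hB : ℬ.IsEdge) (hBt : ℬ.IsTrim)
    (hBm : ∀ q q', ℬ.SameColumns q q' → q = q') (h : Conjugate 𝒜.shift ℬ.shift) :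
    ∃ θ : 𝒜.Q ≃ ℬ.Q, ∀ p v, 𝒜.mat p v = ℬ.mat (θ p) (fun i => θ (v i)) := by
  obtain ⟨φ, h₁, h₂⟩ := h
  obtain ⟨n, hn⟩ := exists_rootState_eq_of_sameBlock hB h₁
  obtain ⟨m, hm⟩ := exists_rootState_eq_of_sameBlock hA h₂
  have hf := rootState_eq_of_conj hA hB hBt hBm φ (map_sub h₁) hn
  have hg := rootState_eq_of_conj hB hA hAt hAm φ.symm (map_sub h₂) hm
  choose a ha using hAt.exists_rootState hA
  choose b hb using hBt.exists_rootState hB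
  -- The map on states does not depend on the trees chosen to represent them.
  have hθ : ∀ t, rootState (φ (a (rootState t))) = rootState (φ t) := fun t => hf _ _ (ha _)
  have hθ' : ∀ t, rootState (φ.symm (b (rootState t))) = rootState (φ.symm t) :=
    fun t => hg _ _ (hb _)
  let θ : 𝒜.Q ≃ ℬ.Q := ⟨fun p => rootState (φ (a p)), fun q => rootState (φ.symm (b q)),
    fun p => by simp [hθ', ha], fun q => by simp [hθ, hb]⟩
  have hθφ : ∀ t, θ (rootState t) = rootState (φ t) := hθ
  refine ⟨θ, fun p v => ?_⟩
  obtain ⟨τ, rfl⟩ := hAt.exists_tuple hA v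
  simp only [hθφ]
  rw [mat_eq_card hA, mat_eq_card hB (θ p) (fun i => φ (τ i))]
  -- `φ` carries the trees with subtrees `τ` and root state `p` onto those with subtrees `φ (τ i)`
  -- and root state `θ p`.
  refine Nat.card_congr (φ.subtypeEquiv fun s => ?_)
  simp [← map_sub h₁, ← hθφ]

theorem IsRegular.of_equiv (h : 𝒜.IsRegular) (θ : 𝒜.Q ≃ ℬ.Q)
    (hθ : ∀ p v, 𝒜.mat p v = ℬ.mat (θ p) (fun i => θ (v i))) : ℬ.IsRegular := by
  have h' : ∀ p v, ℬ.mat p v = 𝒜.mat (θ.symm p) (fun i => θ.symm (v i)) := by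
    intro p v
    simp [hθ]
  constructor
  · intro p v w u hv hw hu
    rw [h'] at *
    refine h.pos_of_mem _ _ _ _ hv hw fun i => ?_
    rcases hu i with ⟨j, hj⟩ | ⟨j, hj⟩
    · exact Or.inl ⟨j, by simp [hj]⟩
    · exact Or.inr ⟨j, by simp [hj]⟩
  · intro p v w hv hw
    rw [h'] at *
    rw [h']
    exact h.eq_of_pos _ _ _ hv hw
  · intro p v hv i
    rw [h'] at *
    exact h.back _ _ hv i

end TreeAutomaton

/-! ### Amalgamations are conjugacies; regular automata give Hom tree-shifts -/

namespace TreeAutomaton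

open TreeShift

variable {d : ℕ} {𝒜 ℬ : TreeAutomaton d}

theorem mat_eq_card_subtype (𝒜 : TreeAutomaton d) (p : 𝒜.Q) (v : Fin d → 𝒜.Q) :
    𝒜.mat p v = Nat.card {a // 𝒜.trans p a v} :=
  (Nat.card_coe_set_eq _).symm

theorem mat_pos_iff (𝒜 : TreeAutomaton d) (p : 𝒜.Q) (v : Fin d → 𝒜.Q) :
    0 < 𝒜.mat p v ↔ ∃ a, 𝒜.trans p a v :=
  Set.ncard_pos (Set.toFinite _)

/-- The coordinates are exchanged one after another. -/
theorem mat_congr {v v' : Fin d → 𝒜.Q} (h : ∀ i, 𝒜.SameColumns (v i) (v' i)) (p : 𝒜.Q) :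
    𝒜.mat p v = 𝒜.mat p v' := by
  have key : ∀ S : Finset (Fin d), 𝒜.mat p (S.piecewise v' v) = 𝒜.mat p v := by
    intro S
    induction S using Finset.induction_on with
    | empty => simp
    | insert j S hj ih =>
      rw [Finset.piecewise_insert, ← h j, ← ih]
      congr 1
      apply Function.update_eq_self_iff.2
      simp [hj]
  simpa using (key Finset.univ).symm

/-- If the labels of the transitions from `p` to `v` correspond to the letters `b` of type `p` that
allow the types `v` at the children, then the automaton presents the trees obeying `ok`. -/
theorem IsEdge.conjugate_of_equiv (h : 𝒜.IsEdge) {B : Type} (κ : B → 𝒜.Q)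
    (ok : B → (Fin d → 𝒜.Q) → Prop)
    (e : ∀ p v, Nonempty ({a // 𝒜.trans p a v} ≃ {b // κ b = p ∧ ok b v})) :
    Conjugate 𝒜.shift {y : LTree d B | ∀ x, ok (y x) fun i => κ (y (x ++ [i]))} := by
  classical
  replace e := fun p v => (e p v).some
  rcases isEmpty_or_nonempty B with hB | hB
  · refine Conjugate.of_isEmpty (Set.eq_empty_of_forall_notMem ?_)
      (Set.eq_empty_of_forall_notMem fun y _ => hB.elim (y []))
    rintro t ⟨u, hu⟩
    exact hB.elim (e _ _ ⟨_, hu []⟩).1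
  rcases isEmpty_or_nonempty 𝒜.A with hA | hA
  · refine Conjugate.of_isEmpty (Set.eq_empty_of_forall_notMem fun t _ => hA.elim (t []))
      (Set.eq_empty_of_forall_notMem fun y hy => ?_)
    exact hA.elim ((e _ _).symm ⟨_, rfl, hy []⟩).1
  have hf : ∀ a, ∃ b, ∀ p v (ha : 𝒜.trans p a v), b = (e p v ⟨a, ha⟩).1 := by
    intro a
    by_cases hex : ∃ p v, 𝒜.trans p a v
    · obtain ⟨p, v, ha⟩ := hex
      refine ⟨(e p v ⟨a, ha⟩).1, fun p' v' ha' => ?_⟩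
      obtain ⟨rfl, rfl⟩ := h _ _ _ _ _ ha ha'
      rfl
    · exact ⟨Classical.arbitrary B, fun p v ha => absurd ⟨p, v, ha⟩ hex⟩
  choose f hf using hf
  -- A transition is recovered from the letter at a node and the types of the letters at its
  -- children, whence the height 2 of the inverse code. The default letter serves only for tuples
  -- that the letter does not allow.
  let g : B → (Fin d → 𝒜.Q) → 𝒜.A := fun b v =>
    if h : ok b v then ((e (κ b) v).symm ⟨b, rfl, h⟩).1 else Classical.arbitrary 𝒜.A
  have hf1 : ∀ p a v, 𝒜.trans p a v → κ (f a) = p ∧ ok (f a) v ∧ g (f a) v = a := by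
    intro p a v ha
    rw [hf a p v ha]
    have h1 := (e p v ⟨a, ha⟩).2
    refine ⟨h1.1, h1.2, ?_⟩
    simp only [g, dif_pos h1.2]
    have key : ∀ (q : 𝒜.Q) (b : B) (hq : κ b = q) (hb : ok b v),
        ((e (κ b) v).symm ⟨b, rfl, hb⟩).1 = ((e q v).symm ⟨b, hq, hb⟩).1 := by
      rintro _ b rfl hb
      rfl
    rw [key p _ h1.1 h1.2]
    simp
  have hg1 : ∀ b v, ok b v → 𝒜.trans (κ b) (g b v) v ∧ f (g b v) = b := by
    intro b v hb
    have h1 := ((e (κ b) v).symm ⟨b, rfl, hb⟩).2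
    simp only [g, dif_pos hb]
    exact ⟨h1, by rw [hf _ _ _ h1]; simp⟩
  refine Conjugate.of_maps (fun t x => f (t x)) (fun y x => g (y x) fun i => κ (y (x ++ [i])))
    ?_ ?_ ?_ ?_ 1 2 ?_ ?_
  · rintro t ⟨u, hu⟩ x
    simpa [(hf1 _ _ _ (hu _)).1] using (hf1 _ _ _ (hu x)).2.1
  · intro y hy
    exact ⟨fun x => κ (y x), fun x => (hg1 _ _ (hy x)).1⟩
  · rintro t ⟨u, hu⟩
    funext x
    simpa [(hf1 _ _ _ (hu _)).1] using (hf1 _ _ _ (hu x)).2.2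
  · intro y hy
    funext x
    exact (hg1 _ _ (hy x)).2
  · intro t _ t' _ x x' hw
    simpa using congrArg f (hw [] (by simp))
  · intro t _ t' _ x x' hw
    have h1 : t x = t' x' := by simpa using hw [] (by simp)
    have h2 : ∀ i, t (x ++ [i]) = t' (x' ++ [i]) := fun i => hw [i] (by simp)
    simp only [h1, h2]

/-- Identify `B` with a disjoint union of sets of sizes `n i`. This is used to distribute the
transitions of a merged row among the rows of which it is the sum. -/
theorem exists_map_card_fiber {B I : Type} [Finite B] [Fintype I] (n : I → ℕ)
    (h : Nat.card B = ∑ i, n i) : ∃ c : B → I, ∀ i, Nat.card {b // c b = i} = n i := by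
  have h1 : Nat.card B = Nat.card (Σ i, Fin (n i)) := by simp [h, Nat.card_eq_fintype_card]
  obtain ⟨e⟩ := Finite.card_eq.1 h1
  refine ⟨fun b => (e b).1, fun i => ?_⟩
  rw [Nat.card_congr ((e.subtypeEquiv fun b => Iff.rfl).trans (Equiv.sigmaSubtype i))]
  simp

/-- The transitions of `ℬ` from a class `P` to `V` are shared out among the members of `P`, each `p`
receiving as many as `𝒜` has from `p` to a tuple of representatives of `V`. The state `κ b` to which
a letter `b` has been assigned is then the state of `𝒜` at a node with that letter, and a letter is
allowed above given states when it labels a transition of `ℬ` to their classes. -/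
theorem IsGeneralAmalgamation.conjugate (hA : 𝒜.IsEdge) (h : 𝒜.IsGeneralAmalgamation ℬ) :
    Conjugate 𝒜.shift ℬ.shift := by
  classical
  obtain ⟨hB, π, hπ, hs, hm⟩ := h
  rcases isEmpty_or_nonempty 𝒜.Q with hQ | hQ
  · refine Conjugate.of_isEmpty (Set.eq_empty_of_forall_notMem ?_)
      (Set.eq_empty_of_forall_notMem ?_)
    · rintro t ⟨u, -⟩
      exact hQ.elim (u [])
    · rintro t ⟨u, -⟩
      exact hQ.elim (hπ (u [])).choose
  have hc : ∀ P V, ∃ c : {b // ℬ.trans P b V} → 𝒜.Q,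
      ∀ p, Nat.card {b // c b = p} = if π p = P then 𝒜.mat p (Function.surjInv hπ ∘ V) else 0 := by
    intro P V
    refine exists_map_card_fiber _ ?_
    rw [← mat_eq_card_subtype, ← Finset.sum_filter]
    convert hm P (Function.surjInv hπ ∘ V) using 2
    · funext i
      exact (Function.surjInv_eq hπ _).symm
  choose c hc using hc
  have hcπ : ∀ P V b, π (c P V b) = P := by
    intro P V b
    by_contra hne
    have h1 := hc P V (c P V b)
    rw [if_neg hne] at h1
    have : Nonempty {b' // c P V b' = c P V b} := ⟨⟨b, rfl⟩⟩
    exact absurd h1 Nat.card_pos.ne'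
  have hκ : ∀ b, ∃ q, ∀ P V (hb : ℬ.trans P b V), q = c P V ⟨b, hb⟩ := by
    intro b
    by_cases hex : ∃ P V, ℬ.trans P b V
    · obtain ⟨P, V, hb⟩ := hex
      refine ⟨c P V ⟨b, hb⟩, fun P' V' hb' => ?_⟩
      obtain ⟨rfl, rfl⟩ := hB _ _ _ _ _ hb hb'
      rfl
    · exact ⟨Classical.arbitrary _, fun P V hb => absurd ⟨P, V, hb⟩ hex⟩
  choose κ hκ using hκ
  have key := hA.conjugate_of_equiv κ (fun b v => ℬ.trans (π (κ b)) b (π ∘ v)) fun p v => by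
    refine Finite.card_eq.1 ?_
    have h1 : 𝒜.mat p v = 𝒜.mat p (Function.surjInv hπ ∘ (π ∘ v)) :=
      mat_congr (fun i => hs _ _ (Function.surjInv_eq hπ _).symm) p
    have h2 := hc (π p) (π ∘ v) p
    rw [if_pos rfl, ← h1, mat_eq_card_subtype] at h2
    rw [← h2]
    refine Nat.card_congr ⟨fun b => ⟨b.1.1, by rw [hκ _ _ _ b.1.2, b.2], ?_⟩,
      fun b => ⟨⟨b.1, by simpa [b.2.1] using b.2.2⟩, by rw [← hκ, b.2.1]⟩,
      fun b => rfl, fun b => rfl⟩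
    rw [hκ _ _ _ b.1.2, b.2]
    exact b.1.2
  convert key using 1
  ext y
  constructor
  · rintro ⟨u, hu⟩ x
    -- The states of a computation of `ℬ` are forced to be the classes of the states assigned to the
    -- labels.
    have h1 : ∀ x, π (κ (y x)) = u x := fun x => by rw [hκ _ _ _ (hu x), hcπ]
    convert hu x using 1
    · exact h1 x
    · funext i
      exact h1 _
  · intro hy
    exact ⟨fun x => π (κ (y x)), hy⟩

theorem IsGeneralAmalgamation.isTrim (hA : 𝒜.IsTrim) (h : 𝒜.IsGeneralAmalgamation ℬ) :
    ℬ.IsTrim := by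
  obtain ⟨-, π, hπ, -, hm⟩ := h
  intro P
  obtain ⟨p, rfl⟩ := hπ P
  obtain ⟨a, v, hv⟩ := hA p
  have h1 : 0 < ℬ.mat (π p) (π ∘ v) := by
    rw [hm]
    refine lt_of_lt_of_le ((𝒜.mat_pos_iff p v).2 ⟨a, hv⟩)
      (Finset.single_le_sum (f := fun p => 𝒜.mat p v) (fun _ _ => Nat.zero_le _) ?_)
    simp
  obtain ⟨b, hb⟩ := (ℬ.mat_pos_iff _ _).1 h1
  exact ⟨b, _, hb⟩

theorem amalgamation_spec (hA : 𝒜.IsEdge) (hAt : 𝒜.IsTrim)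
    (h : Relation.ReflTransGen IsGeneralAmalgamation 𝒜 ℬ) :
    ℬ.IsEdge ∧ ℬ.IsTrim ∧ Conjugate 𝒜.shift ℬ.shift := by
  induction h with
  | refl => exact ⟨hA, hAt, Conjugate.refl _⟩
  | tail _ hbc ih => exact ⟨hbc.1, hbc.isTrim ih.2.1, ih.2.2.trans (hbc.conjugate ih.1)⟩

/-- The support of a row is a product set: starting from the constant tuple at the first coordinate,
which exists as `d ≥ 1`, condition (i) allows the other coordinates to be inserted one by one. -/
theorem IsRegular.pos_iff (h : 𝒜.IsRegular) (hd : 1 ≤ d) (p : 𝒜.Q) (v : Fin d → 𝒜.Q) :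
    0 < 𝒜.mat p v ↔ ∀ i, 0 < 𝒜.mat p fun _ => v i := by
  constructor
  · exact fun hv i => h.pos_of_mem p v v _ hv hv fun _ => Or.inl ⟨i, rfl⟩
  · intro hv
    have key : ∀ S : Finset (Fin d), 0 < 𝒜.mat p (S.piecewise v fun _ => v ⟨0, hd⟩) := by
      intro S
      induction S using Finset.induction_on with
      | empty => simpa using hv _
      | insert j S hj ih =>
        rw [Finset.piecewise_insert]
        refine h.pos_of_mem p _ _ _ ih (hv j) fun i => ?_
        by_cases hi : i = j
        · subst hi
          exact Or.inr ⟨i, by simp⟩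
        · exact Or.inl ⟨i, by simp [hi]⟩
    simpa using key Finset.univ

/-- Each state `p` is blown up into `m p` vertices, where every nonzero entry of its row equals `m
p`; vertices above `p` and `q` are joined when `p` has a transition to `(q, …, q)`. Condition (iii)
makes this symmetric. Because the support is a product, the vertices above `p` that are adjacent to
all types in `v` are either all `m p` of them or none, exactly as for the transitions from `p` to
`v`. -/
theorem IsRegular.isConjugateToHom (h : 𝒜.IsRegular) (hA : 𝒜.IsEdge) (hd : 1 ≤ d) :
    IsConjugateToHom 𝒜.shift := by
  classical
  have hm : ∀ p, ∃ m, ∀ v, 0 < 𝒜.mat p v → 𝒜.mat p v = m := by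
    intro p
    by_cases hp : ∃ v, 0 < 𝒜.mat p v
    · obtain ⟨w, hw⟩ := hp
      exact ⟨_, fun v hv => h.eq_of_pos p v w hv hw⟩
    · push Not at hp
      exact ⟨0, fun v hv => absurd hv (hp v).not_gt⟩
  choose m hm using hm
  refine ⟨Σ p : 𝒜.Q, Fin (m p), inferInstance, fun b b' => 0 < 𝒜.mat b.1 fun _ => b'.1,
    fun b b' hb => h.back _ _ hb ⟨0, hd⟩, ?_⟩
  refine hA.conjugate_of_equiv (fun b : Σ p : 𝒜.Q, Fin (m p) => b.1)
    (fun b v => ∀ i, 0 < 𝒜.mat b.1 fun _ => v i) fun p v => Finite.card_eq.1 ?_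
  rw [← mat_eq_card_subtype]
  by_cases hv : 0 < 𝒜.mat p v
  · rw [hm p v hv]
    have hv' := (h.pos_iff hd p v).1 hv
    have e : {b : Σ p : 𝒜.Q, Fin (m p) // b.1 = p ∧ ∀ i, 0 < 𝒜.mat b.1 fun _ => v i} ≃
        {b : Σ p : 𝒜.Q, Fin (m p) // b.1 = p} := Equiv.subtypeEquivRight fun b =>
      ⟨fun hb => hb.1, fun hb => ⟨hb, by rw [hb]; exact hv'⟩⟩
    rw [Nat.card_congr (e.trans (Equiv.sigmaSubtype p))]
    simp
  · have : IsEmpty {b : Σ p : 𝒜.Q, Fin (m p) // b.1 = p ∧ ∀ i, 0 < 𝒜.mat b.1 fun _ => v i} := by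
      refine ⟨fun b => hv ((h.pos_iff hd p v).2 ?_)⟩
      rw [← b.2.1]
      exact b.2.2
    rw [Nat.card_of_isEmpty]
    omega

/-! ### The neighbourhood automaton of a graph and the criterion -/

/-- The automaton of a symmetric relation: its states are the sets of neighbours. -/
noncomputable def nbrAutomaton (d : ℕ) {V : Type} [Finite V] (E : V → V → Prop) :
    TreeAutomaton d where
  Q := Set.range fun v => {w | E v w}
  A := V × (Fin d → Set.range fun v => {w | E v w})
  fintypeQ := Fintype.ofFinite _
  decidableEqQ := Classical.decEq _
  trans p a v := {w | E a.1 w} = p.1 ∧ a.2 = v ∧ ∀ i, a.1 ∈ (v i).1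

section

variable {V : Type} {E : V → V → Prop}

/-- Every node has a child, so isolated vertices never occur as labels. Without them the
neighbourhood automaton is trim. -/
theorem homShift_conjugate_nonisolated (hd : 1 ≤ d) :
    Conjugate (homShift d fun v w : {v // ∃ w, E v w} => E v.1 w.1) (homShift d E) := by
  convert Conjugate.of_image (d := d) (Subtype.val : {v // ∃ w, E v w} → V) Subtype.val_injective
    using 1
  ext y
  constructor
  · exact fun hy => ⟨fun x => ⟨y x, _, hy x ⟨0, hd⟩⟩, fun x i => hy x i, rfl⟩
  · rintro ⟨t, ht, rfl⟩
    exact fun x i => ht x i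

variable [Finite V]

/-- A label records a vertex, which fixes the source, together with the target. -/
theorem nbrAutomaton_isEdge : (nbrAutomaton d E).IsEdge := by
  rintro a p v p' v' ⟨h1, h2, -⟩ ⟨h1', h2', -⟩
  exact ⟨Subtype.ext (h1.symm.trans h1'), h2.symm.trans h2'⟩

/-- The labels from `p` to `v` are the vertices of type `p` that are adjacent to the types in `v`. -/
def nbrEquiv (p : (nbrAutomaton d E).Q) (v : Fin d → (nbrAutomaton d E).Q) :
    {a // (nbrAutomaton d E).trans p a v} ≃ {b : V // {w | E b w} = p.1 ∧ ∀ i, b ∈ (v i).1} where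
  toFun a := ⟨a.1.1, a.2.1, a.2.2.2⟩
  invFun b := ⟨(b.1, v), b.2.1, rfl, b.2.2⟩
  left_inv a := Subtype.ext (Prod.ext rfl a.2.2.1.symm)
  right_inv _ := rfl

theorem nbrAutomaton_mat_pos (p : (nbrAutomaton d E).Q) (v : Fin d → (nbrAutomaton d E).Q) :
    0 < (nbrAutomaton d E).mat p v ↔ ∃ b, {w | E b w} = p.1 ∧ ∀ i, b ∈ (v i).1 := by
  rw [mat_pos_iff]
  exact ⟨fun ⟨a, ha⟩ => ⟨_, (nbrEquiv p v ⟨a, ha⟩).2⟩,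
    fun ⟨b, hb⟩ => ⟨_, ((nbrEquiv p v).symm ⟨b, hb⟩).2⟩⟩

/-- By symmetry, lying in the neighbourhood of `w` means having `w` as a neighbour, a property of
the neighbourhood only. This is where the graph being undirected enters. -/
theorem mem_nbr_congr (hE : ∀ u v, E u v → E v u) {b b' : V} (h : {w | E b w} = {w | E b' w})
    (q : (nbrAutomaton d E).Q) : b ∈ q.1 ↔ b' ∈ q.1 := by
  obtain ⟨_, w, rfl⟩ := q
  have h1 : E b w ↔ E b' w := Set.ext_iff.1 h w
  exact ⟨fun h => hE _ _ (h1.1 (hE _ _ h)), fun h => hE _ _ (h1.2 (hE _ _ h))⟩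

/-- If `b` lies in `q`, its neighbourhood has a transition to `(q, …, q)`. With one coordinate
changed to `q'` the entry stays positive, so a vertex with the same neighbours as `b` lies in `q'`,
and then `b` does too. -/
theorem nbrAutomaton_eq_of_sameColumns (hE : ∀ u v, E u v → E v u) (hd : 1 ≤ d)
    (q q' : (nbrAutomaton d E).Q) (h : (nbrAutomaton d E).SameColumns q q') : q = q' := by
  have key : ∀ q q', (nbrAutomaton d E).SameColumns q q' → q.1 ⊆ q'.1 := by
    intro q q' h b hb
    let p : (nbrAutomaton d E).Q := ⟨_, b, rfl⟩
    have h1 : 0 < (nbrAutomaton d E).mat p fun _ => q :=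
      (nbrAutomaton_mat_pos _ _).2 ⟨b, rfl, fun _ => hb⟩
    have h2 := h p ⟨0, hd⟩ fun _ => q
    rw [Function.update_eq_self_iff.2 rfl] at h2
    rw [h2, nbrAutomaton_mat_pos] at h1
    obtain ⟨b', hb', hv⟩ := h1
    have h3 := hv ⟨0, hd⟩
    rw [Function.update_self] at h3
    exact (mem_nbr_congr hE hb' q').1 h3
  exact Subtype.ext (Set.Subset.antisymm (key _ _ h) (key _ _ fun p i v => (h p i v).symm))

theorem nbrAutomaton_isTrim (hV : ∀ v, ∃ w, E v w) (hE : ∀ u v, E u v → E v u) :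
    (nbrAutomaton d E).IsTrim := by
  rintro ⟨_, b, rfl⟩
  obtain ⟨w, hw⟩ := hV b
  exact ⟨(b, fun _ => ⟨_, w, rfl⟩), fun _ => ⟨_, w, rfl⟩, rfl, rfl, fun _ => hE _ _ hw⟩

/-- All vertices of type `p` allow the same types at the children, so the support of row `p` is a
product and each nonzero entry is the number of vertices of type `p`. Condition (iii) is the
symmetry of adjacency. -/
theorem nbrAutomaton_isRegular (hE : ∀ u v, E u v → E v u) : (nbrAutomaton d E).IsRegular := by
  refine ⟨fun p v w u hv hw hu => ?_, fun p v w hv hw => ?_, fun p v hv i => ?_⟩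
  · rw [nbrAutomaton_mat_pos] at *
    obtain ⟨b, hb, hbv⟩ := hv
    obtain ⟨b', hb', hbw⟩ := hw
    refine ⟨b, hb, fun i => ?_⟩
    rcases hu i with ⟨j, hj⟩ | ⟨j, hj⟩
    · exact hj ▸ hbv j
    · exact hj ▸ (mem_nbr_congr hE (hb.trans hb'.symm) _).2 (hbw j)
  · rw [nbrAutomaton_mat_pos] at hv hw
    obtain ⟨b, hb, hbv⟩ := hv
    obtain ⟨b', hb', hbw⟩ := hw
    rw [mat_eq_card_subtype, mat_eq_card_subtype, Nat.card_congr (nbrEquiv p v),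
      Nat.card_congr (nbrEquiv p w)]
    refine Nat.card_congr (Equiv.subtypeEquivRight fun c => and_congr_right fun hc => ?_)
    exact ⟨fun _ i => (mem_nbr_congr hE (hc.trans hb'.symm) _).2 (hbw i),
      fun _ i => (mem_nbr_congr hE (hc.trans hb.symm) _).2 (hbv i)⟩
  · rw [nbrAutomaton_mat_pos] at *
    obtain ⟨b, hb, hbv⟩ := hv
    have h1 := hbv i
    generalize v i = q at h1 ⊢
    obtain ⟨_, w, rfl⟩ := q
    refine ⟨w, rfl, fun _ => ?_⟩
    rw [← hb]
    exact hE _ _ h1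

theorem nbrAutomaton_conjugate (hE : ∀ u v, E u v → E v u) :
    Conjugate (nbrAutomaton d E).shift (homShift d E) := by
  have h := nbrAutomaton_isEdge.conjugate_of_equiv (𝒜 := nbrAutomaton d E)
    (fun b => ⟨{w | E b w}, b, rfl⟩) (fun b v => ∀ i, b ∈ (v i).1) fun p v =>
      ⟨(nbrEquiv p v).trans (Equiv.subtypeEquivRight fun b =>
        ⟨fun h => ⟨Subtype.ext h.1, h.2⟩, fun h => ⟨congrArg Subtype.val h.1, h.2⟩⟩)⟩
  convert h using 1
  ext y
  exact forall_congr' fun x => forall_congr' fun i => ⟨hE _ _, hE _ _⟩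

end

/-- A totally amalgamated trim edge tree automaton is regular if and only if its tree-shift is
conjugate to a Hom tree-shift. -/
theorem isConjugateToHom_iff_isRegular (hd : 1 ≤ d) (hA : 𝒜.IsEdge) (hAt : 𝒜.IsTrim)
    (hAm : ∀ q q', 𝒜.SameColumns q q' → q = q') :
    IsConjugateToHom 𝒜.shift ↔ 𝒜.IsRegular := by
  refine ⟨?_, fun h => h.isConjugateToHom hA hd⟩
  rintro ⟨V, _, E, hE, hc⟩
  have hE' : ∀ u v : {v // ∃ w, E v w}, E u.1 v.1 → E v.1 u.1 := fun u v => hE _ _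
  have hV : ∀ v : {v // ∃ w, E v w}, ∃ w : {v // ∃ w, E v w}, E v.1 w.1 :=
    fun ⟨v, w, h⟩ => ⟨⟨w, v, hE _ _ h⟩, h⟩
  have h := (hc.trans (homShift_conjugate_nonisolated hd).symm).trans
    (nbrAutomaton_conjugate hE').symm
  -- Both automata are trim and without mergeable states, so rigidity transports regularity from the
  -- neighbourhood automaton.
  obtain ⟨θ, hθ⟩ := exists_equiv_of_conjugate nbrAutomaton_isEdge (nbrAutomaton_isTrim hV hE')
    (nbrAutomaton_eq_of_sameColumns hE' hd) hA hAt hAm h.symm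
  exact (nbrAutomaton_isRegular hE').of_equiv θ hθ

theorem IsTotalAmalgamation.isConjugateToHom_iff (hd : 1 ≤ d) (hA : 𝒜.IsEdge) (hAt : 𝒜.IsTrim)
    (h : 𝒜.IsTotalAmalgamation ℬ) : IsConjugateToHom 𝒜.shift ↔ ℬ.IsRegular := by
  obtain ⟨h1, h2, h3⟩ := amalgamation_spec hA hAt h.1
  rw [← isConjugateToHom_iff_isRegular hd h1 h2 h.2, IsConjugateToHom.congr h3]

end TreeAutomaton

/-- Transitions `(p, a) → (v 0, …, v (d-1))` with numerical states and labels, as in the codes. -/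
abbrev Tr : Type := ℕ × ℕ × List ℕ

namespace Tr

open TreeShift TreeAutomaton

variable {d : ℕ}

/-! ### The procedure -/

def sources (E : List Tr) : List ℕ := E.map fun e => e.1

/-- The number of transitions from `p` to `w`. -/
def cnt (E : List Tr) (p : ℕ) (w : List ℕ) : ℕ :=
  (E.filter fun e => decide (e.1 = p) && decide (e.2.2 = w)).length

/-- The nonzero entries of the columns through `q` agree with those of the columns through `q'`. -/
def colSub (d : ℕ) (E : List Tr) (q q' : ℕ) : Bool :=
  E.all fun e => (List.range d).all fun i =>
    !decide (e.2.2.set i q = e.2.2) || decide (cnt E e.1 e.2.2 = cnt E e.1 (e.2.2.set i q'))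

/-- Testing in both directions compares all pairs of entries of which at least one is nonzero; a
pair of zeros needs no test. -/
def mergeable (d : ℕ) (E : List Tr) (q q' : ℕ) : Bool :=
  !decide (q = q') && (colSub d E q q' && colSub d E q' q)

/-- Add the row of `q'` to that of `q` and delete the columns through `q'`. -/
def merge (E : List Tr) (q q' : ℕ) : List Tr :=
  (E.filter fun e => !decide (q' ∈ e.2.2)).map fun e => (if e.1 = q' then q else e.1, e.2)

/-- The states that can be merged with another one. -/
def candidates (d : ℕ) (E : List Tr) : List ℕ :=
  (sources E).filter fun q => (sources E).any fun q' => mergeable d E q q'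

/-- The default `0` of `headD` is never reached in the second branch, since a candidate has a
partner by definition. -/
def mergeStep (d : ℕ) (E : List Tr) : List Tr :=
  if candidates d E = [] then E
  else merge E ((candidates d E).headD 0)
    (((sources E).filter fun q' => mergeable d E ((candidates d E).headD 0) q').headD 0)

/-- The folded list is only a counter: every effective step removes a state, and there are at most
as many states as transitions. -/
def amalgamate (d : ℕ) (E : List Tr) : List Tr := E.foldl (fun acc _ => mergeStep d acc) E

def trimStep (E : List Tr) : List Tr :=
  E.filter fun e => e.2.2.all fun s => decide (s ∈ sources E)

/-- Delete the states from which there is no infinite computation. -/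
def trim (E : List Tr) : List Tr := E.foldl (fun acc _ => trimStep acc) E

/-- Condition (i) is tested only for tuples obtained by changing one coordinate; the general case
follows by repetition. This keeps the number of tests polynomial. -/
def regCheck (d : ℕ) (E : List Tr) : Bool :=
  E.all fun e =>
    (e.2.2.all fun s => !decide (cnt E s (List.replicate d e.1) = 0)) &&
    E.all fun e' => !decide (e.1 = e'.1) ||
      (decide (cnt E e.1 e.2.2 = cnt E e.1 e'.2.2) &&
        (List.range d).all fun i => e'.2.2.all fun s => !decide (cnt E e.1 (e.2.2.set i s) = 0))

/-- A code may contain entries of the wrong length or out of range. They describe no transition and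
have to be discarded. -/
def valid (d n k : ℕ) (e : Tr) : Bool :=
  (decide (e.1 < n) && decide (e.2.1 < k)) &&
    (decide (e.2.2.length = d) && e.2.2.all fun s => decide (s < n))

def removeDups (E : List Tr) : List Tr :=
  E.foldl (fun acc e => if e ∈ acc then acc else e :: acc) []

def edgeCheck (E : List Tr) : Bool :=
  E.all fun e => E.all fun e' => !decide (e.2.1 = e'.2.1) || decide (e = e')

/-- The transitions of the automaton given by a code. -/
def transitions (d : ℕ) (c : ℕ × ℕ × List Tr) : List Tr :=
  removeDups (c.2.2.filter fun e => valid d c.1 c.2.1 e)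

/-- The test for edge automata whose tree-shift is conjugate to a Hom tree-shift. -/
def homCheck (d : ℕ) (c : ℕ × ℕ × List Tr) : Bool :=
  edgeCheck (transitions d c) && regCheck d (amalgamate d (trim (transitions d c)))

/-! ### Automata given by lists of transitions -/

theorem mem_sources {E : List Tr} {s : ℕ} : s ∈ sources E ↔ ∃ e ∈ E, e.1 = s := by
  simp [sources]

/-- Lists of the transitions of a trim edge automaton. -/
structure WF (d : ℕ) (E : List Tr) : Prop where
  nodup : (E.map fun e => e.2.1).Nodup
  length : ∀ e ∈ E, e.2.2.length = d
  closed : ∀ e ∈ E, ∀ s ∈ e.2.2, s ∈ sources E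

/-- The automaton whose transitions are those listed in `E`. -/
noncomputable abbrev listAut (d : ℕ) (E : List Tr) : TreeAutomaton d where
  Q := {s // s ∈ sources E}
  A := {a // a ∈ E.map fun e : Tr => e.2.1}
  fintypeQ := (List.finite_toSet (sources E)).fintype
  decidableEqQ := inferInstance
  finiteA := (List.finite_toSet (E.map fun e : Tr => e.2.1)).to_subtype
  trans p a v := (p.1, a.1, List.ofFn fun i => (v i).1) ∈ E

theorem WF.eq_of_label {E : List Tr} (h : WF d E) {e e' : Tr} (he : e ∈ E) (he' : e' ∈ E)
    (h' : e.2.1 = e'.2.1) : e = e' :=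
  List.inj_on_of_nodup_map h.nodup he he' h'

theorem WF.isEdge {E : List Tr} (h : WF d E) : (listAut d E).IsEdge := by
  intro a p v p' v' h1 h2
  have h3 := h.eq_of_label (e := (p.1, a.1, _)) (e' := (p'.1, a.1, _)) h1 h2 rfl
  simp only [Prod.mk.injEq, true_and] at h3
  refine ⟨Subtype.ext h3.1, funext fun i => Subtype.ext ?_⟩
  exact congrFun (List.ofFn_injective h3.2) i

theorem WF.exists_eq {E : List Tr} (h : WF d E) {e : Tr} (he : e ∈ E) :
    ∃ (p : (listAut d E).Q) (v : Fin d → (listAut d E).Q),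
      p.1 = e.1 ∧ (List.ofFn fun i => (v i).1) = e.2.2 := by
  have hl := h.length e he
  refine ⟨⟨e.1, mem_sources.2 ⟨e, he, rfl⟩⟩,
    fun i => ⟨e.2.2[i.1]'(by omega), h.closed e he _ (List.getElem_mem _)⟩, rfl, ?_⟩
  apply List.ext_getElem
  · simp [hl]
  · intro i h1 h2
    simp

theorem WF.isTrim {E : List Tr} (h : WF d E) : (listAut d E).IsTrim := by
  intro p
  obtain ⟨e, he, hp⟩ := mem_sources.1 p.2
  obtain ⟨p', v, hp', hv⟩ := h.exists_eq he
  refine ⟨⟨e.2.1, List.mem_map_of_mem (f := fun e : Tr => e.2.1) he⟩, v, ?_⟩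
  change (p.1, e.2.1, List.ofFn fun i => (v i).1) ∈ E
  rw [hv, ← hp]
  exact he

/-- The matrix counts labels and `cnt` counts list entries; the two agree because no label is
repeated in `E`. -/
theorem WF.mat_eq {E : List Tr} (h : WF d E) (p : (listAut d E).Q) (v : Fin d → (listAut d E).Q) :
    (listAut d E).mat p v = cnt E p.1 (List.ofFn fun i => (v i).1) := by
  generalize hw : (List.ofFn fun i => (v i).1) = w
  have hnd : ((E.filter fun e => decide (e.1 = p.1) && decide (e.2.2 = w)).map
      fun e => e.2.1).Nodup := h.nodup.sublist (List.filter_sublist.map _)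
  rw [mat, ← Set.ncard_image_of_injective _ Subtype.val_injective, cnt, ← List.length_map
    (f := fun e : Tr => e.2.1), ← List.toFinset_card_of_nodup hnd, ← Set.ncard_coe_finset]
  congr 1
  ext a
  simp only [Set.mem_image, Set.mem_ofPred_eq, List.coe_toFinset, List.mem_map, List.mem_filter,
    Bool.and_eq_true, decide_eq_true_eq]
  constructor
  · rintro ⟨a, ha, rfl⟩
    exact ⟨_, ⟨ha, rfl, hw⟩, rfl⟩
  · rintro ⟨e, ⟨he, h1, h2⟩, rfl⟩
    refine ⟨⟨e.2.1, List.mem_map_of_mem (f := fun e : Tr => e.2.1) he⟩, ?_, rfl⟩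
    change (p.1, e.2.1, List.ofFn fun i => (v i).1) ∈ E
    rw [hw, ← h1, ← h2]
    exact he

theorem cnt_pos_iff {E : List Tr} {p : ℕ} {w : List ℕ} :
    0 < cnt E p w ↔ ∃ e ∈ E, e.1 = p ∧ e.2.2 = w := by
  simp [cnt, List.length_pos_iff_exists_mem]

theorem ofFn_update {v : Fin d → ℕ} {i : Fin d} {q : ℕ} :
    List.ofFn (Function.update v i q) = (List.ofFn v).set i.1 q := by
  apply List.ext_getElem
  · simp
  · intro j h1 h2
    simp only [List.getElem_ofFn, List.getElem_set, Function.update_apply, Fin.ext_iff]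
    simp [eq_comm]

theorem ofFn_val_update {E : List Tr} {v : Fin d → (listAut d E).Q} {i : Fin d}
    {q : (listAut d E).Q} :
    (List.ofFn fun j => (Function.update v i q j).1) = (List.ofFn fun j => (v j).1).set i.1 q.1 := by
  rw [← ofFn_update]
  congr 1
  funext j
  by_cases hj : j = i
  · subst hj; simp
  · simp [hj]

theorem WF.colSub_iff {E : List Tr} (h : WF d E) (q q' : (listAut d E).Q) :
    colSub d E q.1 q'.1 = true ↔ ∀ p i v, 0 < (listAut d E).mat p (Function.update v i q) →
      (listAut d E).mat p (Function.update v i q) = (listAut d E).mat p (Function.update v i q') := by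
  simp only [colSub, List.all_eq_true, List.mem_range, Bool.or_eq_true, Bool.not_eq_true',
    decide_eq_false_iff_not, decide_eq_true_eq]
  constructor
  · intro hc p i v hp
    rw [h.mat_eq, ofFn_val_update] at hp
    obtain ⟨e, he, h1, h2⟩ := cnt_pos_iff.1 hp
    rw [h.mat_eq, h.mat_eq, ofFn_val_update, ofFn_val_update]
    have h3 := hc e he i i.2
    rw [h1, h2] at h3
    simpa using h3
  · intro hc e he i hi
    obtain ⟨p, v, h1, h2⟩ := h.exists_eq he
    -- This equality says that the coordinate `i` of the target is already `q`, that is, that the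
    -- column passes through `q` there.
    by_cases hs : e.2.2.set i q.1 = e.2.2
    · refine Or.inr ?_
      have h3 := hc p ⟨i, hi⟩ v
      rw [h.mat_eq, h.mat_eq, ofFn_val_update, ofFn_val_update, h2, h1, hs] at h3
      exact h3 (cnt_pos_iff.2 ⟨e, he, rfl, rfl⟩)
    · exact Or.inl hs

theorem WF.mergeable_iff {E : List Tr} (h : WF d E) (q q' : (listAut d E).Q) :
    mergeable d E q.1 q'.1 = true ↔ q ≠ q' ∧ (listAut d E).SameColumns q q' := by
  simp only [mergeable, Bool.and_eq_true, h.colSub_iff, Bool.not_eq_true', decide_eq_false_iff_not,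
    ne_eq, Subtype.ext_iff]
  refine and_congr_right fun _ => ⟨fun ⟨h1, h2⟩ p i v => ?_, fun hs => ⟨fun p i v _ => hs p i v,
    fun p i v _ => (hs p i v).symm⟩⟩
  rcases Nat.eq_zero_or_pos ((listAut d E).mat p (Function.update v i q)) with h3 | h3
  · rcases Nat.eq_zero_or_pos ((listAut d E).mat p (Function.update v i q')) with h4 | h4
    · rw [h3, h4]
    · exact (h2 p i v h4).symm
  · exact h1 p i v h3

/-! ### Correctness of merging and of the regularity test -/

theorem mem_merge {E : List Tr} {q q' : ℕ} {e : Tr} :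
    e ∈ merge E q q' ↔ ∃ e' ∈ E, q' ∉ e'.2.2 ∧ e = (if e'.1 = q' then q else e'.1, e'.2) := by
  simp only [merge, List.mem_map, List.mem_filter, Bool.not_eq_true', decide_eq_false_iff_not,
    and_assoc, @eq_comm _ e]

theorem length_filter_or {α : Type} (l : List α) (f g : α → Bool)
    (h : ∀ a, f a = true → g a = true → False) :
    (l.filter fun a => f a || g a).length = (l.filter f).length + (l.filter g).length := by
  induction l with
  | nil => rfl
  | cons a l ih =>
    have := h a
    cases hf : f a <;> cases hg : g a <;> simp_all <;> omega

theorem cnt_merge {E : List Tr} {q q' : ℕ} (hne : q ≠ q') {P : ℕ} (hP : P ≠ q') {w : List ℕ}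
    (hw : q' ∉ w) :
    cnt (merge E q q') P w = if P = q then cnt E q w + cnt E q' w else cnt E P w := by
  have h1 : cnt (merge E q q') P w = (E.filter fun e =>
      decide ((if e.1 = q' then q else e.1) = P) && decide (e.2.2 = w)).length := by
    rw [cnt, merge, List.filter_map, List.length_map, List.filter_filter]
    congr 1
    refine List.filter_congr fun e _ => ?_
    by_cases h : e.2.2 = w
    · simp [h, hw]
    · simp [h]
  rw [h1]
  split_ifs with h
  · subst h
    rw [cnt, cnt, ← length_filter_or]
    · congr 1
      refine List.filter_congr fun e _ => ?_
      by_cases h : e.1 = q' <;> simp [h, hne.symm]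
    · intro a h2 h3
      simp only [Bool.and_eq_true, decide_eq_true_eq] at h2 h3
      exact hne (h2.1.symm.trans h3.1)
  · rw [cnt]
    congr 1
    refine List.filter_congr fun e _ => ?_
    by_cases h' : e.1 = q'
    · simp [h', hP.symm, Ne.symm h]
    · simp [h']

/-- Deleting the columns through `q'` empties no row: if `s` has a transition, equality of columns
gives it one to the same target with `q'` replaced by `q`, and that one survives. -/
theorem WF.sources_merge {E : List Tr} (h : WF d E) {q q' : (listAut d E).Q} (hne : q ≠ q')
    (hs : (listAut d E).SameColumns q q') (s : ℕ) :
    s ∈ sources (merge E q.1 q'.1) ↔ s ∈ sources E ∧ s ≠ q'.1 := by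
  have hne' : q.1 ≠ q'.1 := fun h => hne (Subtype.ext h)
  simp only [mem_sources, mem_merge]
  constructor
  · rintro ⟨_, ⟨e, he, -, rfl⟩, rfl⟩
    dsimp only
    split_ifs with h1
    · exact ⟨mem_sources.1 q.2, hne'⟩
    · exact ⟨⟨e, he, rfl⟩, h1⟩
  · rintro ⟨⟨e, he, rfl⟩, h1⟩
    obtain ⟨p, v, hp, hv⟩ := h.exists_eq he
    have h2 : 0 < (listAut d E).mat p v := by
      rw [h.mat_eq, hv, hp]
      exact cnt_pos_iff.2 ⟨e, he, rfl, rfl⟩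
    rw [mat_congr (v' := fun i => if v i = q' then q else v i), h.mat_eq, cnt_pos_iff] at h2
    · obtain ⟨e', he', h3, h4⟩ := h2
      refine ⟨_, ⟨e', he', ?_, rfl⟩, ?_⟩
      · rw [h4, List.mem_ofFn]
        rintro ⟨i, hi⟩
        dsimp only at hi
        split_ifs at hi with h5
        · exact hne' hi
        · exact h5 (Subtype.ext hi)
      · rw [h3, hp]
        exact if_neg h1
    · intro i
      split_ifs with h5
      · rw [h5]
        exact fun p i v => (hs p i v).symm
      · exact fun _ _ _ => rfl

theorem WF.merge {E : List Tr} (h : WF d E) {q q' : (listAut d E).Q} (hne : q ≠ q')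
    (hs : (listAut d E).SameColumns q q') : WF d (merge E q.1 q'.1) := by
  refine ⟨?_, ?_, ?_⟩
  · rw [Tr.merge, List.map_map]
    exact h.nodup.sublist (List.filter_sublist.map _)
  · intro e he
    obtain ⟨e', he', -, rfl⟩ := mem_merge.1 he
    exact h.length e' he'
  · intro e he s hs'
    obtain ⟨e', he', h1, rfl⟩ := mem_merge.1 he
    refine (h.sources_merge hne hs s).2 ⟨h.closed e' he' s hs', ?_⟩
    rintro rfl
    exact h1 hs'

/-- The projection sends `q'` to `q` and fixes the other states. Equal columns allow every entry to
be read at the tuple of representatives, which avoids `q'`, and there the new row of `q` is the sum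
of two old ones. -/
theorem WF.isGeneralAmalgamation_merge {E : List Tr} (h : WF d E) {q q' : (listAut d E).Q}
    (hne : q ≠ q') (hs : (listAut d E).SameColumns q q') :
    (listAut d E).IsGeneralAmalgamation (listAut d (Tr.merge E q.1 q'.1)) := by
  have hne' : q.1 ≠ q'.1 := fun h => hne (Subtype.ext h)
  have hsrc := h.sources_merge hne hs
  let r : (listAut d E).Q → (listAut d E).Q := fun s => if s = q' then q else s
  have hr : ∀ s, (r s).1 ≠ q'.1 := by
    intro s
    simp only [r]
    split_ifs with h1
    · exact hne'
    · exact fun h2 => h1 (Subtype.ext h2)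
  let π : (listAut d E).Q → (listAut d (Tr.merge E q.1 q'.1)).Q :=
    fun s => ⟨(r s).1, (hsrc _).2 ⟨(r s).2, hr s⟩⟩
  have hπ : ∀ s s', π s = s' ↔ (r s).1 = s'.1 := fun s s' => Subtype.ext_iff
  refine ⟨(h.merge hne hs).isEdge, π, ?_, ?_, ?_⟩
  · rintro ⟨s, hs'⟩
    obtain ⟨h1, h2⟩ := (hsrc s).1 hs'
    refine ⟨⟨s, h1⟩, Subtype.ext ?_⟩
    have h3 : (⟨s, h1⟩ : (listAut d E).Q) ≠ q' := fun h3 => h2 (congrArg Subtype.val h3)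
    simp [π, r, h3]
  · intro s s' hss
    have h1 : r s = r s' := Subtype.ext ((hπ s (π s')).1 hss)
    simp only [r] at h1
    split_ifs at h1 with h2 h3 h3
    · rw [h2, h3]; exact fun _ _ _ => rfl
    · rw [h2, ← h1]; exact fun p i v => (hs p i v).symm
    · rw [h3, h1]; exact hs
    · rw [h1]; exact fun _ _ _ => rfl
  · intro P v
    have hv : ∀ p, (listAut d E).mat p v = cnt E p.1 (List.ofFn fun i => (r (v i)).1) := by
      intro p
      rw [mat_congr (v' := fun i => r (v i)), h.mat_eq]
      intro i
      simp only [r]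
      split_ifs with h5
      · rw [h5]
        exact fun p i v => (hs p i v).symm
      · exact fun _ _ _ => rfl
    have hw : q'.1 ∉ List.ofFn fun i => (r (v i)).1 := by
      rw [List.mem_ofFn]
      rintro ⟨i, hi⟩
      exact hr _ hi
    obtain ⟨hP1, hP2⟩ := (hsrc P.1).1 P.2
    rw [(h.merge hne hs).mat_eq]
    change cnt (Tr.merge E q.1 q'.1) P.1 (List.ofFn fun i => (r (v i)).1) = _
    rw [cnt_merge hne' hP2 hw, Finset.sum_congr rfl fun p _ => hv p]
    have hq' : r q' = q := by simp [r]
    have hself : ∀ s, s ≠ q' → r s = s := fun s hs => by simp [r, hs]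
    have key : ∀ S : Finset (listAut d E).Q, (∀ s, s ∈ S ↔ π s = P) →
        (if P.1 = q.1 then cnt E q.1 (List.ofFn fun i => (r (v i)).1) +
          cnt E q'.1 (List.ofFn fun i => (r (v i)).1)
          else cnt E P.1 (List.ofFn fun i => (r (v i)).1)) =
        ∑ p ∈ S, cnt E p.1 (List.ofFn fun i => (r (v i)).1) := by
      intro S hS
      split_ifs with hPq
      · have : S = {q, q'} := by
          ext s
          rw [hS, hπ, hPq, Finset.mem_insert, Finset.mem_singleton]
          by_cases h1 : s = q'
          · simp [h1, hq']
          · simp [h1, hself s h1, Subtype.ext_iff]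
        rw [this, Finset.sum_pair hne]
      · have : S = {⟨P.1, hP1⟩} := by
          ext s
          rw [hS, hπ, Finset.mem_singleton]
          by_cases h1 : s = q'
          · rw [h1, hq', Subtype.ext_iff]
            exact ⟨fun h => absurd h.symm hPq, fun h => absurd h.symm hP2⟩
          · rw [hself s h1, Subtype.ext_iff]
        rw [this, Finset.sum_singleton]
    exact key _ fun s => by simp

theorem WF.mergeStep_spec {E : List Tr} (h : WF d E) :
    (mergeStep d E = E ∧ ∀ q q', (listAut d E).SameColumns q q' → q = q') ∨
    ∃ q q' : (listAut d E).Q, q ≠ q' ∧ (listAut d E).SameColumns q q' ∧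
      mergeStep d E = Tr.merge E q.1 q'.1 := by
  rw [mergeStep]
  split_ifs with hc
  · refine Or.inl ⟨rfl, fun q q' hs => ?_⟩
    by_contra hne
    simp only [candidates, List.filter_eq_nil_iff, List.any_eq_true, not_exists, not_and] at hc
    exact hc q.1 q.2 q'.1 q'.2 ((h.mergeable_iff q q').2 ⟨hne, hs⟩)
  · right
    have hhead : ∀ l : List ℕ, l ≠ [] → l.headD 0 ∈ l := by
      rintro (_ | ⟨a, l⟩) hl
      · exact absurd rfl hl
      · simp
    have h1 := hhead _ hc
    generalize (candidates d E).headD 0 = q at h1 ⊢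
    simp only [candidates, List.mem_filter, List.any_eq_true] at h1
    obtain ⟨hq, s, hs⟩ := h1
    have h2 : ((sources E).filter fun q' => mergeable d E q q').headD 0 ∈ _ := hhead _ fun h3 =>
      by simpa [h3] using List.mem_filter.2 hs
    generalize ((sources E).filter fun q' => mergeable d E q q').headD 0 = q' at h2 ⊢
    obtain ⟨hq', hqq⟩ := List.mem_filter.1 h2
    obtain ⟨h3, h4⟩ := (h.mergeable_iff ⟨q, hq⟩ ⟨q', hq'⟩).1 hqq
    exact ⟨⟨q, hq⟩, ⟨q', hq'⟩, h3, h4, rfl⟩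

/-- Every effective step removes exactly one state, so the iteration is stationary after as many
steps as there are states; without states nothing can be merged. -/
theorem WF.mergeStep_iterate {n : ℕ} {E : List Tr} (h : WF d E)
    (hn : (sources E).toFinset.card ≤ n) :
    WF d ((mergeStep d)^[n] E) ∧ (listAut d E).IsTotalAmalgamation (listAut d ((mergeStep d)^[n] E)) := by
  induction n generalizing E with
  | zero =>
    refine ⟨h, .refl, fun q q' _ => ?_⟩
    have h1 := Finset.card_eq_zero.1 (Nat.le_zero.1 hn)
    have h2 : q.1 ∈ (sources E).toFinset := List.mem_toFinset.2 q.2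
    simp [h1] at h2
  | succ n ih =>
    rw [Function.iterate_succ_apply]
    rcases h.mergeStep_spec with ⟨h1, h2⟩ | ⟨q, q', hne, hs, h1⟩
    · rw [h1, Function.iterate_fixed h1]
      exact ⟨h, .refl, h2⟩
    · rw [h1]
      have h3 : (sources (Tr.merge E q.1 q'.1)).toFinset = (sources E).toFinset.erase q'.1 := by
        ext s
        simp only [List.mem_toFinset, h.sources_merge hne hs, Finset.mem_erase, and_comm]
      obtain ⟨h4, h5, h6⟩ := ih (h.merge hne hs) (by
        rw [h3, Finset.card_erase_of_mem (List.mem_toFinset.2 q'.2)]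
        omega)
      exact ⟨h4, .head (h.isGeneralAmalgamation_merge hne hs) h5, h6⟩

theorem WF.amalgamate {E : List Tr} (h : WF d E) :
    WF d (amalgamate d E) ∧ (listAut d E).IsTotalAmalgamation (listAut d (amalgamate d E)) := by
  rw [Tr.amalgamate, List.foldl_const]
  refine h.mergeStep_iterate ((List.toFinset_card_le _).trans ?_)
  simp [sources]

theorem WF.isRegular_iff {E : List Tr} (h : WF d E) :
    (listAut d E).IsRegular ↔ regCheck d E = true := by
  have hmem : ∀ {e : Tr}, e ∈ E → 0 < cnt E e.1 e.2.2 := fun he => cnt_pos_iff.2 ⟨_, he, rfl, rfl⟩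
  simp only [regCheck, List.all_eq_true, List.mem_range, Bool.or_eq_true, Bool.not_eq_true',
    decide_eq_false_iff_not, decide_eq_true_eq, Bool.and_eq_true, ← Nat.pos_iff_ne_zero]
  constructor
  · intro hr e he
    obtain ⟨p, v, hp, hv⟩ := h.exists_eq he
    have h1 : 0 < (listAut d E).mat p v := by
      rw [h.mat_eq, hp, hv]
      exact hmem he
    refine ⟨fun s hs => ?_, fun e' he' => or_iff_not_imp_left.2 fun hpp => ?_⟩
    · rw [← hv, List.mem_ofFn] at hs
      obtain ⟨i, rfl⟩ := hs
      have h2 := hr.back p v h1 i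
      rw [h.mat_eq, List.ofFn_const, hp] at h2
      exact h2
    · rw [not_not] at hpp
      obtain ⟨p', w, hp', hw⟩ := h.exists_eq he'
      obtain rfl : p = p' := Subtype.ext (by rw [hp, hp', hpp])
      have h2 : 0 < (listAut d E).mat p w := by
        rw [h.mat_eq, hp', hw]
        exact hmem he'
      constructor
      · have h3 := hr.eq_of_pos p v w h1 h2
        rwa [h.mat_eq, h.mat_eq, hv, hw, hp] at h3
      · intro i hi s hs
        rw [← hw, List.mem_ofFn] at hs
        obtain ⟨j, rfl⟩ := hs
        have h3 := hr.pos_of_mem p v w (Function.update v ⟨i, hi⟩ (w j)) h1 h2 fun k => by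
          by_cases hk : k = ⟨i, hi⟩
          · subst hk; exact Or.inr ⟨j, by simp⟩
          · exact Or.inl ⟨k, by simp [hk]⟩
        rw [h.mat_eq, ofFn_val_update, hp, hv] at h3
        exact h3
  · intro hr
    have hex : ∀ p v, 0 < (listAut d E).mat p v →
        ∃ e ∈ E, e.1 = p.1 ∧ e.2.2 = List.ofFn fun i => (v i).1 := fun p v hv => by
      rwa [h.mat_eq, cnt_pos_iff] at hv
    have hupd : ∀ p v w i j, 0 < (listAut d E).mat p v → 0 < (listAut d E).mat p w →
        0 < (listAut d E).mat p (Function.update v i (w j)) := by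
      intro p v w i j hv hw
      obtain ⟨e, he, h1, h2⟩ := hex p v hv
      obtain ⟨e', he', h1', h2'⟩ := hex p w hw
      have h3 := (((hr e he).2 e' he').resolve_left fun h => h (h1.trans h1'.symm)).2 i.1 i.2
        (w j).1 (by rw [h2', List.mem_ofFn]; exact ⟨j, rfl⟩)
      rwa [h1, h2, ← ofFn_val_update, ← h.mat_eq] at h3
    refine ⟨fun p v w u hv hw hu => ?_, fun p v w hv hw => ?_, fun p v hv i => ?_⟩
    -- The tuple `u` is reached from `v` by changing one coordinate at a time to an entry of `v` or
    -- of `w`, as in `hupd`.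
    · have key : ∀ S : Finset (Fin d), 0 < (listAut d E).mat p (S.piecewise u v) := by
        intro S
        induction S using Finset.induction_on with
        | empty => simpa using hv
        | insert j S hj ih =>
          rw [Finset.piecewise_insert]
          rcases hu j with ⟨k, hk⟩ | ⟨k, hk⟩
          · rw [← hk]
            exact hupd _ _ _ _ _ ih hv
          · rw [← hk]
            exact hupd _ _ _ _ _ ih hw
      simpa using key Finset.univ
    · obtain ⟨e, he, h1, h2⟩ := hex p v hv
      obtain ⟨e', he', h1', h2'⟩ := hex p w hw
      have h3 := (((hr e he).2 e' he').resolve_left fun h => h (h1.trans h1'.symm)).1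
      rw [h.mat_eq, h.mat_eq, ← h2, ← h2', ← h1]
      exact h3
    · obtain ⟨e, he, h1, h2⟩ := hex p v hv
      have h3 := (hr e he).1 (v i).1 (by rw [h2, List.mem_ofFn]; exact ⟨i, rfl⟩)
      rw [h.mat_eq, List.ofFn_const, ← h1]
      exact h3

/-- A list of the transitions of an automaton. -/
theorem _root_.TreeAutomaton.exists_list (𝒜 : TreeAutomaton d) (hA : 𝒜.IsEdge) (hAt : 𝒜.IsTrim) :
    ∃ E, WF d E ∧ 𝒜.IsGeneralAmalgamation (listAut d E) := by
  classical
  have : Fintype 𝒜.A := Fintype.ofFinite _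
  obtain ⟨f, hf⟩ := Countable.exists_injective_nat 𝒜.Q
  obtain ⟨g, hg⟩ := Countable.exists_injective_nat 𝒜.A
  let T := 𝒜.Q × 𝒜.A × (Fin d → 𝒜.Q)
  let l : List T := ((Finset.univ : Finset T).filter fun e => 𝒜.trans e.1 e.2.1 e.2.2).toList
  let E : List Tr := l.map fun e => (f e.1, g e.2.1, List.ofFn fun i => f (e.2.2 i))
  have hl : ∀ e, e ∈ l ↔ 𝒜.trans e.1 e.2.1 e.2.2 := by simp [l]
  have hE : ∀ e : Tr, e ∈ E ↔ ∃ p a v, 𝒜.trans p a v ∧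
      (f p, g a, List.ofFn fun i => f (v i)) = e := by
    intro e
    simp only [E, List.mem_map, hl]
    exact ⟨fun ⟨e, h1, h2⟩ => ⟨_, _, _, h1, h2⟩, fun ⟨p, a, v, h1, h2⟩ => ⟨(p, a, v), h1, h2⟩⟩
  have hsrc : ∀ s, s ∈ sources E ↔ ∃ p, f p = s := by
    intro s
    rw [mem_sources]
    constructor
    · rintro ⟨e, he, rfl⟩
      obtain ⟨p, a, v, -, rfl⟩ := (hE e).1 he
      exact ⟨p, rfl⟩
    · rintro ⟨p, rfl⟩
      obtain ⟨a, v, h⟩ := hAt p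
      exact ⟨_, (hE _).2 ⟨p, a, v, h, rfl⟩, rfl⟩
  have hwf : WF d E := by
    refine ⟨?_, ?_, ?_⟩
    · rw [List.map_map]
      refine (Finset.nodup_toList _).map_on fun e he e' he' h => ?_
      rw [hl] at he he'
      have h1 : e.2.1 = e'.2.1 := hg h
      rw [h1] at he
      obtain ⟨h2, h3⟩ := hA _ _ _ _ _ he he'
      exact Prod.ext h2 (Prod.ext h1 h3)
    · intro e he
      obtain ⟨p, a, v, -, rfl⟩ := (hE e).1 he
      simp
    · intro e he s hs
      obtain ⟨p, a, v, -, rfl⟩ := (hE e).1 he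
      obtain ⟨i, hi⟩ := List.mem_ofFn.1 hs
      exact (hsrc s).2 ⟨v i, hi⟩
  -- Renaming states and labels is a general amalgamation whose classes are singletons.
  let π : 𝒜.Q → (listAut d E).Q := fun p => ⟨f p, (hsrc _).2 ⟨p, rfl⟩⟩
  have hπ : Function.Injective π := fun p p' h => hf (Subtype.ext_iff.1 h)
  refine ⟨E, hwf, hwf.isEdge, π, ?_, fun q q' h => ?_, ?_⟩
  · rintro ⟨s, hs⟩
    obtain ⟨p, rfl⟩ := (hsrc s).1 hs
    exact ⟨p, rfl⟩
  · obtain rfl := hπ h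
    exact fun _ _ _ => rfl
  · rintro ⟨s, hs⟩ v
    obtain ⟨p, rfl⟩ := (hsrc s).1 hs
    have h1 : ∀ S : Finset 𝒜.Q, (∀ s, s ∈ S ↔ π s = π p) → ∑ p ∈ S, 𝒜.mat p v = 𝒜.mat p v := by
      intro S hS
      rw [show S = {p} by ext p'; rw [hS, Finset.mem_singleton, hπ.eq_iff], Finset.sum_singleton]
    refine Eq.trans ?_ (h1 _ fun s => Finset.mem_filter.trans (by simp [π])).symm
    rw [mat_eq_card_subtype, mat_eq_card_subtype]
    symm
    refine Nat.card_congr (Equiv.ofBijective (fun a => ⟨⟨g a.1, List.mem_map.2 ⟨_,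
      (hE _).2 ⟨p, a.1, v, a.2, rfl⟩, rfl⟩⟩, (hE _).2 ⟨p, a.1, v, a.2, rfl⟩⟩) ⟨?_, ?_⟩)
    · intro a a' h
      exact Subtype.ext (hg (congrArg (fun b => b.1.1) h))
    · rintro ⟨⟨b, hb⟩, h⟩
      obtain ⟨p', a, v', ha, h2⟩ := (hE _).1 h
      simp only [Prod.mk.injEq] at h2
      obtain ⟨h2, rfl, h4⟩ := h2
      obtain rfl := hf h2
      have h5 : v' = v := funext fun i => hf (congrFun (List.ofFn_injective h4) i)
      exact ⟨⟨a, h5 ▸ ha⟩, rfl⟩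

/-! ### Tree-shifts given by lists of transitions -/

/-- The trees accepted by means of the transitions in `E`. -/
def listShift (d : ℕ) (E : List Tr) : Set (LTree d ℕ) :=
  {t | ∃ u : LTree d ℕ, ∀ x, (u x, t x, List.ofFn fun i => u (x ++ [i])) ∈ E}

theorem listAut_conjugate (E : List Tr) : Conjugate (listAut d E).shift (listShift d E) := by
  convert Conjugate.of_image (Y := (listAut d E).shift) Subtype.val Subtype.val_injective using 1
  ext t
  constructor
  · rintro ⟨u, hu⟩
    exact ⟨fun x => ⟨t x, List.mem_map.2 ⟨_, hu x, rfl⟩⟩,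
      ⟨fun x => ⟨u x, mem_sources.2 ⟨_, hu x, rfl⟩⟩, fun x => hu x⟩, rfl⟩
  · rintro ⟨t, ⟨u, hu⟩, rfl⟩
    exact ⟨fun x => (u x).1, hu⟩

theorem mem_removeDups {E : List Tr} {e : Tr} : e ∈ removeDups E ↔ e ∈ E := by
  have key : ∀ acc : List Tr, e ∈ E.foldl (fun acc e => if e ∈ acc then acc else e :: acc) acc ↔
      e ∈ acc ∨ e ∈ E := by
    induction E with
    | nil => simp
    | cons a E ih =>
      intro acc
      rw [List.foldl_cons, ih]
      split_ifs with h
      · by_cases h' : e = a <;> simp_all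
      · simp only [List.mem_cons]; tauto
  simp [removeDups, key]

theorem nodup_removeDups (E : List Tr) : (removeDups E).Nodup := by
  have key : ∀ acc : List Tr, acc.Nodup →
      (E.foldl (fun acc e => if e ∈ acc then acc else e :: acc) acc).Nodup := by
    induction E with
    | nil => simp
    | cons a E ih =>
      intro acc hacc
      rw [List.foldl_cons]
      apply ih
      split_ifs with h
      · exact hacc
      · exact List.nodup_cons.2 ⟨h, hacc⟩
  exact key [] List.nodup_nil

theorem mem_transitions {c : ℕ × ℕ × List Tr} {e : Tr} :
    e ∈ transitions d c ↔ e ∈ c.2.2 ∧ e.1 < c.1 ∧ e.2.1 < c.2.1 ∧ e.2.2.length = d ∧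
      ∀ s ∈ e.2.2, s < c.1 := by
  simp [transitions, mem_removeDups, valid, and_assoc]

theorem transCode_mem_transitions {c : ℕ × ℕ × List Tr} (p : Fin c.1) (a : Fin c.2.1)
    (v : Fin d → Fin c.1) :
    (p.1, a.1, List.ofFn fun i => (v i).1) ∈ transitions d c ↔ (automatonOfCode d c).trans p a v := by
  rw [mem_transitions]
  refine ⟨fun h => h.1, fun h => ⟨h, p.2, a.2, by simp, ?_⟩⟩
  simp [List.mem_ofFn]

theorem exists_of_mem_transitions {c : ℕ × ℕ × List Tr} {e : Tr} (he : e ∈ transitions d c) :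
    ∃ (p : Fin c.1) (a : Fin c.2.1) (v : Fin d → Fin c.1),
      e = (p.1, a.1, List.ofFn fun i => (v i).1) := by
  obtain ⟨-, h1, h2, h3, h4⟩ := mem_transitions.1 he
  refine ⟨⟨e.1, h1⟩, ⟨e.2.1, h2⟩,
    fun i => ⟨e.2.2[i.1]'(by omega), h4 _ (List.getElem_mem _)⟩, ?_⟩
  refine Prod.ext rfl (Prod.ext rfl (List.ext_getElem (by simp [h3]) ?_))
  intro i h1 h2
  simp

theorem code_conjugate (c : ℕ × ℕ × List Tr) :
    Conjugate (automatonOfCode d c).shift (listShift d (transitions d c)) := by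
  convert Conjugate.of_image (Y := (automatonOfCode d c).shift) Fin.val Fin.val_injective using 1
  ext t
  constructor
  · rintro ⟨u, hu⟩
    have h1 := fun x => (mem_transitions.1 (hu x)).2
    exact ⟨fun x => ⟨t x, (h1 x).2.1⟩, ⟨fun x => ⟨u x, (h1 x).1⟩,
      fun x => (transCode_mem_transitions _ _ _).1 (hu x)⟩, rfl⟩
  · rintro ⟨t, ⟨u, hu⟩, rfl⟩
    exact ⟨fun x => (u x).1, fun x => (transCode_mem_transitions _ _ _).2 (hu x)⟩

theorem isEdge_iff_edgeCheck (c : ℕ × ℕ × List Tr) :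
    (automatonOfCode d c).IsEdge ↔ edgeCheck (transitions d c) = true := by
  simp only [edgeCheck, List.all_eq_true, Bool.or_eq_true, Bool.not_eq_true',
    decide_eq_false_iff_not, decide_eq_true_eq]
  constructor
  · intro h e he e' he'
    refine or_iff_not_imp_left.2 fun hl => ?_
    rw [not_not] at hl
    obtain ⟨p, a, v, rfl⟩ := exists_of_mem_transitions he
    obtain ⟨p', a', v', rfl⟩ := exists_of_mem_transitions he'
    rw [transCode_mem_transitions] at he he'
    obtain rfl : a = a' := Fin.ext hl
    obtain ⟨rfl, rfl⟩ := h _ _ _ _ _ he he'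
    rfl
  · intro h a p v p' v' h1 h2
    have h3 := (h _ ((transCode_mem_transitions p a v).2 h1) _
      ((transCode_mem_transitions p' a v').2 h2)).resolve_left (by simp)
    simp only [Prod.mk.injEq, true_and] at h3
    exact ⟨Fin.ext h3.1, funext fun i => Fin.ext (congrFun (List.ofFn_injective h3.2) i)⟩

/-- In an accepting computation the state at each child is the source of the transition used there,
so no deleted transition is ever used. -/
theorem listShift_trimStep (E : List Tr) : listShift d (trimStep E) = listShift d E := by
  ext t
  refine exists_congr fun u => ⟨fun h x => (List.mem_filter.1 (h x)).1, fun h x => ?_⟩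
  refine List.mem_filter.2 ⟨h x, ?_⟩
  simp only [List.all_eq_true, decide_eq_true_eq, List.mem_ofFn]
  rintro _ ⟨i, rfl⟩
  exact mem_sources.2 ⟨_, h _, rfl⟩

theorem listShift_trim (E : List Tr) : listShift d (trim E) = listShift d E := by
  rw [trim, List.foldl_const]
  generalize E.length = n
  induction n with
  | zero => rfl
  | succ n ih => rw [Function.iterate_succ_apply', listShift_trimStep, ih]

theorem trim_sublist (E : List Tr) : (trim E).Sublist E := by
  rw [trim, List.foldl_const]
  generalize E.length = n
  induction n with
  | zero => exact List.Sublist.refl _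
  | succ n ih =>
    rw [Function.iterate_succ_apply']
    exact List.filter_sublist.trans ih

/-- A step that changes the list shortens it, so as many steps as the length of `E` reach a fixed
point. -/
theorem trim_closed (E : List Tr) : ∀ e ∈ trim E, ∀ s ∈ e.2.2, s ∈ sources (trim E) := by
  have key : ∀ (n : ℕ) (E : List Tr), E.length ≤ n → trimStep (trimStep^[n] E) = trimStep^[n] E := by
    intro n
    induction n with
    | zero =>
      intro E hE
      obtain rfl := List.length_eq_zero_iff.1 (Nat.le_zero.1 hE)
      rfl
    | succ n ih =>
      intro E hE
      rw [Function.iterate_succ_apply]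
      by_cases h : trimStep E = E
      · rw [h, Function.iterate_fixed h, h]
      · refine ih _ (Nat.le_of_lt_succ (lt_of_lt_of_le ?_ hE))
        refine lt_of_le_of_ne (List.length_filter_le _ _) fun h' => h ?_
        exact List.filter_sublist.eq_of_length h'
  have h := key _ E le_rfl
  rw [← List.foldl_const (f := trimStep) (l := E), ← trim] at h
  intro e he
  rw [← h] at he
  have h1 := (List.mem_filter.1 he).2
  simpa using h1

/-- Distinct labels and the closure obtained by trimming make the trimmed list well formed. As
trimming does not change the accepted trees, the criterion for trim automata decides the general
case. -/
theorem homCheck_iff (hd : 1 ≤ d) (c : ℕ × ℕ × List Tr) :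
    homCheck d c = true ↔
      (automatonOfCode d c).IsEdge ∧ IsConjugateToHom (automatonOfCode d c).shift := by
  rw [homCheck, Bool.and_eq_true, isEdge_iff_edgeCheck]
  refine and_congr_right fun he => ?_
  have hwf : WF d (trim (transitions d c)) := by
    refine ⟨List.Nodup.sublist ((trim_sublist _).map _) ?_, ?_, trim_closed _⟩
    · refine (nodup_removeDups _).map_on fun e h1 e' h2 h => ?_
      simp only [edgeCheck, List.all_eq_true, Bool.or_eq_true, Bool.not_eq_true',
        decide_eq_false_iff_not, decide_eq_true_eq] at he
      exact (he e h1 e' h2).resolve_left fun h' => h' h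
    · exact fun e he => (mem_transitions.1 ((trim_sublist _).subset he)).2.2.2.1
  obtain ⟨h1, h2⟩ := hwf.amalgamate
  rw [← h1.isRegular_iff, ← h2.isConjugateToHom_iff hd hwf.isEdge hwf.isTrim,
    IsConjugateToHom.congr (listAut_conjugate _), listShift_trim,
    IsConjugateToHom.congr (code_conjugate c)]

end Tr

theorem TreeAutomaton.exists_isTotalAmalgamation {d : ℕ} (𝒜 : TreeAutomaton d) (hA : 𝒜.IsEdge)
    (hAt : 𝒜.IsTrim) : ∃ ℬ, 𝒜.IsTotalAmalgamation ℬ := by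
  obtain ⟨E, h1, h2⟩ := 𝒜.exists_list hA hAt
  obtain ⟨-, h3, h4⟩ := h1.amalgamate
  exact ⟨_, .head h2 h3, h4⟩

namespace WhileProg

/-! ### Data are computable -/

namespace Data

/-- This numbering agrees with the standard encoding of lists, see `encode_toList`, so passing
between data and lists is primitive recursive at no cost. -/
def toNat : Data → ℕ
  | nil => 0
  | cons a b => Nat.succ (Nat.pair a.toNat b.toNat)

def decodeNat : ℕ → Data
  | 0 => nil
  | n + 1 => cons (decodeNat n.unpair.1) (decodeNat n.unpair.2)
decreasing_by
  · exact Nat.lt_succ_of_le (Nat.unpair_left_le n)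
  · exact Nat.lt_succ_of_le (Nat.unpair_right_le n)

theorem decodeNat_toNat (a : Data) : decodeNat a.toNat = a := by
  induction a with
  | nil => rw [toNat, decodeNat]
  | cons a b iha ihb => rw [toNat, decodeNat, Nat.unpair_pair, iha, ihb]

theorem toNat_decodeNat (n : ℕ) : (decodeNat n).toNat = n := by
  induction n using Nat.strong_induction_on with
  | _ n ih =>
    match n with
    | 0 => rw [decodeNat, toNat]
    | n + 1 =>
      rw [decodeNat, toNat, ih _ (Nat.lt_succ_of_le (Nat.unpair_left_le n)),
        ih _ (Nat.lt_succ_of_le (Nat.unpair_right_le n)), Nat.pair_unpair]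

def equivNat : Data ≃ ℕ := ⟨toNat, decodeNat, decodeNat_toNat, toNat_decodeNat⟩

instance instPrimcodable : Primcodable Data := Primcodable.ofEquiv ℕ equivNat

theorem primrec_toNat : Primrec toNat := Primrec.of_equiv (e := equivNat)

theorem toNat_primrec_iff {α : Type} [Primcodable α] {f : α → Data} :
    (Primrec fun a => (f a).toNat) ↔ Primrec f :=
  Primrec.of_equiv_iff equivNat

theorem primrec_cons : Primrec₂ cons :=
  toNat_primrec_iff.1 (Primrec.succ.comp (Primrec₂.natPair.comp
    (primrec_toNat.comp Primrec.fst) (primrec_toNat.comp Primrec.snd)))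

theorem primrec_hd : Primrec hd := by
  refine toNat_primrec_iff.1 ((Primrec.fst.comp (Primrec.unpair.comp
    (Primrec.pred.comp primrec_toNat))).of_eq fun a => ?_)
  cases a <;> simp [hd, toNat]

theorem primrec_tl : Primrec tl := by
  refine toNat_primrec_iff.1 ((Primrec.snd.comp (Primrec.unpair.comp
    (Primrec.pred.comp primrec_toNat))).of_eq fun a => ?_)
  cases a <;> simp [tl, toNat]

/-- The list of the entries of a datum. -/
def toList : Data → List Data
  | nil => []
  | cons a b => a :: b.toList

theorem toList_ofList (l : List Data) : (ofList l).toList = l := by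
  induction l with
  | nil => rfl
  | cons a l ih => rw [ofList, toList, ih]

theorem encode_toList (a : Data) : Encodable.encode a.toList = a.toNat := by
  induction a with
  | nil => rfl
  | cons a b _ ih =>
    rw [toList, toNat, Encodable.encode_list_cons, ih]
    rfl

theorem primrec_toList : Primrec toList :=
  Primrec.encode_iff.1 (primrec_toNat.of_eq fun a => (encode_toList a).symm)

theorem primrec_ofList : Primrec ofList :=
  toNat_primrec_iff.1 (Primrec.encode.of_eq fun l => by rw [← encode_toList, toList_ofList])

theorem size_pos (a : Data) : 1 ≤ a.size := by
  cases a <;> simp [size]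

theorem size_hd_le (a : Data) : a.hd.size ≤ a.size := by
  cases a <;> simp [size, hd]; omega

theorem size_tl_le (a : Data) : a.tl.size ≤ a.size := by
  cases a <;> simp [size, tl]; omega

theorem ofList_injective : Function.Injective ofList :=
  Function.LeftInverse.injective toList_ofList

end Data

/-! ### Representations -/

/-- Types whose elements are represented by data. -/
class Enc (α : Type) where
  enc : α → Data
  enc_injective : Function.Injective enc

open Enc

section

variable {α β γ δ : Type} [Enc α] [Enc β] [Enc γ] [Enc δ]

instance : Enc Unit := ⟨fun _ => .nil, fun _ _ _ => rfl⟩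

instance : Enc Bool := ⟨fun b => if b then .cons .nil .nil else .nil, by
  rintro (_ | _) (_ | _) <;> simp⟩

instance : Enc ℕ := ⟨Data.ofNat, fun a b h => by
  simpa using congrArg List.length (Data.ofList_injective h)⟩

instance : Enc (α × β) := ⟨fun x => .cons (enc x.1) (enc x.2), fun a b h => by
  injection h with h1 h2
  exact Prod.ext (enc_injective h1) (enc_injective h2)⟩

instance : Enc (List α) := ⟨fun l => .ofList (l.map enc), fun _ _ h =>
  List.map_injective_iff.2 enc_injective (Data.ofList_injective h)⟩

theorem enc_prod (x : α × β) : enc x = .cons (enc x.1) (enc x.2) := rfl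

theorem enc_cons (a : α) (l : List α) : enc (a :: l) = .cons (enc a) (enc l) := rfl

theorem enc_nat_succ (n : ℕ) : enc (n + 1) = .cons .nil (enc n) := rfl

theorem enc_bool_ne_nil (b : Bool) : enc b ≠ .nil ↔ b = true := by cases b <;> simp [enc]

/-- The size of the representation. -/
def esize (x : α) : ℕ := (enc x).size

theorem esize_pos (x : α) : 1 ≤ esize x := Data.size_pos _

theorem esize_prod (x : α × β) : esize x = esize x.1 + esize x.2 + 1 := rfl

theorem esize_nil : esize ([] : List α) = 1 := rfl

theorem esize_cons (a : α) (l : List α) : esize (a :: l) = esize a + esize l + 1 := rfl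

theorem esize_bool_le (b : Bool) : esize b ≤ 3 := by cases b <;> simp [esize, enc, Data.size]

theorem esize_nat (n : ℕ) : esize n = 2 * n + 1 := by
  induction n with
  | zero => rfl
  | succ n ih =>
    rw [esize, enc_nat_succ, Data.size, ← esize, ih, Data.size]
    ring

theorem length_le_esize (l : List α) : l.length ≤ esize l := by
  induction l with
  | nil => simp
  | cons a l ih => rw [esize_cons, List.length_cons]; omega

theorem esize_le_of_mem {a : α} {l : List α} (h : a ∈ l) : esize a ≤ esize l := by
  induction l with
  | nil => simp at h
  | cons b l ih =>
    rw [esize_cons]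
    rcases List.mem_cons.1 h with rfl | h
    · omega
    · have := ih h; omega

theorem esize_list_le {l : List α} {N S : ℕ} (hN : l.length ≤ N) (hS : ∀ a ∈ l, esize a ≤ S) :
    esize l ≤ N * (S + 1) + 1 := by
  have : esize l ≤ l.length * (S + 1) + 1 := by
    clear hN
    induction l with
    | nil => simp [esize_nil]
    | cons a l ih =>
      have h1 := ih fun a ha => hS a (List.mem_cons_of_mem _ ha)
      have h2 := hS a List.mem_cons_self
      rw [esize_cons, List.length_cons, Nat.succ_mul]
      omega
  exact this.trans (Nat.add_le_add_right (Nat.mul_le_mul_right _ hN) 1)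

/-! ### Primitive recursive realizers -/

/-- `f` is realized by a primitive recursive function on the representations. -/
def IsRealized (f : α → β) : Prop :=
  ∃ F : Data → Data, Primrec F ∧ ∀ x, F (enc x) = enc (f x)

namespace IsRealized

theorem comp {g : β → γ} {f : α → β} (hg : IsRealized g) (hf : IsRealized f) :
    IsRealized fun x => g (f x) := by
  obtain ⟨G, hG, hG'⟩ := hg
  obtain ⟨F, hF, hF'⟩ := hf
  exact ⟨_, hG.comp hF, fun x => by rw [hF', hG']⟩

theorem id : IsRealized fun x : α => x := ⟨_, Primrec.id, fun _ => rfl⟩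

theorem const (b : β) : IsRealized fun _ : α => b := ⟨_, Primrec.const (enc b), fun _ => rfl⟩

theorem pair {f : α → β} {g : α → γ} (hf : IsRealized f) (hg : IsRealized g) :
    IsRealized fun x => (f x, g x) := by
  obtain ⟨F, hF, hF'⟩ := hf
  obtain ⟨G, hG, hG'⟩ := hg
  exact ⟨_, Data.primrec_cons.comp hF hG, fun x => by rw [hF', hG', enc_prod]⟩

theorem ite {c : α → Prop} [DecidablePred c] {f g : α → β} (hc : IsRealized fun x => decide (c x))
    (hf : IsRealized f) (hg : IsRealized g) : IsRealized fun x => if c x then f x else g x := by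
  obtain ⟨C, hC, hC'⟩ := hc
  obtain ⟨F, hF, hF'⟩ := hf
  obtain ⟨G, hG, hG'⟩ := hg
  refine ⟨_, Primrec.ite (Primrec.eq.comp hC (Primrec.const .nil)) hG hF, fun x => ?_⟩
  have h := enc_bool_ne_nil (decide (c x))
  rw [hC', hF', hG']
  by_cases hx : c x
  · have : enc (decide (c x)) ≠ .nil := h.2 (by simpa using hx)
    simp [if_neg this, if_pos hx]
  · have : enc (decide (c x)) = .nil := by simpa [hx] using h
    simp [if_pos this, if_neg hx]

theorem eq [DecidableEq β] {f g : α → β} (hf : IsRealized f) (hg : IsRealized g) :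
    IsRealized fun x => decide (f x = g x) := by
  obtain ⟨F, hF, hF'⟩ := hf
  obtain ⟨G, hG, hG'⟩ := hg
  refine ⟨_, Primrec.ite (Primrec.eq.comp hF hG) (Primrec.const (enc true))
    (Primrec.const (enc false)), fun x => ?_⟩
  simp only [hF', hG', enc_injective.eq_iff]
  split_ifs with h <;> simp [h]

theorem foldl {l : δ → List α} {i : δ → β} {s : δ → β → α → β} (hl : IsRealized l)
    (hi : IsRealized i) (hs : IsRealized fun y : β × α × δ => s y.2.2 y.1 y.2.1) :
    IsRealized fun x => (l x).foldl (s x) (i x) := by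
  obtain ⟨L, hL, hL'⟩ := hl
  obtain ⟨I, hI, hI'⟩ := hi
  obtain ⟨S, hS, hS'⟩ := hs
  refine ⟨fun x => (L x).toList.foldl (fun b a => S (.cons b (.cons a x))) (I x),
    Primrec.list_foldl (h := fun x y => S (.cons y.1 (.cons y.2 x)))
      (Data.primrec_toList.comp hL) hI (hS.comp (Data.primrec_cons.comp
      (Primrec.fst.comp Primrec.snd)
      (Data.primrec_cons.comp (Primrec.snd.comp Primrec.snd) Primrec.fst))), fun x => ?_⟩
  dsimp only
  rw [hL', hI', show enc (l x) = Data.ofList ((l x).map enc) from rfl, Data.toList_ofList]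
  generalize l x = l
  generalize i x = b
  induction l generalizing b with
  | nil => rfl
  | cons a l ih =>
    rw [List.map_cons, List.foldl_cons, List.foldl_cons, ← ih]
    congr 1
    exact hS' (b, a, x)

/-- Functions between data that realize a function. -/
theorem of_data {f : α → β} (F : Data → Data) (hF : Primrec F) (h : ∀ x, F (enc x) = enc (f x)) :
    IsRealized f := ⟨F, hF, h⟩

theorem primrec [Primcodable α] (hα : Primrec (enc : α → Data)) {f : α → Bool}
    (hf : IsRealized f) : Primrec f := by
  obtain ⟨F, hF, hF'⟩ := hf
  refine (Primrec.ite (Primrec.eq.comp (hF.comp hα) (Primrec.const .nil)) (Primrec.const false)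
    (Primrec.const true)).of_eq fun x => ?_
  have := enc_bool_ne_nil (f x)
  rw [hF']
  cases h : f x <;> simp_all

end IsRealized

theorem primrec_enc_prod [Primcodable α] [Primcodable β] (hα : Primrec (enc : α → Data))
    (hβ : Primrec (enc : β → Data)) : Primrec (enc : α × β → Data) :=
  Data.primrec_cons.comp (hα.comp Primrec.fst) (hβ.comp Primrec.snd)

theorem primrec_enc_list [Primcodable α] (hα : Primrec (enc : α → Data)) :
    Primrec (enc : List α → Data) :=
  Data.primrec_ofList.comp (Primrec.list_map Primrec.id (hα.comp Primrec.snd))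

theorem primrec_enc_nat : Primrec (enc : ℕ → Data) := by
  refine (Primrec.nat_rec₁ (f := fun _ b => Data.cons .nil b) Data.nil
    (Data.primrec_cons.comp (Primrec.const Data.nil) Primrec.snd)).of_eq fun n => ?_
  induction n with
  | zero => rfl
  | succ n ih => rw [enc_nat_succ, ← ih]

end

end WhileProg

namespace WhileProg

open Enc

variable {α β γ δ : Type} [Enc α] [Enc β] [Enc γ] [Enc δ]

theorem eval_mono (P : Polynomial ℕ) {a b : ℕ} (h : a ≤ b) : P.eval a ≤ P.eval b := by
  rw [Polynomial.eval_eq_sum_range, Polynomial.eval_eq_sum_range]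
  gcongr

/-! ### Programs with time and space bounds -/

/-- `c` halts within time `T` in a store that satisfies `R`. -/
def Runs (m : ℕ) (c : Cmd) (σ : Store) (T : ℕ) (R : Store → Prop) : Prop :=
  ∃ t ≤ T, ∃ σ', Exec m c σ t σ' ∧ R σ'

theorem Runs.assign {m x : ℕ} {e : Expr} {σ : Store} {T : ℕ} {R : Store → Prop}
    (hm : (e.eval σ).size ≤ m) (hT : e.cost σ + 1 ≤ T)
    (hR : R (Function.update σ x (e.eval σ))) : Runs m (.assign x e) σ T R :=
  ⟨_, hT, _, .assign σ x e hm, hR⟩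

theorem Runs.seq {m : ℕ} {c₁ c₂ : Cmd} {σ : Store} {T₁ T₂ T : ℕ} {R S : Store → Prop}
    (h₁ : Runs m c₁ σ T₁ S) (h₂ : ∀ σ', S σ' → Runs m c₂ σ' T₂ R) (hT : T₁ + T₂ ≤ T) :
    Runs m (.seq c₁ c₂) σ T R := by
  obtain ⟨t₁, ht₁, σ₁, he₁, hs⟩ := h₁
  obtain ⟨t₂, ht₂, σ₂, he₂, hr⟩ := h₂ σ₁ hs
  exact ⟨t₁ + t₂, by omega, σ₂, .seq he₁ he₂, hr⟩

theorem Runs.mono {m : ℕ} {c : Cmd} {σ : Store} {T T' : ℕ} {R R' : Store → Prop}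
    (h : Runs m c σ T R) (hT : T ≤ T') (hR : ∀ σ', R σ' → R' σ') : Runs m c σ T' R' := by
  obtain ⟨t, ht, σ', he, hr⟩ := h
  exact ⟨t, ht.trans hT, σ', he, hR _ hr⟩

/-- For every variable `b` some program replaces the representation of `x` in `b` by that of `f x`
within time and space `P`, without changing the variables below `b`. -/
def RunsWithin (f : α → β) (P : Polynomial ℕ) : Prop :=
  ∀ b, ∃ c, ∀ (x : α) (σ : Store) (m : ℕ), σ b = enc x → P.eval (esize x) ≤ m →
    Runs m c σ (P.eval (esize x)) fun σ' => σ' b = enc (f x) ∧ ∀ j < b, σ' j = σ j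

/-- `f` is computed in polynomial time and space. -/
def PolyTime (f : α → β) : Prop :=
  ∃ P : Polynomial ℕ, (∀ x, esize (f x) ≤ P.eval (esize x)) ∧ RunsWithin f P

namespace PolyTime

theorem of_expr {f : α → β} (e : ℕ → Expr) (K : ℕ)
    (h : ∀ b x σ, σ b = enc x → (e b).eval σ = enc (f x) ∧ (e b).cost σ ≤ K * esize x)
    (hf : ∀ x, esize (f x) ≤ K * esize x) : PolyTime f := by
  -- The summand `1` pays for the assignment.
  refine ⟨Polynomial.C K * Polynomial.X + 1, fun x => ?_, fun b => ⟨.assign b (e b),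
    fun x σ m hx hm => ?_⟩⟩
  · have := hf x
    simp only [Polynomial.eval_add, Polynomial.eval_mul, Polynomial.eval_C, Polynomial.eval_X,
      Polynomial.eval_one]
    omega
  · obtain ⟨h1, h2⟩ := h b x σ hx
    have := hf x
    simp only [Polynomial.eval_add, Polynomial.eval_mul, Polynomial.eval_C, Polynomial.eval_X,
      Polynomial.eval_one] at hm ⊢
    refine Runs.assign ?_ (by omega) ⟨?_, ?_⟩
    · rw [h1]
      exact (this.trans (Nat.le_succ _)).trans hm
    · rw [Function.update_self, h1]
    · intro j hj
      exact Function.update_of_ne hj.ne _ _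

theorem id : PolyTime fun x : α => x :=
  of_expr (fun b => .var b) 1 (fun b x σ h => ⟨h, by simpa [Expr.cost] using esize_pos x⟩)
    fun x => by omega

/-- The bound on the size of `f x` turns the cost of `g` into a polynomial in the size of `x`; this
is why `PolyTime` bounds the output too. -/
theorem comp {g : β → γ} {f : α → β} (hg : PolyTime g) (hf : PolyTime f) :
    PolyTime fun x => g (f x) := by
  obtain ⟨G, hGs, hG⟩ := hg
  obtain ⟨F, hFs, hF⟩ := hf
  have key : ∀ x, G.eval (esize (f x)) ≤ G.eval (F.eval (esize x)) := fun x =>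
    eval_mono G (hFs x)
  refine ⟨F + G.comp F, fun x => ?_, fun b => ?_⟩
  · have h1 := hGs (f x)
    have h2 := key x
    simp only [Polynomial.eval_add, Polynomial.eval_comp]
    omega
  · obtain ⟨c₁, h₁⟩ := hF b
    obtain ⟨c₂, h₂⟩ := hG b
    refine ⟨.seq c₁ c₂, fun x σ m hx hm => ?_⟩
    have h2 := key x
    simp only [Polynomial.eval_add, Polynomial.eval_comp] at hm ⊢
    refine Runs.seq (h₁ x σ m hx (by omega)) (fun σ' hσ' => ?_) le_rfl
    exact (h₂ (f x) σ' m hσ'.1 (by omega)).mono h2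
      fun σ'' h => ⟨h.1, fun j hj => (h.2 j hj).trans (hσ'.2 j hj)⟩

theorem pair {f : α → β} {g : α → γ} (hf : PolyTime f) (hg : PolyTime g) :
    PolyTime fun x => (f x, g x) := by
  obtain ⟨F, hFs, hF⟩ := hf
  obtain ⟨G, hGs, hG⟩ := hg
  -- Here `8 = 2 + 2 + 4`: two copies of the input and the final pairing. `X` leaves room for the
  -- copies.
  refine ⟨F + G + Polynomial.X + 8, fun x => ?_, fun b => ?_⟩
  · have h1 := hFs x
    have h2 := hGs x
    simp only [Polynomial.eval_add, Polynomial.eval_X, Polynomial.eval_ofNat, esize_prod]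
    omega
  · obtain ⟨c₁, h₁⟩ := hF (b + 1)
    obtain ⟨c₂, h₂⟩ := hG (b + 2)
    -- A program run at a variable preserves those below it, so the input at `b` and the first
    -- result at `b + 1` survive the later steps.
    refine ⟨.seq (.assign (b + 1) (.var b)) (.seq c₁ (.seq (.assign (b + 2) (.var b)) (.seq c₂
      (.assign b (.cons (.var (b + 1)) (.var (b + 2))))))), fun x σ m hx hm => ?_⟩
    have hfx := hFs x
    have hgx := hGs x
    simp only [Polynomial.eval_add, Polynomial.eval_X, Polynomial.eval_ofNat] at hm ⊢
    refine Runs.seq (T₁ := 2) (S := fun σ' => σ' (b + 1) = enc x ∧ ∀ j < b + 1, σ' j = σ j)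
      (T₂ := F.eval (esize x) + (2 + (G.eval (esize x) + 4)))
      (Runs.assign ?_ le_rfl ⟨?_, ?_⟩) ?_ (by omega)
    · rw [Expr.eval, hx]
      exact le_trans (by omega : esize x ≤ _) hm
    · rw [Function.update_self, Expr.eval, hx]
    · intro j hj
      exact Function.update_of_ne hj.ne _ _
    rintro σ₁ ⟨h11, h12⟩
    refine Runs.seq (h₁ x σ₁ m h11 (by omega)) ?_ le_rfl
    rintro σ₂ ⟨h21, h22⟩
    have hb2 : σ₂ b = enc x := by rw [h22 b (by omega), h12 b (by omega), hx]
    refine Runs.seq (T₁ := 2) (S := fun σ' => σ' (b + 2) = enc x ∧ ∀ j < b + 2, σ' j = σ₂ j)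
      (Runs.assign ?_ le_rfl ⟨?_, ?_⟩) ?_ le_rfl
    · rw [Expr.eval, hb2]
      exact le_trans (by omega : esize x ≤ _) hm
    · rw [Function.update_self, Expr.eval, hb2]
    · intro j hj
      exact Function.update_of_ne hj.ne _ _
    rintro σ₃ ⟨h31, h32⟩
    refine Runs.seq (h₂ x σ₃ m h31 (by omega)) ?_ le_rfl
    rintro σ₄ ⟨h41, h42⟩
    have h1 : σ₄ (b + 1) = enc (f x) := by rw [h42 _ (by omega), h32 _ (by omega), h21]
    refine Runs.assign ?_ (by simp [Expr.cost]) ⟨?_, ?_⟩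
    · rw [Expr.eval, Expr.eval, Expr.eval, h1, h41, Data.size]
      exact le_trans (by unfold esize at *; omega) hm
    · rw [Function.update_self, Expr.eval, Expr.eval, Expr.eval, h1, h41, enc_prod]
    · intro j hj
      rw [Function.update_of_ne hj.ne, h42 _ (by omega), h32 _ (by omega), h22 _ (by omega),
        h12 _ (by omega)]

theorem ite {c : α → Prop} [DecidablePred c] {f g : α → β} (hc : PolyTime fun x => decide (c x))
    (hf : PolyTime f) (hg : PolyTime g) : PolyTime fun x => if c x then f x else g x := by
  obtain ⟨C, -, hC⟩ := hc
  obtain ⟨F, hFs, hF⟩ := hf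
  obtain ⟨G, hGs, hG⟩ := hg
  refine ⟨C + F + G + Polynomial.X + 4, fun x => ?_, fun b => ?_⟩
  · have h1 := hFs x
    have h2 := hGs x
    simp only [Polynomial.eval_add, Polynomial.eval_X, Polynomial.eval_ofNat]
    split_ifs <;> omega
  · obtain ⟨c₀, h₀⟩ := hC (b + 1)
    obtain ⟨c₁, h₁⟩ := hF b
    obtain ⟨c₂, h₂⟩ := hG b
    refine ⟨.seq (.assign (b + 1) (.var b)) (.seq c₀ (.ite (.var (b + 1)) c₁ c₂)),
      fun x σ m hx hm => ?_⟩
    simp only [Polynomial.eval_add, Polynomial.eval_X, Polynomial.eval_ofNat] at hm ⊢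
    refine Runs.seq (T₁ := 2) (S := fun σ' => σ' (b + 1) = enc x ∧ ∀ j < b + 1, σ' j = σ j)
      (T₂ := C.eval (esize x) + (2 + (F.eval (esize x) + G.eval (esize x))))
      (Runs.assign ?_ le_rfl ⟨?_, ?_⟩) ?_ (by omega)
    · rw [Expr.eval, hx]
      exact le_trans (by omega : esize x ≤ _) hm
    · rw [Function.update_self, Expr.eval, hx]
    · intro j hj
      exact Function.update_of_ne hj.ne _ _
    rintro σ₁ ⟨h11, h12⟩
    refine Runs.seq (h₀ x σ₁ m h11 (by omega)) ?_ le_rfl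
    rintro σ₂ ⟨h21, h22⟩
    have hb2 : σ₂ b = enc x := by rw [h22 b (by omega), h12 b (by omega), hx]
    have hpre : ∀ j < b, σ₂ j = σ j := fun j hj => by
      rw [h22 _ (by omega), h12 _ (by omega)]
    have hnil := enc_bool_ne_nil (decide (c x))
    rw [← h21, decide_eq_true_eq] at hnil
    by_cases hcx : c x
    · obtain ⟨t, ht, σ', he, hr⟩ := h₁ x σ₂ m hb2 (by omega)
      refine ⟨_, ?_, σ', .ite_true (hnil.2 hcx) he, ?_, fun j hj => ?_⟩
      · rw [Expr.cost]; omega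
      · rw [hr.1, if_pos hcx]
      · rw [hr.2 j hj, hpre j hj]
    · obtain ⟨t, ht, σ', he, hr⟩ := h₂ x σ₂ m hb2 (by omega)
      refine ⟨_, ?_, σ', .ite_false (not_not.1 fun h => hcx (hnil.1 h)) he, ?_, fun j hj => ?_⟩
      · rw [Expr.cost]; omega
      · rw [hr.1, if_neg hcx]
      · rw [hr.2 j hj, hpre j hj]

/-- The parameter is kept in `b`, the rest of the list in `b + 1`, the accumulator in `b + 2`, and
the body acts on their combination in `b + 3`. The body costs at most `T`; the surcharge `14 = 7 + 2
+ 3 + 2` pays for packing, the two updates and the loop test, and the last `2` for the final test.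
-/
theorem loop {l : List α} {s : δ → β → α → β} {S T B N m b : ℕ} {c : Cmd} {x : δ}
    (hc : ∀ (y : β × α × δ) (σ : Store), esize y ≤ S → σ (b + 3) = enc y →
      Runs m c σ T fun σ' => σ' (b + 3) = enc (s y.2.2 y.1 y.2.1) ∧ ∀ j < b + 3, σ' j = σ j)
    (hx : esize x + B + N + 2 ≤ S) (hm : S ≤ m) (hN : esize l ≤ N) :
    ∀ (i : β), (∀ l' : List α, l' <+: l → esize (l'.foldl (s x) i) ≤ B) → ∀ σ : Store,
      σ b = enc x → σ (b + 1) = enc l → σ (b + 2) = enc i →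
      Runs m (.while (.var (b + 1))
          (.seq (.assign (b + 3) (.cons (.var (b + 2)) (.cons (.hd (.var (b + 1))) (.var b))))
            (.seq c (.seq (.assign (b + 2) (.var (b + 3))) (.assign (b + 1) (.tl (.var (b + 1))))))))
        σ (l.length * (T + 14) + 2)
        fun σ' => σ' (b + 2) = enc (l.foldl (s x) i) ∧ ∀ j < b, σ' j = σ j := by
  induction l with
  | nil =>
    intro i _ σ _ h1 h2
    exact ⟨_, by simp [Expr.cost], σ, .while_done h1, h2, fun _ _ => rfl⟩
  | cons a l ih =>
    intro i hB σ h0 h1 h2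
    have hi := hB [] List.nil_prefix
    rw [List.foldl_nil] at hi
    have hi' := hB [a] ⟨l, rfl⟩
    rw [List.foldl_cons, List.foldl_nil] at hi'
    rw [esize_cons] at hN
    rw [enc_cons] at h1
    have hbody : Runs m (.seq (.assign (b + 3) (.cons (.var (b + 2)) (.cons (.hd (.var (b + 1)))
        (.var b)))) (.seq c (.seq (.assign (b + 2) (.var (b + 3)))
          (.assign (b + 1) (.tl (.var (b + 1))))))) σ (T + 12)
        fun σ' => σ' b = enc x ∧ σ' (b + 1) = enc l ∧ σ' (b + 2) = enc (s x i a) ∧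
          ∀ j < b, σ' j = σ j := by
      refine Runs.seq (T₁ := 7) (T₂ := T + (2 + 3))
        (S := fun σ' => σ' (b + 3) = enc (i, a, x) ∧ ∀ j < b + 3, σ' j = σ j)
        (Runs.assign ?_ (by simp [Expr.cost]) ⟨?_, ?_⟩) ?_ (by omega)
      · simp only [Expr.eval, h0, h1, h2, Data.hd]
        change esize (i, a, x) ≤ m
        rw [esize_prod, esize_prod]
        dsimp only
        omega
      · rw [Function.update_self]
        simp only [Expr.eval, h0, h1, h2, Data.hd, enc_prod]
      · intro j hj
        exact Function.update_of_ne hj.ne _ _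
      rintro σ₁ ⟨h11, h12⟩
      refine Runs.seq (hc (i, a, x) σ₁ ?_ h11) ?_ le_rfl
      · rw [esize_prod, esize_prod]
        dsimp only
        omega
      rintro σ₂ ⟨h21, h22⟩
      have hpre : ∀ j < b + 3, σ₂ j = σ j := fun j hj => (h22 j hj).trans (h12 j hj)
      refine Runs.seq (T₁ := 2) (S := fun σ' => σ' (b + 2) = enc (s x i a) ∧
        ∀ j < b + 2, σ' j = σ j) (Runs.assign ?_ le_rfl ⟨?_, ?_⟩) ?_ le_rfl
      · rw [Expr.eval, h21]
        change esize (s x i a) ≤ m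
        omega
      · rw [Function.update_self, Expr.eval, h21]
      · intro j hj
        rw [Function.update_of_ne hj.ne, hpre j (by omega)]
      rintro σ₃ ⟨h31, h32⟩
      have h33 : σ₃ (b + 1) = .cons (enc a) (enc l) := by rw [h32 _ (by omega), h1]
      refine Runs.assign ?_ le_rfl ⟨?_, ?_, ?_, ?_⟩
      · rw [Expr.eval, Expr.eval, h33]
        change esize l ≤ m
        omega
      · rw [Function.update_of_ne (by omega), h32 _ (by omega), h0]
      · rw [Function.update_self, Expr.eval, Expr.eval, h33]
        rfl
      · rw [Function.update_of_ne (by omega), h31]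
      · intro j hj
        rw [Function.update_of_ne (by omega), h32 _ (by omega)]
    obtain ⟨t₁, ht₁, σ₁, he₁, g0, g1, g2, g3⟩ := hbody
    obtain ⟨t₂, ht₂, σ₂, he₂, g4, g5⟩ := ih (by omega) (s x i a)
      (fun l' hl' => hB (a :: l') (List.cons_prefix_cons.2 ⟨rfl, hl'⟩)) σ₁ g0 g1 g2
    refine ⟨_, ?_, σ₂, .while_step ?_ he₁ he₂, g4, fun j hj => (g5 j hj).trans (g3 j hj)⟩
    · rw [Expr.cost, List.length_cons, Nat.succ_mul]
      omega
    · rw [Expr.eval, h1]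
      simp

/-- Iterating a polynomial step can make sizes explode, so a polynomial bound `B` on all
intermediate accumulators, the folds over prefixes, is part of the hypotheses. -/
theorem foldl {l : δ → List α} {i : δ → β} {s : δ → β → α → β} (hl : PolyTime l)
    (hi : PolyTime i) (hs : PolyTime fun y : β × α × δ => s y.2.2 y.1 y.2.1) (B : Polynomial ℕ)
    (hB : ∀ x, ∀ l' : List α, l' <+: l x → esize (l'.foldl (s x) (i x)) ≤ B.eval (esize x)) :
    PolyTime fun x => (l x).foldl (s x) (i x) := by
  obtain ⟨L, hLs, hL⟩ := hl
  obtain ⟨I, hIs, hI⟩ := hi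
  obtain ⟨S, hSs, hS⟩ := hs
  -- A bound on the size of the triple handed to the body: parameter, accumulator, list entry and
  -- two pairings.
  let W : Polynomial ℕ := Polynomial.X + B + L + 2
  have hW : ∀ n, W.eval n = n + B.eval n + L.eval n + 2 := fun n => by simp [W]
  refine ⟨L + I + W + S.comp W + L * (S.comp W + 14) + 20, fun x => ?_, fun b => ?_⟩
  · have h1 := hB x (l x) List.prefix_rfl
    simp only [Polynomial.eval_add, Polynomial.eval_mul, Polynomial.eval_comp,
      Polynomial.eval_ofNat, hW]
    omega
  · obtain ⟨c₁, h₁⟩ := hL (b + 1)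
    obtain ⟨c₂, h₂⟩ := hI (b + 2)
    obtain ⟨c₃, h₃⟩ := hS (b + 3)
    refine ⟨.seq (.assign (b + 1) (.var b)) (.seq c₁ (.seq (.assign (b + 2) (.var b)) (.seq c₂
      (.seq (.while (.var (b + 1))
          (.seq (.assign (b + 3) (.cons (.var (b + 2)) (.cons (.hd (.var (b + 1))) (.var b))))
            (.seq c₃ (.seq (.assign (b + 2) (.var (b + 3)))
              (.assign (b + 1) (.tl (.var (b + 1))))))))
        (.assign b (.var (b + 2))))))), fun x σ m hx hm => ?_⟩
    have hlx := hLs x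
    have hBx := hB x (l x) List.prefix_rfl
    have hSW : ∀ y : β × α × δ, esize y ≤ W.eval (esize x) →
        S.eval (esize y) ≤ S.eval (W.eval (esize x)) := fun y hy => eval_mono S hy
    have hlen : (l x).length * (S.eval (W.eval (esize x)) + 14) ≤
        L.eval (esize x) * (S.eval (W.eval (esize x)) + 14) :=
      Nat.mul_le_mul_right _ ((length_le_esize _).trans hlx)
    have hWx := hW (esize x)
    simp only [Polynomial.eval_add, Polynomial.eval_mul, Polynomial.eval_comp,
      Polynomial.eval_ofNat] at hm ⊢
    generalize S.eval (W.eval (esize x)) = SW at *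
    generalize L.eval (esize x) * (SW + 14) = M at *
    generalize W.eval (esize x) = Wx at *
    refine Runs.seq (T₁ := 2) (S := fun σ' => σ' (b + 1) = enc x ∧ ∀ j < b + 1, σ' j = σ j)
      (T₂ := L.eval (esize x) + (2 + (I.eval (esize x) + ((l x).length * (SW + 14) + 2 + 2))))
      (Runs.assign ?_ le_rfl ⟨?_, ?_⟩) ?_ (by omega)
    · rw [Expr.eval, hx]
      exact le_trans (by omega : esize x ≤ _) hm
    · rw [Function.update_self, Expr.eval, hx]
    · intro j hj
      exact Function.update_of_ne hj.ne _ _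
    rintro σ₁ ⟨h11, h12⟩
    refine Runs.seq (h₁ x σ₁ m h11 (by omega)) ?_ le_rfl
    rintro σ₂ ⟨h21, h22⟩
    have hb2 : σ₂ b = enc x := by rw [h22 b (by omega), h12 b (by omega), hx]
    refine Runs.seq (T₁ := 2) (S := fun σ' => σ' (b + 2) = enc x ∧ ∀ j < b + 2, σ' j = σ₂ j)
      (Runs.assign ?_ le_rfl ⟨?_, ?_⟩) ?_ le_rfl
    · rw [Expr.eval, hb2]
      exact le_trans (by omega : esize x ≤ _) hm
    · rw [Function.update_self, Expr.eval, hb2]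
    · intro j hj
      exact Function.update_of_ne hj.ne _ _
    rintro σ₃ ⟨h31, h32⟩
    refine Runs.seq (h₂ x σ₃ m h31 (by omega)) ?_ le_rfl
    rintro σ₄ ⟨h41, h42⟩
    have hb : σ₄ b = enc x := by rw [h42 _ (by omega), h32 _ (by omega), hb2]
    have hb1 : σ₄ (b + 1) = enc (l x) := by rw [h42 _ (by omega), h32 _ (by omega), h21]
    refine Runs.seq (loop (S := Wx) (T := SW) (B := B.eval (esize x)) (N := L.eval (esize x))
      (fun y σ' hy hσ' => (h₃ y σ' m hσ' ((hSW y hy).trans (by omega))).mono (hSW y hy)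
        fun _ h => h) (by omega) (by omega) hlx (i x) (hB x) σ₄ hb hb1 h41) ?_ le_rfl
    rintro σ₅ ⟨h51, h52⟩
    refine Runs.assign ?_ le_rfl ⟨?_, ?_⟩
    · rw [Expr.eval, h51]
      change esize _ ≤ m
      omega
    · rw [Function.update_self, Expr.eval, h51]
    · intro j hj
      rw [Function.update_of_ne hj.ne, h52 _ hj, h42 _ (by omega), h32 _ (by omega),
        h22 _ (by omega), h12 _ (by omega)]

end PolyTime

end WhileProg

/-! ### Combinators for functions both primitive recursive and polynomial -/

namespace WhileProg

open Enc

/-- `f` is computed in polynomial time and space, and realized by a primitive recursive function. -/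
def Feasible {α β : Type} [Enc α] [Enc β] (f : α → β) : Prop := IsRealized f ∧ PolyTime f

namespace Feasible

variable {α β γ δ : Type} [Enc α] [Enc β] [Enc γ] [Enc δ]

theorem id : Feasible fun x : α => x := ⟨.id, .id⟩

theorem comp {g : β → γ} {f : α → β} (hg : Feasible g) (hf : Feasible f) :
    Feasible fun x => g (f x) := ⟨hg.1.comp hf.1, hg.2.comp hf.2⟩

theorem pair {f : α → β} {g : α → γ} (hf : Feasible f) (hg : Feasible g) :
    Feasible fun x => (f x, g x) := ⟨hf.1.pair hg.1, hf.2.pair hg.2⟩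

theorem ite {c : α → Prop} [DecidablePred c] {f g : α → β} (hc : Feasible fun x => decide (c x))
    (hf : Feasible f) (hg : Feasible g) : Feasible fun x => if c x then f x else g x :=
  ⟨hc.1.ite hf.1 hg.1, hc.2.ite hf.2 hg.2⟩

/-- The constant expression whose value is a given datum. -/
def ofData : Data → Expr
  | .nil => .nil
  | .cons a b => .cons (ofData a) (ofData b)

theorem eval_ofData (a : Data) (σ : Store) : (ofData a).eval σ = a := by
  induction a with
  | nil => rfl
  | cons a b iha ihb => rw [ofData, Expr.eval, iha, ihb]

theorem cost_ofData (a : Data) (σ : Store) : (ofData a).cost σ = a.size := by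
  induction a with
  | nil => rfl
  | cons a b iha ihb => rw [ofData, Expr.cost, Data.size, iha, ihb]

theorem const (y : β) : Feasible fun _ : α => y := by
  refine ⟨.const y, .of_expr (fun _ => ofData (enc y)) (esize y) (fun b x σ _ => ⟨eval_ofData _ _, ?_⟩)
    fun x => Nat.le_mul_of_pos_right _ (esize_pos x)⟩
  rw [cost_ofData]
  exact Nat.le_mul_of_pos_right _ (esize_pos x)

/-- Nothing has to be computed when argument and value have the same representation, as for a pair
and a list cell, or for a list of units and its length. -/
theorem of_enc_eq {f : α → β} (h : ∀ x, enc x = enc (f x)) : Feasible f :=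
  ⟨.of_data _ Primrec.id h, .of_expr (fun b => .var b) 1
    (fun b x σ hx => ⟨hx.trans (h x), by simpa [Expr.cost] using esize_pos x⟩)
    fun x => by rw [esize, ← h, ← esize]; omega⟩

theorem of_hd {f : α → β} (h : ∀ x, (enc x).hd = enc (f x)) : Feasible f :=
  ⟨.of_data _ Data.primrec_hd h, .of_expr (fun b => .hd (.var b)) 2
    (fun b x σ hx => ⟨by rw [Expr.eval, Expr.eval, hx, h], by
      have := esize_pos x
      simp only [Expr.cost]; omega⟩)
    fun x => by
      have := Data.size_hd_le (enc x)
      rw [esize, ← h, esize]; omega⟩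

theorem of_tl {f : α → β} (h : ∀ x, (enc x).tl = enc (f x)) : Feasible f :=
  ⟨.of_data _ Data.primrec_tl h, .of_expr (fun b => .tl (.var b)) 2
    (fun b x σ hx => ⟨by rw [Expr.eval, Expr.eval, hx, h], by
      have := esize_pos x
      simp only [Expr.cost]; omega⟩)
    fun x => by
      have := Data.size_tl_le (enc x)
      rw [esize, ← h, esize]; omega⟩

theorem fst {f : δ → α × β} (hf : Feasible f) : Feasible fun x => (f x).1 :=
  (of_hd (f := Prod.fst) fun _ : α × β => rfl).comp hf

theorem snd {f : δ → α × β} (hf : Feasible f) : Feasible fun x => (f x).2 :=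
  (of_tl (f := Prod.snd) fun _ : α × β => rfl).comp hf

theorem eq [DecidableEq β] {f g : α → β} (hf : Feasible f) (hg : Feasible g) :
    Feasible fun x => decide (f x = g x) := by
  refine ⟨hf.1.eq hg.1, PolyTime.comp (g := fun y : β × β => decide (y.1 = y.2)) ?_ (hf.2.pair hg.2)⟩
  refine .of_expr (fun b => .eq (.hd (.var b)) (.tl (.var b))) 5 (fun b x σ hx => ⟨?_, ?_⟩)
    fun x => ?_
  · simp only [Expr.eval, hx, enc_prod, Data.hd, Data.tl, enc_injective.eq_iff]
    split_ifs with h <;> simp [h, enc]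
  · have := esize_prod x
    simp only [Expr.eval, Expr.cost, hx, enc_prod, Data.hd, Data.tl]
    unfold esize at *
    omega
  · have := esize_bool_le (decide (x.1 = x.2))
    have := esize_pos x
    omega

theorem not {p : α → Bool} (hp : Feasible p) : Feasible fun x => !p x := by
  convert hp.eq (const false) using 2 with x
  cases p x <;> rfl

theorem bite {p : α → Bool} {f g : α → β} (hp : Feasible p) (hf : Feasible f) (hg : Feasible g) :
    Feasible fun x => if p x = true then f x else g x :=
  ite (by simpa using hp) hf hg

theorem and {p q : α → Bool} (hp : Feasible p) (hq : Feasible q) :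
    Feasible fun x => p x && q x := by
  convert hp.bite hq (const false) using 2 with x
  cases p x <;> rfl

theorem or {p q : α → Bool} (hp : Feasible p) (hq : Feasible q) :
    Feasible fun x => p x || q x := by
  convert hp.bite (const true) hq using 2 with x
  cases p x <;> rfl

theorem cons {f : δ → α} {l : δ → List α} (hf : Feasible f) (hl : Feasible l) :
    Feasible fun x => f x :: l x :=
  (of_enc_eq (f := fun y : α × List α => y.1 :: y.2) fun _ => rfl).comp (hf.pair hl)

theorem tail {l : δ → List α} (hl : Feasible l) : Feasible fun x => (l x).tail :=
  (of_tl (f := List.tail) fun l : List α => by cases l <;> rfl).comp hl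

theorem headD {l : δ → List ℕ} (hl : Feasible l) : Feasible fun x => (l x).headD 0 :=
  (of_hd (f := fun l => l.headD 0) fun l : List ℕ => by cases l <;> rfl).comp hl

theorem pred {n : δ → ℕ} (hn : Feasible n) : Feasible fun x => n x - 1 :=
  (of_tl (f := fun n => n - 1) fun n : ℕ => by cases n <;> rfl).comp hn

theorem enc_replicate_unit (n : ℕ) : enc (List.replicate n ()) = enc n := by
  induction n with
  | zero => rfl
  | succ n ih => rw [List.replicate_succ, enc_cons, ih, enc_nat_succ]; rfl

theorem foldl {l : δ → List α} {i : δ → β} {s : δ → β → α → β} (hl : Feasible l)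
    (hi : Feasible i) (hs : Feasible fun y : β × α × δ => s y.2.2 y.1 y.2.1) (B : Polynomial ℕ)
    (hB : ∀ x, ∀ l' : List α, l' <+: l x → esize (l'.foldl (s x) (i x)) ≤ B.eval (esize x)) :
    Feasible fun x => (l x).foldl (s x) (i x) :=
  ⟨hl.1.foldl hi.1 hs.1, hl.2.foldl hi.2 hs.2 B hB⟩

/-- For list accumulators it suffices to bound their lengths and the sizes of their entries
separately. -/
theorem foldl_list {l : δ → List α} {i : δ → List β} {s : δ → List β → α → List β}
    (hl : Feasible l) (hi : Feasible i)
    (hs : Feasible fun y : List β × α × δ => s y.2.2 y.1 y.2.1) (N S : Polynomial ℕ)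
    (hN : ∀ x, ∀ l' : List α, l' <+: l x → (l'.foldl (s x) (i x)).length ≤ N.eval (esize x))
    (hS : ∀ x, ∀ l' : List α, l' <+: l x → ∀ b ∈ l'.foldl (s x) (i x),
      esize b ≤ S.eval (esize x)) :
    Feasible fun x => (l x).foldl (s x) (i x) := by
  refine hl.foldl hi hs (N * (S + 1) + 1) fun x l' hl' => ?_
  simpa using esize_list_le (hN x l' hl') (hS x l' hl')

theorem esize_le {f : α → β} (hf : Feasible f) :
    ∃ P : Polynomial ℕ, ∀ x, esize (f x) ≤ P.eval (esize x) :=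
  hf.2.imp fun _ h => h.1

theorem all {l : δ → List α} {p : δ → α → Bool} (hl : Feasible l)
    (hp : Feasible fun y : α × δ => p y.2 y.1) : Feasible fun x => (l x).all fun a => p x a := by
  have h : Feasible fun x => (l x).foldl (fun b a => if b = true then p x a else false) true := by
    refine foldl hl (const true) (bite (fst id) (hp.comp (snd id)) (const false)) 3 fun x l' _ => ?_
    simpa using esize_bool_le _
  convert h using 2 with x
  generalize l x = l
  have key : ∀ b, (b && l.all fun a => p x a) =
      l.foldl (fun b a => if b = true then p x a else false) b := by
    induction l with
    | nil => simp
    | cons a l ih =>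
      intro b
      rw [List.foldl_cons, ← ih, List.all_cons]
      cases b <;> simp
  simpa using key true

theorem any {l : δ → List α} {p : δ → α → Bool} (hl : Feasible l)
    (hp : Feasible fun y : α × δ => p y.2 y.1) : Feasible fun x => (l x).any fun a => p x a := by
  convert (all (p := fun x a => !p x a) hl hp.not).not using 2 with x
  rw [List.not_all_eq_any_not]
  simp

/-- The list is part of the program, which is unrolled along it; this serves the loops over the `d`
coordinates, `d` being fixed. -/
theorem all_const {ι : Type} {p : δ → ι → Bool} (l : List ι) (hp : ∀ b ∈ l, Feasible fun x => p x b) :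
    Feasible fun x => l.all fun b => p x b := by
  induction l with
  | nil => exact const true
  | cons b l ih =>
    simp only [List.all_cons]
    exact (hp b List.mem_cons_self).and (ih fun b' h => hp b' (List.mem_cons_of_mem _ h))

theorem reverse {l : δ → List α} (hl : Feasible l) : Feasible fun x => (l x).reverse := by
  obtain ⟨L, hL⟩ := hl.esize_le
  have hf : ∀ l : List α, l.foldl (fun b a => a :: b) [] = l.reverse := fun l => by simp
  simp only [← hf]
  refine foldl_list hl (const []) (cons (fst (snd id)) (fst id)) L L (fun x l' hl' => ?_)
    fun x l' hl' b hb => ?_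
  · rw [hf, List.length_reverse]
    exact hl'.length_le.trans ((length_le_esize _).trans (hL x))
  · rw [hf, List.mem_reverse] at hb
    exact (esize_le_of_mem (hl'.subset hb)).trans (hL x)

/-- A fold produces the entries in reverse order, and `reverse` restores it; the same device is used
for `filter`. -/
theorem map {l : δ → List α} {f : δ → α → β} (hl : Feasible l)
    (hf : Feasible fun y : α × δ => f y.2 y.1) : Feasible fun x => (l x).map fun a => f x a := by
  obtain ⟨L, hL⟩ := hl.esize_le
  obtain ⟨F, hF⟩ := hf.esize_le
  have hr : ∀ x, ∀ l : List α, l.foldl (fun b a => f x a :: b) [] = (l.map fun a => f x a).reverse :=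
    fun x l => by
      rw [← List.foldl_map (f := fun a => f x a) (g := fun b a => a :: b)]
      simp
  have h : Feasible fun x => (l x).foldl (fun b a => f x a :: b) [] := by
    refine foldl_list hl (const []) (cons (hf.comp (snd id)) (fst id)) L
      (F.comp (L + Polynomial.X + 1)) (fun x l' hl' => ?_) fun x l' hl' b hb => ?_
    · rw [hr, List.length_reverse, List.length_map]
      exact hl'.length_le.trans ((length_le_esize _).trans (hL x))
    · rw [hr, List.mem_reverse, List.mem_map] at hb
      obtain ⟨a, ha, rfl⟩ := hb
      have h1 := (esize_le_of_mem (hl'.subset ha)).trans (hL x)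
      refine (hF (a, x)).trans ?_
      rw [Polynomial.eval_comp]
      refine eval_mono F ?_
      simp only [Polynomial.eval_add, Polynomial.eval_X, Polynomial.eval_one, esize_prod]
      omega
  convert h.reverse using 2 with x
  rw [hr, List.reverse_reverse]

theorem filter {l : δ → List α} {p : δ → α → Bool} (hl : Feasible l)
    (hp : Feasible fun y : α × δ => p y.2 y.1) :
    Feasible fun x => (l x).filter fun a => p x a := by
  obtain ⟨L, hL⟩ := hl.esize_le
  have hr : ∀ x, ∀ l : List α, l.foldl (fun b a => if p x a = true then a :: b else b) [] =
      (l.filter fun a => p x a).reverse := fun x l => by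
    rw [← List.foldl_filter (p := fun a => p x a) (f := fun b a => a :: b)]
    simp
  have h : Feasible fun x => (l x).foldl (fun b a => if p x a = true then a :: b else b) [] := by
    refine foldl_list hl (const []) (bite (hp.comp (snd id)) (cons (fst (snd id)) (fst id)) (fst id))
      L L (fun x l' hl' => ?_) fun x l' hl' b hb => ?_
    · rw [hr, List.length_reverse]
      exact (List.length_filter_le _ _).trans
        (hl'.length_le.trans ((length_le_esize _).trans (hL x)))
    · rw [hr, List.mem_reverse, List.mem_filter] at hb
      exact (esize_le_of_mem (hl'.subset hb.1)).trans (hL x)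
  convert h.reverse using 2 with x
  rw [hr, List.reverse_reverse]

theorem length {l : δ → List α} (hl : Feasible l) : Feasible fun x => (l x).length := by
  have h : Feasible fun x => ((l x).map fun _ => ()).length := by
    refine (of_enc_eq (f := fun l : List Unit => l.length) fun l => ?_).comp (hl.map (const ()))
    have hl : l = List.replicate l.length () := List.eq_replicate_length.2 fun _ _ => rfl
    rw [← enc_replicate_unit, ← hl]
  simpa using h

theorem sub {m n : δ → ℕ} (hm : Feasible m) (hn : Feasible n) : Feasible fun x => m x - n x := by
  obtain ⟨M, hM⟩ := hm.esize_le
  have hr : ∀ (k : ℕ) (l : List Unit), l.foldl (fun b _ => b - 1) k = k - l.length := fun k l => by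
    induction l generalizing k with
    | nil => rfl
    | cons a l ih => rw [List.foldl_cons, ih, List.length_cons]; omega
  have h : Feasible fun x => (List.replicate (n x) ()).foldl (fun b _ => b - 1) (m x) := by
    refine foldl ((of_enc_eq fun k => (enc_replicate_unit k).symm).comp hn) hm (pred (fst id)) M
      fun x l' _ => ?_
    refine le_trans ?_ (hM x)
    rw [hr, esize_nat, esize_nat]
    omega
  convert h using 2 with x
  rw [hr, List.length_replicate]

theorem lt {m n : δ → ℕ} (hm : Feasible m) (hn : Feasible n) :
    Feasible fun x => decide (m x < n x) := by
  convert ((hn.sub hm).eq (const 0)).not using 2 with x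
  rw [← decide_not, decide_eq_decide]
  omega

theorem mem [DecidableEq α] {f : δ → α} {l : δ → List α} [∀ x, Decidable (f x ∈ l x)]
    (hf : Feasible f) (hl : Feasible l) :
    Feasible fun x => decide (f x ∈ l x) := by
  convert hl.any (p := fun x a => decide (a = f x)) ((fst id).eq (hf.comp (snd id))) using 2 with x
  rw [Bool.eq_iff_iff]
  simp

/-- The index is a constant of the program, so the recursion on it is unrolled. -/
theorem set {v : δ → List ℕ} {s : δ → ℕ} (i : ℕ) (hv : Feasible v) (hs : Feasible s) :
    Feasible fun x => (v x).set i (s x) := by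
  induction i generalizing v with
  | zero =>
    convert (hv.eq (const [])).bite (const []) (hs.cons hv.tail) using 2 with x
    cases v x <;> simp
  | succ i ih =>
    convert (hv.eq (const [])).bite (const []) (hv.headD.cons (ih hv.tail)) using 2 with x
    cases v x <;> simp

theorem replicate {s : δ → α} (n : ℕ) (hs : Feasible s) :
    Feasible fun x => List.replicate n (s x) := by
  induction n with
  | zero => exact const []
  | succ n ih => exact hs.cons ih

end Feasible

end WhileProg

/-! ### The test is feasible -/

namespace Tr

open WhileProg WhileProg.Enc WhileProg.Feasible

variable {d : ℕ} {δ : Type} [Enc δ]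

theorem feasible_sources {E : δ → List Tr} (hE : Feasible E) : Feasible fun x => sources (E x) :=
  hE.map (f := fun _ (e : Tr) => e.1) (fst (fst .id))

theorem feasible_cnt {E : δ → List Tr} {p : δ → ℕ} {w : δ → List ℕ} (hE : Feasible E)
    (hp : Feasible p) (hw : Feasible w) : Feasible fun x => cnt (E x) (p x) (w x) :=
  length <| hE.filter (p := fun x e => decide (e.1 = p x) && decide (e.2.2 = w x)) <|
    and (eq (fst (fst .id)) (hp.comp (snd .id))) (eq (snd (snd (fst .id))) (hw.comp (snd .id)))

theorem feasible_colSub {E : δ → List Tr} {q q' : δ → ℕ} (hE : Feasible E)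
    (hq : Feasible q) (hq' : Feasible q') : Feasible fun x => colSub d (E x) (q x) (q' x) := by
  refine hE.all (p := fun x e => (List.range d).all fun i =>
    !decide (e.2.2.set i (q x) = e.2.2) ||
      decide (cnt (E x) e.1 e.2.2 = cnt (E x) e.1 (e.2.2.set i (q' x)))) (all_const _ fun i _ => ?_)
  have hv : Feasible fun y : Tr × δ => y.1.2.2 := snd (snd (fst .id))
  have hp : Feasible fun y : Tr × δ => y.1.1 := fst (fst .id)
  exact or (not (eq (set i hv (hq.comp (snd .id))) hv)) (eq
    (feasible_cnt (hE.comp (snd .id)) hp hv)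
    (feasible_cnt (hE.comp (snd .id)) hp (set i hv (hq'.comp (snd .id)))))

theorem feasible_mergeable {E : δ → List Tr} {q q' : δ → ℕ} (hE : Feasible E)
    (hq : Feasible q) (hq' : Feasible q') : Feasible fun x => mergeable d (E x) (q x) (q' x) :=
  and (not (eq hq hq')) (and (feasible_colSub hE hq hq') (feasible_colSub hE hq' hq))

theorem feasible_merge {E : δ → List Tr} {q q' : δ → ℕ} (hE : Feasible E)
    (hq : Feasible q) (hq' : Feasible q') : Feasible fun x => merge (E x) (q x) (q' x) := by
  refine map (f := fun x e => (if e.1 = q' x then q x else e.1, e.2))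
    (hE.filter (p := fun x e => !decide (q' x ∈ e.2.2)) ?_) ?_
  · exact not (mem (hq'.comp (snd .id)) (snd (snd (fst .id))))
  · exact pair (ite (eq (fst (fst .id)) (hq'.comp (snd .id))) (hq.comp (snd .id)) (fst (fst .id)))
      (snd (fst .id))

theorem feasible_candidates {E : δ → List Tr} (hE : Feasible E) :
    Feasible fun x => candidates d (E x) := by
  refine (feasible_sources hE).filter
    (p := fun x q => (sources (E x)).any fun q' => mergeable d (E x) q q') ?_
  refine any (p := fun y q' => mergeable d (E y.2) y.1 q')
    ((feasible_sources hE).comp (snd .id)) ?_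
  exact feasible_mergeable (hE.comp (snd (snd .id))) (fst (snd .id)) (fst .id)

theorem feasible_mergeStep {E : δ → List Tr} (hE : Feasible E) :
    Feasible fun x => mergeStep d (E x) := by
  have hq : Feasible fun x => (candidates d (E x)).headD 0 := headD (feasible_candidates hE)
  refine ite (eq (feasible_candidates hE) (const [])) hE (feasible_merge hE hq (headD ?_))
  exact (feasible_sources hE).filter
    (p := fun x q' => mergeable d (E x) ((candidates d (E x)).headD 0) q')
    (feasible_mergeable (hE.comp (snd .id)) (hq.comp (snd .id)) (fst .id))

/-- Merging invents nothing: labels, targets and sources all come from the given list. This bounds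
the accumulators when the step is iterated. -/
theorem mergeStep_subset (E : List Tr) : (mergeStep d E).length ≤ E.length ∧
    ∀ e ∈ mergeStep d E, ∃ s ∈ sources E, ∃ e' ∈ E, e = (s, e'.2) := by
  have hself : ∀ e ∈ E, ∃ s ∈ sources E, ∃ e' ∈ E, e = (s, e'.2) := fun e he =>
    ⟨e.1, mem_sources.2 ⟨e, he, rfl⟩, e, he, rfl⟩
  rw [mergeStep]
  split_ifs with hc
  · exact ⟨le_rfl, hself⟩
  · constructor
    · rw [merge, List.length_map]
      exact List.length_filter_le _ _
    · intro e he
      obtain ⟨e', he', -, rfl⟩ := mem_merge.1 he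
      split_ifs with h1
      · refine ⟨_, ?_, e', he', rfl⟩
        have h2 : ∀ l : List ℕ, l ≠ [] → l.headD 0 ∈ l := by
          rintro (_ | ⟨a, l⟩) hl
          · exact absurd rfl hl
          · simp
        exact (List.mem_filter.1 (h2 _ hc)).1
      · exact hself e' he'

theorem feasible_amalgamate : Feasible fun E : List Tr => amalgamate d E := by
  have hsub : ∀ E E' : List Tr, E' <+: E →
      (E'.foldl (fun acc _ => mergeStep d acc) E).length ≤ E.length ∧
      ∀ e ∈ E'.foldl (fun acc _ => mergeStep d acc) E, ∃ s ∈ sources E, ∃ e' ∈ E,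
        e = (s, e'.2) := by
    intro E E' _
    rw [List.foldl_const]
    generalize E'.length = n
    induction n with
    | zero => exact ⟨le_rfl, fun e he => ⟨e.1, mem_sources.2 ⟨e, he, rfl⟩, e, he, rfl⟩⟩
    | succ n ih =>
      rw [Function.iterate_succ_apply']
      obtain ⟨h1, h2⟩ := mergeStep_subset (d := d) ((mergeStep d)^[n] E)
      refine ⟨h1.trans ih.1, fun e he => ?_⟩
      obtain ⟨s, hs, e', he', rfl⟩ := h2 e he
      obtain ⟨e₁, he₁, rfl⟩ := mem_sources.1 hs
      obtain ⟨s', hs', -, -, rfl⟩ := ih.2 e₁ he₁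
      obtain ⟨-, -, e₂, he₂, rfl⟩ := ih.2 e' he'
      exact ⟨s', hs', e₂, he₂, rfl⟩
  -- An intermediate transition joins the source of one original transition to the label and target
  -- of another, whence the bound `2 * X + 1`.
  refine foldl_list (s := fun _ acc _ => mergeStep d acc) .id .id (feasible_mergeStep (fst .id))
    Polynomial.X (2 * Polynomial.X + 1) (fun E E' h => ?_) fun E E' h e he => ?_
  · simpa using (hsub E E' h).1.trans (length_le_esize E)
  · obtain ⟨s, hs, e', he', rfl⟩ := (hsub E E' h).2 e he
    obtain ⟨e₁, he₁, rfl⟩ := mem_sources.1 hs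
    have h1 := esize_le_of_mem he₁
    have h2 := esize_le_of_mem he'
    rw [esize_prod] at h1 h2
    simp only [esize_prod (e₁.1, e'.2), Polynomial.eval_add, Polynomial.eval_mul,
      Polynomial.eval_ofNat, Polynomial.eval_X, Polynomial.eval_one]
    omega

theorem feasible_trimStep {E : δ → List Tr} (hE : Feasible E) : Feasible fun x => trimStep (E x) := by
  refine hE.filter (p := fun x (e : Tr) => e.2.2.all fun s => decide (s ∈ sources (E x))) ?_
  refine all (p := fun (y : Tr × δ) s => decide (s ∈ sources (E y.2))) (snd (snd (fst .id))) ?_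
  exact mem (fst .id) ((feasible_sources hE).comp (snd (snd .id)))

theorem feasible_trim : Feasible fun E : List Tr => trim E := by
  have hsub : ∀ E E' : List Tr, (E'.foldl (fun acc _ => trimStep acc) E).Sublist E := by
    intro E E'
    rw [List.foldl_const]
    generalize E'.length = n
    induction n with
    | zero => exact List.Sublist.refl _
    | succ n ih =>
      rw [Function.iterate_succ_apply']
      exact List.filter_sublist.trans ih
  refine foldl_list (s := fun _ acc _ => trimStep acc) .id .id (feasible_trimStep (fst .id))
    Polynomial.X Polynomial.X (fun E E' _ => ?_) fun E E' _ e he => ?_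
  · simpa using (hsub E E').length_le.trans (length_le_esize E)
  · simpa using esize_le_of_mem ((hsub E E').subset he)

theorem feasible_regCheck {E : δ → List Tr} (hE : Feasible E) :
    Feasible fun x => regCheck d (E x) := by
  refine hE.all (p := fun x e =>
    (e.2.2.all fun s => !decide (cnt (E x) s (List.replicate d e.1) = 0)) &&
    (E x).all fun e' => !decide (e.1 = e'.1) ||
      (decide (cnt (E x) e.1 e.2.2 = cnt (E x) e.1 e'.2.2) &&
        (List.range d).all fun i => e'.2.2.all fun s =>
          !decide (cnt (E x) e.1 (e.2.2.set i s) = 0))) (and ?_ ?_)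
  · refine all (p := fun (y : Tr × δ) s => !decide (cnt (E y.2) s (List.replicate d y.1.1) = 0))
      (snd (snd (fst .id))) (not (eq ?_ (const 0)))
    exact feasible_cnt (hE.comp (snd (snd .id))) (fst .id) (replicate d (fst (fst (snd .id))))
  · refine all (p := fun (y : Tr × δ) e' => !decide (y.1.1 = e'.1) ||
      (decide (cnt (E y.2) y.1.1 y.1.2.2 = cnt (E y.2) y.1.1 e'.2.2) &&
        (List.range d).all fun i => e'.2.2.all fun s =>
          !decide (cnt (E y.2) y.1.1 (y.1.2.2.set i s) = 0))) (hE.comp (snd .id)) ?_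
    have hp : Feasible fun z : Tr × Tr × δ => z.2.1.1 := fst (fst (snd .id))
    have hv : Feasible fun z : Tr × Tr × δ => z.2.1.2.2 := snd (snd (fst (snd .id)))
    have hw : Feasible fun z : Tr × Tr × δ => z.1.2.2 := snd (snd (fst .id))
    have hE' : Feasible fun z : Tr × Tr × δ => E z.2.2 := hE.comp (snd (snd .id))
    refine or (not (eq hp (fst (fst .id)))) (and (eq (feasible_cnt hE' hp hv)
      (feasible_cnt hE' hp hw)) (all_const _ fun i _ => ?_))
    refine all (p := fun (z : Tr × Tr × δ) s =>
      !decide (cnt (E z.2.2) z.2.1.1 (z.2.1.2.2.set i s) = 0)) hw (not (eq ?_ (const 0)))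
    exact feasible_cnt (hE'.comp (snd .id)) (hp.comp (snd .id)) (set i (hv.comp (snd .id)) (fst .id))

theorem feasible_removeDups : Feasible fun E : List Tr => removeDups E := by
  have hsub : ∀ E' acc : List Tr,
      (E'.foldl (fun acc e => if e ∈ acc then acc else e :: acc) acc).length ≤
        E'.length + acc.length ∧
      ∀ e ∈ E'.foldl (fun acc e => if e ∈ acc then acc else e :: acc) acc, e ∈ E' ∨ e ∈ acc := by
    intro E'
    induction E' with
    | nil => simp
    | cons a E' ih =>
      intro acc
      rw [List.foldl_cons]
      obtain ⟨h1, h2⟩ := ih (if a ∈ acc then acc else a :: acc)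
      refine ⟨h1.trans ?_, fun e he => ?_⟩
      · split_ifs <;> simp only [List.length_cons] <;> omega
      · have h3 := h2 e he
        split_ifs at h3 with h4 <;> simp only [List.mem_cons] at h3 ⊢ <;> tauto
  refine foldl_list (s := fun _ acc e => if e ∈ acc then acc else e :: acc) .id (const [])
    (ite (mem (fst (snd .id)) (fst .id)) (fst .id) (cons (fst (snd .id)) (fst .id)))
    Polynomial.X Polynomial.X (fun E E' h => ?_) fun E E' h e he => ?_
  · simpa using (hsub E' []).1.trans (h.length_le.trans (length_le_esize E))
  · have h1 := (hsub E' []).2 e he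
    simp only [List.not_mem_nil, or_false] at h1
    simpa using esize_le_of_mem (h.subset h1)

theorem feasible_transitions : Feasible fun c : ℕ × ℕ × List Tr => transitions d c := by
  refine feasible_removeDups.comp (filter (p := fun c e => valid d c.1 c.2.1 e) (snd (snd .id)) ?_)
  refine and (and (lt (fst (fst .id)) (fst (snd .id)))
    (lt (fst (snd (fst .id))) (fst (snd (snd .id))))) (and (eq (length (snd (snd (fst .id))))
    (const d)) ?_)
  exact all (p := fun (y : Tr × ℕ × ℕ × List Tr) s => decide (s < y.2.1)) (snd (snd (fst .id)))
    (lt (fst .id) (fst (snd (snd .id))))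

theorem feasible_edgeCheck : Feasible fun E : List Tr => edgeCheck E := by
  refine all (p := fun (E : List Tr) e => E.all fun e' => !decide (e.2.1 = e'.2.1) || decide (e = e')) .id ?_
  refine all (p := fun (y : Tr × List Tr) e' => !decide (y.1.2.1 = e'.2.1) || decide (y.1 = e'))
    (snd .id) ?_
  exact or (not (eq (fst (snd (fst (snd .id)))) (fst (snd (fst .id)))))
    (eq (fst (snd .id)) (fst .id))

theorem feasible_homCheck : Feasible fun c : ℕ × ℕ × List Tr => homCheck d c :=
  and (feasible_edgeCheck.comp feasible_transitions)
    ((feasible_regCheck .id).comp (feasible_amalgamate.comp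
      (feasible_trim.comp feasible_transitions)))

/-! ### Decidability and the polynomial program for edge automata -/

theorem primrec_homCheck : Primrec fun c : ℕ × ℕ × List Tr => homCheck d c := by
  have h := primrec_enc_list (primrec_enc_prod primrec_enc_nat
    (primrec_enc_prod primrec_enc_nat (primrec_enc_list primrec_enc_nat)))
  exact feasible_homCheck.1.primrec (primrec_enc_prod primrec_enc_nat
    (primrec_enc_prod primrec_enc_nat h))

theorem computablePred_homCheck (hd : 1 ≤ d) :
    ComputablePred (fun c : ℕ × ℕ × List Tr => (TreeShift.automatonOfCode d c).IsEdge ∧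
      TreeShift.IsConjugateToHom (TreeShift.automatonOfCode d c).shift) := by
  have h : (fun c : ℕ × ℕ × List Tr => (TreeShift.automatonOfCode d c).IsEdge ∧
      TreeShift.IsConjugateToHom (TreeShift.automatonOfCode d c).shift) =
      fun c => homCheck d c = true := funext fun c => propext (homCheck_iff hd c).symm
  rw [h]
  exact ⟨fun c => inferInstance, (primrec_homCheck (d := d)).to_comp.of_eq fun c => by simp⟩

/-- The codes of automata have polynomial size. -/
theorem esize_codeOfList_le {n k : ℕ} (L : List (Fin n × Fin k × (Fin d → Fin n))) :
    esize (TreeShift.codeOfList L) ≤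
      (2 * Polynomial.X + 1 + ((2 * Polynomial.X + 1) + (Polynomial.X * ((2 * Polynomial.X + 1) +
        ((2 * Polynomial.X + 1) + (Polynomial.C d * (2 * Polynomial.X + 1 + 1) + 1) + 1) + 1 + 1)
          + 1) + 1) + 1 : Polynomial ℕ).eval (n + k + L.length) := by
  have hn : ∀ s ≤ n + k + L.length, esize s ≤ 2 * (n + k + L.length) + 1 := fun s hs => by
    rw [esize_nat]; omega
  simp only [Polynomial.eval_add, Polynomial.eval_mul, Polynomial.eval_ofNat, Polynomial.eval_X,
    Polynomial.eval_one, Polynomial.eval_C, TreeShift.codeOfList, esize_prod]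
  gcongr
  · exact hn _ (by omega)
  · exact hn _ (by omega)
  · refine esize_list_le (by simp) fun e he => ?_
    obtain ⟨e, -, rfl⟩ := List.mem_map.1 he
    simp only [TreeShift.transCode, esize_prod]
    have h1 := e.1.2
    have h2 := e.2.1.2
    gcongr
    · exact hn _ (by omega)
    · exact hn _ (by omega)
    · refine esize_list_le (by simp) fun s hs => ?_
      obtain ⟨i, rfl⟩ := List.mem_ofFn.1 hs
      have h3 := (e.2.2 i).2
      exact hn _ (by omega)

theorem exists_program (hd : 1 ≤ d) : ∃ (prog : Cmd) (P : Polynomial ℕ),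
    ∀ (n k : ℕ) (L : List (Fin n × Fin k × (Fin d → Fin n))),
      (TreeShift.automatonOfCode d (TreeShift.codeOfList L)).IsEdge →
      DecidesWithin prog (encodeAutomaton (TreeShift.codeOfList L)) (P.eval (n + k + L.length))
        (TreeShift.IsConjugateToHom
          (TreeShift.automatonOfCode d (TreeShift.codeOfList L)).shift) := by
  obtain ⟨P, -, hP⟩ := (feasible_homCheck (d := d)).2
  obtain ⟨c, hc⟩ := hP 0
  generalize hS : (2 * Polynomial.X + 1 + ((2 * Polynomial.X + 1) + (Polynomial.X *
    ((2 * Polynomial.X + 1) + ((2 * Polynomial.X + 1) + (Polynomial.C d * (2 * Polynomial.X + 1 + 1)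
      + 1) + 1) + 1 + 1) + 1) + 1) + 1 : Polynomial ℕ) = S
  -- `S` bounds the input and `P.comp S` the run on it.
  refine ⟨c, S + P.comp S, fun n k L hL => ?_⟩
  have h1 := esize_codeOfList_le L
  rw [hS] at h1
  have h2 := eval_mono P h1
  simp only [Polynomial.eval_add, Polynomial.eval_comp]
  refine ⟨h1.trans (Nat.le_add_right _ _), ?_⟩
  -- The machine input is definitionally the representation `enc` of the code, so the program for
  -- `homCheck` applies as it is.
  obtain ⟨t, ht, σ, he, hσ, -⟩ := hc (TreeShift.codeOfList L)
    (Function.update (fun _ => Data.nil) 0 (encodeAutomaton (TreeShift.codeOfList L))) _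
    (Function.update_self _ _ _) (h2.trans (Nat.le_add_left _ _))
  refine ⟨t, ht.trans (h2.trans (Nat.le_add_left _ _)), σ, he, ?_⟩
  rw [hσ, enc_bool_ne_nil, homCheck_iff hd]
  exact and_iff_right hL

end Tr

namespace TreeShift

variable {d : ℕ}

/-! ### Blocks as lists -/

/-- The words of length less than `h` in preorder. -/
def words (d : ℕ) : ℕ → List (List (Fin d))
  | 0 => []
  | h + 1 => [] :: (List.finRange d).flatMap fun i => (words d h).map fun w => i :: w

theorem mem_words {h : ℕ} {w : List (Fin d)} : w ∈ words d h ↔ w.length < h := by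
  induction h generalizing w with
  | zero => simp [words]
  | succ h ih =>
    cases w with
    | nil => simp [words]
    | cons i w => simp [words, ih]

theorem nodup_words (h : ℕ) : (words d h).Nodup := by
  induction h with
  | zero => simp [words]
  | succ h ih =>
    rw [words, List.nodup_cons, List.nodup_flatMap]
    refine ⟨by simp, fun i _ => ih.map fun _ _ h => by simpa using h, ?_⟩
    refine (List.nodup_finRange d).imp fun {i j} hij => ?_
    rw [Function.onFun, List.disjoint_left]
    simp only [List.mem_map, not_exists, not_and]
    rintro _ ⟨w, -, rfl⟩ w' - h
    exact hij (by simp_all)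

theorem filter_words {j h : ℕ} (hj : j ≤ h) :
    (words d h).filter (fun w => decide (w.length < j)) = words d j := by
  induction j generalizing h with
  | zero => simp [words]
  | succ j ih =>
    obtain ⟨h, rfl⟩ : ∃ k, h = k + 1 := ⟨h - 1, by omega⟩
    rw [words, words, List.filter_cons_of_pos (by simp), List.filter_flatMap]
    congr 1
    refine List.flatMap_congr fun i _ => ?_
    rw [List.filter_map, ← ih (h := h) (by omega)]
    congr 1
    refine List.filter_congr fun w _ => ?_
    simp

/-- The list of the labels `f w` with their nodes, in preorder. -/
def blockList (h : ℕ) (f : List (Fin d) → ℕ) : List (List (Fin d) × ℕ) :=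
  (words d h).map fun w => (w, f w)

theorem blockList_eq_iff {h : ℕ} {f g : List (Fin d) → ℕ} :
    blockList h f = blockList h g ↔ ∀ w, w.length < h → f w = g w := by
  simp [blockList, List.map_inj_left, mem_words]

/-- The restriction of a block to the height `j`. -/
def restrict (j : ℕ) (b : List (List (Fin d) × ℕ)) : List (List (Fin d) × ℕ) :=
  b.filter fun p => decide (p.1.length < j)

theorem restrict_blockList {j h : ℕ} (hj : j ≤ h) (f : List (Fin d) → ℕ) :
    restrict j (blockList h f) = blockList j f := by
  rw [restrict, blockList, List.filter_map, blockList, ← filter_words hj]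
  rfl

/-- The subblock at the child `i` of the root. -/
def childList (i : Fin d) (b : List (List (Fin d) × ℕ)) : List (List (Fin d) × ℕ) :=
  (b.filter fun p => decide (p.1.head? = some i)).map fun p => (p.1.tail, p.2)

theorem flatMap_ite_eq {α : Type} {l : List (Fin d)} (hl : l.Nodup) {i : Fin d} (hi : i ∈ l)
    (g : Fin d → List α) : (l.flatMap fun j => if j = i then g j else []) = g i := by
  induction l with
  | nil => simp at hi
  | cons a l ih =>
    rw [List.nodup_cons] at hl
    rw [List.flatMap_cons]
    by_cases h : a = i
    · subst h
      have : (l.flatMap fun j => if j = a then g j else []) = [] := by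
        rw [List.flatMap_eq_nil_iff]
        intro j hj
        rw [if_neg]
        rintro rfl
        exact hl.1 hj
      simp [this]
    · rw [if_neg h, List.nil_append, ih hl.2]
      exact (List.mem_cons.1 hi).resolve_left (Ne.symm h)

theorem childList_blockList (i : Fin d) (h : ℕ) (f : List (Fin d) → ℕ) :
    childList i (blockList (h + 1) f) = blockList h fun w => f (i :: w) := by
  have h1 : (words d (h + 1)).filter (fun w => decide (w.head? = some i)) =
      (words d h).map fun w => i :: w := by
    rw [words, List.filter_cons_of_neg (by simp), List.filter_flatMap,
      ← flatMap_ite_eq (List.nodup_finRange d) (List.mem_finRange i)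
        (fun i => (words d h).map fun w => i :: w)]
    refine List.flatMap_congr fun j _ => ?_
    rw [List.filter_map]
    by_cases hj : j = i
    · simp [hj, Function.comp_def]
    · simp [hj, Function.comp_def]
  rw [childList, blockList, List.filter_map, List.map_map]
  change List.map _ (List.filter (fun w => decide (w.head? = some i)) (words d (h + 1))) = _
  rw [h1, List.map_map]
  rfl

theorem preorder_eq {k : ℕ} (h : ℕ) (b : Block d (Fin k) h) (f : List (Fin d) → ℕ)
    (hf : ∀ w, (b w).1 = f w.1) :
    (Block.preorder h b).map Fin.val = (blockList h f).map Prod.snd := by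
  induction h generalizing f with
  | zero => rfl
  | succ h ih =>
    rw [Block.preorder, blockList, words, List.map_cons, hf, List.map_cons, List.map_cons,
      List.map_flatMap, List.map_flatMap, List.map_flatMap]
    congr 1
    refine List.flatMap_congr fun i _ => ?_
    rw [ih (Block.child b i) (fun w => f (i :: w)) fun w => hf _, blockList]
    simp [Function.comp_def]

/-- All labellings of the words in a list by numbers less than `k`. -/
def labellings (k : ℕ) (ws : List (List (Fin d))) : List (List (List (Fin d) × ℕ)) :=
  ws.foldr (fun w acc => (List.range k).flatMap fun a => acc.map fun b => (w, a) :: b) [[]]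

theorem mem_labellings {k : ℕ} {ws : List (List (Fin d))} (hws : ws.Nodup)
    {b : List (List (Fin d) × ℕ)} :
    b ∈ labellings k ws ↔ ∃ f : List (Fin d) → ℕ, (∀ w ∈ ws, f w < k) ∧
      b = ws.map fun w => (w, f w) := by
  induction ws generalizing b with
  | nil => simp [labellings]
  | cons w ws ih =>
    rw [List.nodup_cons] at hws
    rw [labellings, List.foldr_cons, ← labellings]
    simp only [List.mem_flatMap, List.mem_range, List.mem_map, ih hws.2]
    constructor
    · rintro ⟨a, ha, _, ⟨f, hf, rfl⟩, rfl⟩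
      refine ⟨Function.update f w a, ?_, ?_⟩
      · intro w' hw'
        by_cases h : w' = w
        · simpa [h] using ha
        · simpa [h] using hf w' ((List.mem_cons.1 hw').resolve_left h)
      · rw [List.map_cons, Function.update_self]
        congr 1
        refine List.map_congr_left fun w' hw' => ?_
        rw [Function.update_of_ne]
        rintro rfl
        exact hws.1 hw'
    · rintro ⟨f, hf, rfl⟩
      exact ⟨f w, hf w List.mem_cons_self, _,
        ⟨f, fun w' hw' => hf w' (List.mem_cons_of_mem _ hw'), rfl⟩, rfl⟩

/-! ### The automaton of a tree-shift of finite type -/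

/-- A bound on the heights of the forbidden blocks. -/
def heightBound (F : List (ℕ × List ℕ)) : ℕ := (F.map Prod.fst).sum

/-- Only occurrences at the root are excluded: an occurrence at a deeper node of a tree is seen by
the transition used at that node. -/
def allowed (F : List (ℕ × List ℕ)) (b : List (List (Fin d) × ℕ)) : Bool :=
  F.all fun e => !decide ((restrict e.1 b).map Prod.snd = e.2)

/-- The transition whose label is the block `b` of height `h + 1`: it goes from the restriction of
`b` to the height `h` to its subblocks. -/
def blockTransition (h : ℕ) (b : List (List (Fin d) × ℕ)) : Tr :=
  (Encodable.encode (restrict h b), Encodable.encode b,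
    (List.finRange d).map fun i => Encodable.encode (childList i b))

def sftTransitions (d : ℕ) (c : ℕ × List (ℕ × List ℕ)) : List Tr :=
  ((labellings c.1 (words d (heightBound c.2 + 1))).filter fun b => allowed c.2 b).map fun b =>
    blockTransition (heightBound c.2) b

/-- A strict bound on the numbers that occur in a list of transitions. -/
def trBound (E : List Tr) : ℕ := (E.map fun e => e.1 + (e.2.1 + e.2.2.sum)).sum + 1

def sftAutomaton (d : ℕ) (c : ℕ × List (ℕ × List ℕ)) : ℕ × ℕ × List Tr :=
  (trBound (sftTransitions d c), trBound (sftTransitions d c), sftTransitions d c)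

theorem blockTransition_blockList (h : ℕ) (f : List (Fin d) → ℕ) :
    blockTransition h (blockList (h + 1) f) = (Encodable.encode (blockList h f),
      Encodable.encode (blockList (h + 1) f),
      List.ofFn fun i => Encodable.encode (blockList h fun w => f (i :: w))) := by
  rw [blockTransition, restrict_blockList (Nat.le_succ h)]
  simp only [childList_blockList, List.ofFn_eq_map]

theorem le_heightBound {F : List (ℕ × List ℕ)} {e : ℕ × List ℕ} (he : e ∈ F) :
    e.1 ≤ heightBound F :=
  List.single_le_sum (fun _ _ => Nat.zero_le _) _ (List.mem_map_of_mem he)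

theorem mem_sftTransitions {c : ℕ × List (ℕ × List ℕ)} {e : Tr} :
    e ∈ sftTransitions d c ↔ ∃ f : List (Fin d) → ℕ,
      (∀ w, w.length < heightBound c.2 + 1 → f w < c.1) ∧
      (∀ e ∈ c.2, (blockList e.1 f).map Prod.snd ≠ e.2) ∧
      e = blockTransition (heightBound c.2) (blockList (heightBound c.2 + 1) f) := by
  have h1 : ∀ f : List (Fin d) → ℕ, allowed c.2 (blockList (heightBound c.2 + 1) f) = true ↔
      ∀ e ∈ c.2, (blockList e.1 f).map Prod.snd ≠ e.2 := by
    intro f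
    simp only [allowed, List.all_eq_true, Bool.not_eq_true', decide_eq_false_iff_not]
    refine forall₂_congr fun e he => ?_
    rw [restrict_blockList ((le_heightBound he).trans (Nat.le_succ _))]
  simp only [sftTransitions, List.mem_map, List.mem_filter, mem_labellings (nodup_words _),
    mem_words]
  constructor
  · rintro ⟨_, ⟨⟨f, hf, rfl⟩, h2⟩, rfl⟩
    exact ⟨f, hf, (h1 f).1 h2, rfl⟩
  · rintro ⟨f, hf, h2, rfl⟩
    exact ⟨_, ⟨⟨f, hf, rfl⟩, (h1 f).2 h2⟩, rfl⟩

theorem mem_transitions_sftAutomaton {c : ℕ × List (ℕ × List ℕ)} {e : Tr} :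
    e ∈ Tr.transitions d (sftAutomaton d c) ↔ e ∈ sftTransitions d c := by
  rw [Tr.mem_transitions]
  refine and_iff_left_of_imp fun he => ?_
  have h1 : e.1 + (e.2.1 + e.2.2.sum) < trBound (sftTransitions d c) :=
    Nat.lt_succ_of_le (List.single_le_sum (fun _ _ => Nat.zero_le _) _
      (List.mem_map_of_mem (f := fun e : Tr => e.1 + (e.2.1 + e.2.2.sum)) he))
  obtain ⟨f, -, -, rfl⟩ := mem_sftTransitions.1 he
  simp only [sftAutomaton]
  refine ⟨by omega, by omega, by simp [blockTransition], fun s hs => ?_⟩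
  have h2 := List.single_le_sum (fun _ _ => Nat.zero_le _) s hs
  omega

/-- The label encodes the whole block, from which source and target are computed. -/
theorem sftAutomaton_isEdge (c : ℕ × List (ℕ × List ℕ)) :
    (automatonOfCode d (sftAutomaton d c)).IsEdge := by
  rw [Tr.isEdge_iff_edgeCheck]
  simp only [Tr.edgeCheck, List.all_eq_true, Bool.or_eq_true, Bool.not_eq_true',
    decide_eq_false_iff_not, decide_eq_true_eq, mem_transitions_sftAutomaton]
  intro e he e' he'
  obtain ⟨f, -, -, rfl⟩ := mem_sftTransitions.1 he
  obtain ⟨f', -, -, rfl⟩ := mem_sftTransitions.1 he'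
  refine or_iff_not_imp_left.2 fun h => ?_
  rw [not_not] at h
  exact congrArg _ (Encodable.encode_injective h)

/-- The trees with numerical labels that avoid the blocks in a list. -/
def numShift (d : ℕ) (c : ℕ × List (ℕ × List ℕ)) : Set (LTree d ℕ) :=
  {t | ∀ x, t x < c.1 ∧ ∀ e ∈ c.2, (blockList e.1 fun w => t (x ++ w)).map Prod.snd ≠ e.2}

theorem sftOfCode_conjugate (c : ℕ × List (ℕ × List ℕ)) :
    Conjugate (sftOfCode d c) (numShift d c) := by
  convert Conjugate.of_image (Y := sftOfCode d c) Fin.val Fin.val_injective using 1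
  have key : ∀ t : LTree d (Fin c.1), t ∈ sftOfCode d c ↔
      ∀ x, ∀ e ∈ c.2, (blockList e.1 fun w => (t (x ++ w)).1).map Prod.snd ≠ e.2 := by
    intro t
    have h1 : ∀ h x, (Block.preorder h (blockAt t h x)).map Fin.val =
        (blockList h fun w => (t (x ++ w)).1).map Prod.snd := fun h x =>
      preorder_eq h _ _ fun w => rfl
    change (∀ h x, ¬ (h, (Block.preorder h (blockAt t h x)).map Fin.val) ∈ c.2) ↔ _
    simp only [h1]
    constructor
    · intro h x e he heq
      refine h e.1 x ?_
      rw [heq]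
      exact he
    · exact fun h j x he => h x _ he rfl
  ext t
  constructor
  · intro ht
    exact ⟨fun x => ⟨t x, (ht x).1⟩, (key _).2 fun x => (ht x).2, rfl⟩
  · rintro ⟨t, ht, rfl⟩
    exact fun x => ⟨(t x).2, (key t).1 ht x⟩

/-- The label of the root of an encoded block. -/
def rootLabel (d n : ℕ) : ℕ :=
  (((Encodable.decode n : Option (List (List (Fin d) × ℕ))).getD []).head?.map Prod.snd).getD 0

theorem rootLabel_encode (h : ℕ) (f : List (Fin d) → ℕ) :
    rootLabel d (Encodable.encode (blockList (h + 1) f)) = f [] := by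
  simp [rootLabel, blockList, words]

/-- The presentation by blocks: a tree is sent to the tree of its blocks of height `H + 1`, and the
inverse reads root labels. The states force neighbouring blocks to overlap consistently, so every
accepted tree of blocks comes from an ordinary tree. -/
theorem numShift_conjugate (c : ℕ × List (ℕ × List ℕ)) :
    Conjugate (numShift d c) (Tr.listShift d (Tr.transitions d (sftAutomaton d c))) := by
  set H := heightBound c.2 with hH
  have key : ∀ s ∈ Tr.listShift d (Tr.transitions d (sftAutomaton d c)),
      (∀ x, s x = Encodable.encode (blockList (H + 1) fun w => rootLabel d (s (x ++ w)))) ∧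
      (fun x => rootLabel d (s x)) ∈ numShift d c := by
    rintro s ⟨u, hu⟩
    simp only [mem_transitions_sftAutomaton, mem_sftTransitions, blockTransition_blockList,
      Prod.mk.injEq, ← hH] at hu
    choose f hf1 hf2 hf3 hf4 hf5 using hu
    have hroot : ∀ x, rootLabel d (s x) = f x [] := fun x => by rw [hf4, rootLabel_encode]
    -- The state at the child is both a subblock of the block at `x` and the restriction of the
    -- block at the child.
    have hstep : ∀ x i w, w.length < H → f (x ++ [i]) w = f x (i :: w) := by
      intro x i w hw
      have h1 := congrFun (List.ofFn_injective (hf5 x)) i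
      rw [hf3] at h1
      exact blockList_eq_iff.1 (Encodable.encode_injective h1) w hw
    -- Descending along `w`, each label inside the block at `x` is the root label of the block at
    -- the corresponding node.
    have hall : ∀ (w x : List (Fin d)), w.length < H + 1 → f x w = f (x ++ w) [] := by
      intro w
      induction w with
      | nil => simp
      | cons i w ih =>
        intro x hw
        rw [List.length_cons] at hw
        rw [← hstep x i w (by omega), ih (x ++ [i]) (by omega), List.append_assoc]
        rfl
    refine ⟨fun x => ?_, fun x => ⟨?_, fun e he => ?_⟩⟩
    · rw [hf4]
      congr 1
      refine blockList_eq_iff.2 fun w hw => ?_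
      rw [hroot, hall w x hw]
    · dsimp only
      rw [hroot]
      exact hf1 x [] (Nat.succ_pos _)
    · convert hf2 x e he using 2
      refine blockList_eq_iff.2 fun w hw => ?_
      have h1 := le_heightBound he
      dsimp only
      rw [hroot, hall w x (by omega)]
  refine Conjugate.of_maps
    (fun t x => Encodable.encode (blockList (H + 1) fun w => t (x ++ w)))
    (fun s x => rootLabel d (s x)) ?_ (fun s hs => (key s hs).2) ?_
    (fun s hs => funext fun x => ((key s hs).1 x).symm) (H + 1) 1 ?_ ?_
  · intro t ht
    refine ⟨fun x => Encodable.encode (blockList H fun w => t (x ++ w)), fun x => ?_⟩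
    rw [mem_transitions_sftAutomaton, mem_sftTransitions]
    refine ⟨fun w => t (x ++ w), fun w _ => (ht _).1, (ht x).2, ?_⟩
    rw [blockTransition_blockList]
    simp [hH]
  · intro t _
    funext x
    rw [rootLabel_encode, List.append_nil]
  · intro t _ t' _ x x' h
    exact congrArg _ (blockList_eq_iff.2 h)
  · intro t _ t' _ x x' h
    simpa using congrArg (rootLabel d) (h [] (by simp))

/-! ### Computability -/

section

open Primrec

variable {α β : Type} [Primcodable α] [Primcodable β]

theorem primrec_filter {l : α → List β} {p : α → β → Bool} (hl : Primrec l) (hp : Primrec₂ p) :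
    Primrec fun x => (l x).filter (p x) := by
  refine (list_flatMap hl (g := fun x b => bif p x b then [b] else [])
    (Primrec.cond hp (list_cons.comp snd (const [])) (const []))).of_eq fun x => ?_
  induction l x with
  | nil => rfl
  | cons b l ih =>
    rw [List.flatMap_cons, ih, List.filter_cons]
    cases p x b <;> rfl

theorem primrec_all {l : α → List β} {p : α → β → Bool} (hl : Primrec l) (hp : Primrec₂ p) :
    Primrec fun x => (l x).all (p x) := by
  refine (list_foldr hl (const true) (h := fun x y => p x y.1 && y.2) (Primrec.and.comp
    (hp.comp fst (fst.comp snd)) (snd.comp snd))).of_eq fun x => ?_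
  induction l x with
  | nil => rfl
  | cons b l ih => rw [List.foldr_cons, ih, List.all_cons]

theorem primrec_sum {l : α → List ℕ} (hl : Primrec l) : Primrec fun x => (l x).sum :=
  list_foldr hl (const 0) (h := fun _ y => y.1 + y.2)
    (nat_add.comp (fst.comp snd) (snd.comp snd))

theorem primrec_words : Primrec (words d) := by
  have hmap : Primrec₂ fun (p : ℕ × List (List (Fin d))) (i : Fin d) =>
      p.2.map fun w => i :: w :=
    list_map (f := fun q : (ℕ × List (List (Fin d))) × Fin d => q.1.2)
      (g := fun q w => q.2 :: w) (snd.comp fst) (list_cons.comp (snd.comp fst) snd)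
  have hstep : Primrec₂ fun (_ : ℕ) (l : List (List (Fin d))) =>
      [] :: (List.finRange d).flatMap fun i => l.map fun w => i :: w :=
    list_cons.comp (const ([] : List (Fin d))) (list_flatMap (const _) hmap)
  refine (nat_rec₁ [] hstep).of_eq fun h => ?_
  induction h with
  | zero => rfl
  | succ h ih => rw [words, ← ih]

theorem primrec_labellings :
    Primrec₂ fun (k : ℕ) (ws : List (List (Fin d))) => labellings k ws := by
  let α := (ℕ × List (List (Fin d))) × List (Fin d) × List (List (List (Fin d) × ℕ))
  have hmap : Primrec₂ fun (x : α) (a : ℕ) => x.2.2.map fun b => (x.2.1, a) :: b :=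
    list_map (f := fun q : α × ℕ => q.1.2.2) (g := fun q b => (q.1.2.1, q.2) :: b)
      (snd.comp (snd.comp fst))
      (list_cons.comp (Primrec.pair (fst.comp (snd.comp (fst.comp fst))) (snd.comp fst)) snd)
  exact list_foldr snd (const [[]]) (h := fun x y => (List.range x.1).flatMap fun a =>
    y.2.map fun b => (y.1, a) :: b) (list_flatMap (list_range.comp (fst.comp fst)) hmap)

theorem primrec_restrict :
    Primrec₂ fun (j : ℕ) (b : List (List (Fin d) × ℕ)) => restrict j b :=
  primrec_filter snd (nat_lt.comp (list_length.comp (fst.comp snd)) (fst.comp fst)).decide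

theorem primrec_childList :
    Primrec₂ fun (i : Fin d) (b : List (List (Fin d) × ℕ)) => childList i b :=
  list_map (primrec_filter snd (Primrec.eq.comp (list_head?.comp (fst.comp snd))
    (option_some.comp (fst.comp fst))).decide)
    (Primrec.pair (list_tail.comp (fst.comp snd)) (snd.comp snd))

theorem primrec_allowed :
    Primrec₂ fun (F : List (ℕ × List ℕ)) (b : List (List (Fin d) × ℕ)) => allowed F b :=
  primrec_all fst (Primrec.not.comp (Primrec.eq.comp (list_map (primrec_restrict.comp
    (fst.comp snd) (snd.comp fst)) (snd.comp snd).to₂) (snd.comp snd)).decide)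

theorem primrec_blockTransition :
    Primrec₂ fun (h : ℕ) (b : List (List (Fin d) × ℕ)) => blockTransition h b :=
  Primrec.pair (Primrec.encode.comp primrec_restrict) (Primrec.pair (Primrec.encode.comp snd)
    (list_map (const _) (Primrec.encode.comp (primrec_childList.comp snd (snd.comp fst)))))

theorem primrec_sftTransitions : Primrec fun c : ℕ × List (ℕ × List ℕ) => sftTransitions d c := by
  have hH : Primrec fun c : ℕ × List (ℕ × List ℕ) => heightBound c.2 :=
    primrec_sum (list_map snd (fst.comp snd))
  refine list_map (primrec_filter (primrec_labellings.comp fst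
    (primrec_words.comp (succ.comp hH))) ?_) ?_
  · exact primrec_allowed.comp (snd.comp fst) snd
  · exact primrec_blockTransition.comp (hH.comp fst) snd

theorem primrec_trBound : Primrec trBound :=
  succ.comp (primrec_sum (list_map Primrec.id (nat_add.comp (fst.comp snd) (nat_add.comp
    (fst.comp (snd.comp snd)) (primrec_sum (snd.comp (snd.comp snd)))))))

theorem primrec_sftAutomaton : Primrec fun c : ℕ × List (ℕ × List ℕ) => sftAutomaton d c :=
  have h := primrec_trBound.comp (primrec_sftTransitions (d := d))
  Primrec.pair h (Primrec.pair h primrec_sftTransitions)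

end

theorem computablePred_sft (hd : 1 ≤ d) :
    ComputablePred (fun c : ℕ × List (ℕ × List ℕ) => IsConjugateToHom (sftOfCode d c)) := by
  refine ComputablePred.computable_of_manyOneReducible ⟨_,
    (primrec_sftAutomaton (d := d)).to_comp, fun c => ?_⟩ (Tr.computablePred_homCheck hd)
  change IsConjugateToHom (sftOfCode d c) ↔ _
  rw [IsConjugateToHom.congr (sftOfCode_conjugate c), IsConjugateToHom.congr (numShift_conjugate c),
    ← IsConjugateToHom.congr (Tr.code_conjugate (sftAutomaton d c))]
  -- The constructed automaton always has distinct labels, so the edge condition in the decided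
  -- predicate is harmless.
  exact (and_iff_right (sftAutomaton_isEdge c)).symm

end TreeShift

/-! ### The proposition -/

theorem mainTheorem2 (d : ℕ) (hd : 1 ≤ d) :
    -- decidability for edge tree-shifts, given by edge tree automata
    ComputablePred (fun c : ℕ × ℕ × List (ℕ × ℕ × List ℕ) =>
      (TreeShift.automatonOfCode d c).IsEdge ∧
        TreeShift.IsConjugateToHom (TreeShift.automatonOfCode d c).shift) ∧
    -- decidability for tree-shifts of finite type, given by forbidden blocks
    ComputablePred (fun c : ℕ × List (ℕ × List ℕ) =>
      TreeShift.IsConjugateToHom (TreeShift.sftOfCode d c)) ∧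
    -- the criterion
    (∀ 𝒜 : TreeAutomaton d, 𝒜.IsEdge → 𝒜.IsTrim →
      (∃ ℬ, 𝒜.IsTotalAmalgamation ℬ) ∧
      ∀ ℬ, 𝒜.IsTotalAmalgamation ℬ →
        (TreeShift.IsConjugateToHom 𝒜.shift ↔ ℬ.IsRegular)) ∧
    -- the criterion is checked in polynomial time and space
    (∃ (prog : WhileProg.Cmd) (P : Polynomial ℕ),
      ∀ (n k : ℕ) (L : List (Fin n × Fin k × (Fin d → Fin n))), L.Nodup →
        (TreeShift.automatonOfCode d (TreeShift.codeOfList L)).IsEdge →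
        (TreeShift.automatonOfCode d (TreeShift.codeOfList L)).IsTrim →
        ∀ ℬ, (TreeShift.automatonOfCode d (TreeShift.codeOfList L)).IsTotalAmalgamation ℬ →
          WhileProg.DecidesWithin prog (WhileProg.encodeAutomaton (TreeShift.codeOfList L))
            (P.eval (n + k + L.length)) ℬ.IsRegular) := by
  refine ⟨Tr.computablePred_homCheck hd, TreeShift.computablePred_sft hd,
    fun 𝒜 hA hAt => ⟨𝒜.exists_isTotalAmalgamation hA hAt,
      fun ℬ h => h.isConjugateToHom_iff hd hA hAt⟩, ?_⟩
  obtain ⟨prog, P, h⟩ := Tr.exists_program hd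
  refine ⟨prog, P, fun n k L _ hE hT ℬ hB => ?_⟩
  -- The program decides conjugacy to a Hom tree-shift, which by the criterion is regularity of any
  -- total amalgamation.
  rw [← hB.isConjugateToHom_iff hd hE hT]
  exact h n k L hE
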